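/- **Setting.** Let $d\ge 1$ and let $\Omega\subset\mathbb R^d$ be a bounded polytopal domain with a finite conforming simplicial mesh $\mathcal T_H$ such that any two elements containing a common node are joined by a chain of elements containing this node in which consecutive elements share a facet containing it. Let $\partial\Omega=\Gamma_D\cup\Gamma_N$, where $\Gamma_D$ is a nonempty union of boundary facets and $\Gamma_N$ is made of the other ones. Let $f\in L^2(\Omega)$, $g\in L^2(\Gamma_N)$, and let $\mathbb A$ be a measurable symmetric matrix field with $\alpha|\xi|^2\le \mathbb A(x)\xi\cdot\xi\le\beta|\xi|^2$ for all $\xi$ and a.e. $x\in\Omega$, for some $\alpha>0$ (the fine scale $\varepsilon$ is fixed and omitted). Put $V=\{v\in H^1(\Omega): v=0\text{ on }\Gamma_D\}$, $B(u,v)=\int_\Omega \mathbb A\nabla u\cdot\nabla v$, $B_H(u,v)=\sum_K\int_K \mathbb A\nabla u\cdot\nabla v$, $F(v)=\int_\Omega fv+\int_{\Gamma_N}gv$, $|||v|||=B(v,v)^{1/2}$, $|||v|||_H=B_H(v,v)^{1/2}$, $|||p|||_{\mathcal F}=(\int_\Omega \mathbb A^{-1}p\cdot p)^{1/2}$ and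 $E_{CRE}(v,p)=|||p-\mathbb A\nabla v|||_{\mathcal F}$. Let $u\in V$ solve $B(u,v)=F(v)$ for all $v\in V$, let $q=\mathbb A\nabla u$, and let $W$ be the set of $p\in H(\mathrm{div},\Omega)$ with $\nabla\cdot p+f=0$ in $\Omega$ and $p\cdot n=g$ on $\Gamma_N$ (normal trace in the weak sense, tested with $V$). **Discrete solution.** Let $\varphi_i^0$ be the piecewise affine Lagrange basis functions of all nodes; a node is free if it is not on $\Gamma_D$. Let $u_H\in \mathrm{span}\{\varphi_i: i\text{ free}\}$ satisfy $B_H(u_H,v)=F(v)$ for all $v\in\mathrm{span}\{\varphi^\star_i: i \text{ free}\}$, where either (conforming MsFEM) $\varphi_i=\varphi_i^\star$ and, on each element $K$, $\nabla\cdot(\mathbb A\nabla\varphi_i)=0$ in $K$, $\varphi_i=\varphi_i^0$ on $\partial K$; or (Petrov–Galerkin) $\varphi^\star_i=\varphi_i^0$ and the trial functions $\varphi_i$ are arbitrary functions that are $H^1$ on each element (for instance oversampled multiscale functions, possibly discontinuous across facets). Put $q_H=\mathbb A\nabla u_H$ elementwise and $Q_i^K=\int_K(q_H\cdot\nabla\varphi_i^\star-f\varphi_i^\star)$.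 **Tractions.** Order the elements. For a facet $\Gamma$ of $K$ let $\eta_K^\Gamma=-1$ if $\Gamma$ is shared with a larger element and $\eta_K^\Gamma=+1$ otherwise. A square integrable function $\hat g$ on the facets defines $\hat g_K=\eta_K^\Gamma\hat g$ on each facet $\Gamma$ of $K$. Call $\hat g$ a prolongation traction if $\hat g=g$ on $\Gamma_N$ and $\int_{\partial K}\hat g_K\varphi_i^\star=Q_i^K$ for every element $K$ and every vertex $i$ of $K$. Given reference tractions $m$, square integrable on every facet (e.g. the signed averaged normal flux of $u_H$, when it is square integrable), the construction is the following. For every node $i$, choose numbers $\hat b_i^\Gamma$ ($\Gamma\ni i$) with $\sum_{\Gamma\subset\partial K,\,\Gamma\ni i}\eta_K^\Gamma\hat b_i^\Gamma=Q_i^K$ for all $K\ni i$ and $\hat b_i^\Gamma=\int_\Gamma g\varphi_i^\star$ for $\Gamma\subset\Gamma_N$, which minimize $\sum_{\Gamma\ni i,\ \Gamma\not\subset\Gamma_N}|\Gamma|^{-2}(\hat b_i^\Gamma-\int_\Gamma m\varphi_i^\star)^2$. Then put $\hat g=g$ on $\Gamma_N$ and, on every other facet $\Gamma$, $\hat g=m+\sum_{i\in\Gamma}a_i^\Gamma\varphi_i^\star$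 with $a_i^\Gamma$ such that $\int_\Gamma\hat g\varphi^\star_i=\hat b_i^\Gamma$ for all nodes $i$ of $\Gamma$. **Claim.** 1. $\sum_{i\in K}\varphi^\star_i=1$ a.e. in $K$, for every element $K$. 2. For every $m$, the construction can be carried out, its result $\hat g$ is unique a.e. on the facets, and it is a prolongation traction. 3. In the conforming case, $u_H\in V$. 4. For every prolongation traction $\hat g$: (a) $\int_K f+\int_{\partial K}\hat g_K=0$ for every $K$. (b) For every $K$, the Neumann problem of finding $w\in H^1(K)$ with $\int_K\mathbb A\nabla w\cdot\nabla v=\int_K fv+\int_{\partial K}\hat g_Kv$ for all $v\in H^1(K)$ has a solution, which is unique up to an additive constant, and $\hat q=\mathbb A\nabla w$ satisfies $-\nabla\cdot \hat q=f$ in $K$, $\hat q\cdot n_K=\hat g_K$ on $\partial K$. In particular, a flux $\hat q$ assembled from such local fluxes exists. (c) Every flux $\hat q$ with $\hat q|_K\in H(\mathrm{div},K)$, $-\nabla\cdot\hat q=f$ in $K$ and $\hat q\cdot n_K=\hat g_K$ on $\partial K$ for every $K$ belongs to $W$. If $u_H\in V$ (in particular for conforming MsFEM), then $$|||u-u_H|||\le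 E_{CRE}(u_H,\hat q),\qquad |||u-u_H|||^2+|||q-\hat q|||_{\mathcal F}^2=E_{CRE}(u_H,\hat q)^2 .$$ In all cases, for every $\hat u\in V$, $$|||u-\hat u|||=E_{CRE}(\hat u,q)\le E_{CRE}(\hat u,\hat q),\qquad |||u-\hat u|||^2+|||q-\hat q|||_{\mathcal F}^2=E_{CRE}(\hat u,\hat q)^2,$$ $$|||u-u_H|||_H\le E_{CRE}(\hat u,\hat q)+|||\hat u-u_H|||_H .$$ -/

import Mathlib

open MeasureTheory Filter Topology
open scoped ENNReal ContDiff InnerProductSpace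

noncomputable section

namespace MsFEM

/-- The ambient Euclidean space `ℝ^d`. -/
abbrev E (d : ℕ) : Type := EuclideanSpace ℝ (Fin d)

/-- A scalar field together with a vector field that plays the role of its (weak or broken)
gradient: `v.1` is the function and `v.2` its gradient. Whether `v.2` really is the weak gradient
of `v.1` on an open set `U` is expressed by `MemH1 U v`. -/
abbrev Field (d : ℕ) : Type := (E d → ℝ) × (E d → E d)

variable {d : ℕ}

/-! ### Sobolev spaces, traces, divergences -/

/-- Smooth functions with compact support in `U`. -/
def IsTestFunction (U : Set (E d)) (φ : E d → ℝ) : Prop :=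
  ContDiff ℝ ∞ φ ∧ HasCompactSupport φ ∧ tsupport φ ⊆ U

/-- `v ∈ H¹(U)`, with `v.2` the weak gradient of `v.1` on `U`. -/
structure MemH1 (U : Set (E d)) (v : Field d) : Prop where
  memLp : MemLp v.1 2 (volume.restrict U)
  memLp_grad : MemLp v.2 2 (volume.restrict U)
  weak_grad : ∀ φ, IsTestFunction U φ →
    ∫ x in U, v.1 x • gradient φ x = - ∫ x in U, φ x • v.2 x

/-- `ψ n → v` in `H¹(U)`, for functions `ψ n` that are differentiable in the classical sense. -/
def TendstoH1 (U : Set (E d)) (ψ : ℕ → E d → ℝ) (v : Field d) : Prop :=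
  Tendsto (fun n => eLpNorm (fun x => ψ n x - v.1 x) 2 (volume.restrict U)) atTop (𝓝 0) ∧
  Tendsto (fun n => eLpNorm (fun x => gradient (ψ n) x - v.2 x) 2 (volume.restrict U))
    atTop (𝓝 0)

/-- `v ∈ H¹₀(U)`: the closure of the test functions in `H¹(U)`. -/
def MemH10 (U : Set (E d)) (v : Field d) : Prop :=
  MemH1 U v ∧ ∃ ψ : ℕ → E d → ℝ, (∀ n, IsTestFunction U (ψ n)) ∧ TendstoH1 U ψ v

/-- The `(d-1)`-dimensional surface measure in `ℝ^d`. -/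
def surf (d : ℕ) : Measure (E d) := Measure.euclideanHausdorffMeasure (d - 1)

/-- The closed simplex (or facet) with vertex set `K`. -/
def hull (K : Finset (E d)) : Set (E d) := convexHull ℝ (K : Set (E d))

/-- The open simplex with vertex set `K` (for a `d`-dimensional simplex `K`). -/
def openHull (K : Finset (E d)) : Set (E d) := interior (hull K)

/-- `τ ∈ L²(∂K)` is the trace of `v ∈ H¹(K)`: the trace operator is the continuous extension
from smooth functions to `H¹(K)` of the restriction to `∂K`. -/
def IsTrace (K : Finset (E d)) (v : Field d) (τ : E d → ℝ) : Prop :=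
  MemLp τ 2 ((surf d).restrict (frontier (hull K))) ∧
  ∃ ψ : ℕ → E d → ℝ, (∀ n, ContDiff ℝ ∞ (ψ n)) ∧ TendstoH1 (openHull K) ψ v ∧
    Tendsto (fun n => eLpNorm (fun x => ψ n x - τ x) 2 ((surf d).restrict (frontier (hull K))))
      atTop (𝓝 0)

open Classical in
/-- The trace on `∂K` of `v ∈ H¹(K)` (it is determined almost everywhere on `∂K`). -/
def trace (K : Finset (E d)) (v : Field d) : E d → ℝ :=
  if h : ∃ τ, IsTrace K v τ then h.choose else 0

/-- `∇ · p = h` on `U` in the sense of distributions. -/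
def HasWeakDiv (U : Set (E d)) (p : E d → E d) (h : E d → ℝ) : Prop :=
  ∀ φ, IsTestFunction U φ → ∫ x in U, ⟪p x, gradient φ x⟫_ℝ = - ∫ x in U, h x * φ x

/-! ### Simplicial meshes -/

/-- A conforming simplicial mesh of a bounded polytopal domain in `ℝ^d`. -/
structure Mesh (d : ℕ) where
  /-- the simplices of all dimensions, given by their vertex sets -/
  complex : Geometry.SimplicialComplex ℝ (E d)
  finite : complex.faces.Finite
  /-- every simplex is a face of a `d`-dimensional one -/
  pure : ∀ s ∈ complex.faces, ∃ K ∈ complex.faces, s ⊆ K ∧ K.card = d + 1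
  /-- the meshed open set is connected, hence is a domain -/
  connected : IsConnected (interior complex.space)
  /-- any two elements containing a node are joined by a chain of elements which contain this
  node and successively share a facet containing this node (this excludes, for example, two
  parts of the domain that touch at one point only) -/
  patch_connected : ∀ (x : E d), ∀ K ∈ complex.faces, ∀ L ∈ complex.faces,
    K.card = d + 1 → L.card = d + 1 → x ∈ K → x ∈ L →
    Relation.ReflTransGen
      (fun M M' : Finset (E d) => M ∈ complex.faces ∧ M' ∈ complex.faces ∧
        M.card = d + 1 ∧ M'.card = d + 1 ∧
        ∃ F : Finset (E d), F.card = d ∧ x ∈ F ∧ F ⊆ M ∧ F ⊆ M') K L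

namespace Mesh

/-- The domain `Ω`. -/
def Ω (T : Mesh d) : Set (E d) := interior T.complex.space

/-- The elements `K` of the mesh. -/
def elements (T : Mesh d) : Finset (Finset (E d)) :=
  T.finite.toFinset.filter (fun s => s.card = d + 1)

/-- The facets `Γ` of the mesh (edges of triangles for `d = 2`). The facets of an element `K` are
the members of `K.powersetCard d`. -/
def facets (T : Mesh d) : Finset (Finset (E d)) :=
  T.finite.toFinset.filter (fun s => s.card = d)

open Classical in
/-- The facets on `∂Ω`: those which belong to exactly one element. -/
def boundaryFacets (T : Mesh d) : Finset (Finset (E d)) :=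
  T.facets.filter (fun F => (T.elements.filter (fun K => F ⊆ K)).card = 1)

/-- The nodes of the mesh. -/
def nodes (T : Mesh d) : Set (E d) := {x | ∃ K ∈ T.elements, x ∈ K}

open Classical in
/-- The trace on the facet `F`, taken from an element that has this facet. For `v ∈ H¹(Ω)` it
does not depend on the element that is chosen. -/
def facetTrace (T : Mesh d) (F : Finset (E d)) (v : Field d) : E d → ℝ :=
  if h : ∃ K ∈ T.elements, F ⊆ K then trace h.choose v else 0

/-- The elementwise Sobolev space `H¹(𝒯)`. -/
def MemBrokenH1 (T : Mesh d) (v : Field d) : Prop := ∀ K ∈ T.elements, MemH1 (openHull K) v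

open Classical in
/-- The orientation `η_K^Γ = ±1`, for an ordering of the elements given by the ranks `rk`. -/
def orient (T : Mesh d) (rk : Finset (E d) → ℕ) (K F : Finset (E d)) : ℝ :=
  if ∃ L ∈ T.elements, F ⊆ L ∧ rk K < rk L then -1 else 1

/-- `∫_{∂K} ĝ_K v`, where `ĝ_K = η_K^Γ ĝ` on every facet `Γ` of `K`. -/
def tractionWork (T : Mesh d) (rk : Finset (E d) → ℕ) (ghat : E d → ℝ) (K : Finset (E d))
    (v : Field d) : ℝ :=
  ∑ F ∈ K.powersetCard d, T.orient rk K F * ∫ x in hull F, ghat x * trace K v x ∂(surf d)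

/-- `∫_{∂K} ĝ_K`. -/
def tractionResultant (T : Mesh d) (rk : Finset (E d) → ℕ) (ghat : E d → ℝ)
    (K : Finset (E d)) : ℝ :=
  ∑ F ∈ K.powersetCard d, T.orient rk K F * ∫ x in hull F, ghat x ∂(surf d)

/-- The continuous piecewise affine Lagrange basis `φ⁰_i`, with its piecewise constant gradient. -/
def IsHatBasis (T : Mesh d) (φ0 : E d → Field d) : Prop :=
  ∀ i ∈ T.nodes, ∀ K ∈ T.elements, ∃ a : E d →ᵃ[ℝ] ℝ,
    (∀ j ∈ K, (j = i → a j = 1) ∧ (j ≠ i → a j = 0)) ∧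
    (∀ x ∈ hull K, (φ0 i).1 x = a x) ∧
    (∀ x ∈ openHull K, (φ0 i).2 x = gradient (fun y => a y) x)

end Mesh

/-! ### The model problem -/

/-- `M ξ`. -/
def act (M : Matrix (Fin d) (Fin d) ℝ) (ξ : E d) : E d := Matrix.toEuclideanLin M ξ

/-- The data of the problem `-∇·(A∇u) = f` in `Ω`, `u = 0` on `Γ_D`, `(A∇u)·n = g` on `Γ_N`. -/
structure Problem (d : ℕ) where
  mesh : Mesh d
  /-- the facets that make up `Γ_D`; the other boundary facets make up `Γ_N` -/
  D : Finset (Finset (E d))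
  D_subset : D ⊆ mesh.boundaryFacets
  D_nonempty : D.Nonempty
  A : E d → Matrix (Fin d) (Fin d) ℝ
  A_meas : ∀ i j, AEStronglyMeasurable (fun x => A x i j) (volume.restrict mesh.Ω)
  A_symm : ∀ᵐ x ∂(volume.restrict mesh.Ω), (A x).IsSymm
  α : ℝ
  β : ℝ
  α_pos : 0 < α
  A_elliptic : ∀ᵐ x ∂(volume.restrict mesh.Ω), ∀ ξ : E d,
    α * ‖ξ‖ ^ 2 ≤ ⟪act (A x) ξ, ξ⟫_ℝ ∧ ⟪act (A x) ξ, ξ⟫_ℝ ≤ β * ‖ξ‖ ^ 2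
  f : E d → ℝ
  f_memLp : MemLp f 2 (volume.restrict mesh.Ω)
  g : E d → ℝ
  g_memLp : ∀ F ∈ mesh.boundaryFacets, F ∉ D → MemLp g 2 ((surf d).restrict (hull F))

namespace Problem

variable (P : Problem d)

open Classical in
/-- The facets that make up `Γ_N`. -/
def neumannFacets : Finset (Finset (E d)) := P.mesh.boundaryFacets \ P.D

/-- The nodes that do not lie on `Γ_D`. -/
def freeNodes : Set (E d) := {i | i ∈ P.mesh.nodes ∧ ∀ F ∈ P.D, i ∉ F}

/-- The flux `A ∇v`. -/
def flux (v : Field d) : E d → E d := fun x => act (P.A x) (v.2 x)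

/-- `∫_U (A∇u)·∇v`. -/
def bilinOn (U : Set (E d)) (u v : Field d) : ℝ := ∫ x in U, ⟪P.flux u x, v.2 x⟫_ℝ

/-- `B(u,v) = ∫_Ω (A∇u)·∇v`. -/
def bilin (u v : Field d) : ℝ := P.bilinOn P.mesh.Ω u v

/-- `B_H(u,v) = ∑_K ∫_K (A∇u)·∇v`. -/
def brokenBilin (u v : Field d) : ℝ := ∑ K ∈ P.mesh.elements, P.bilinOn (hull K) u v

/-- `∫_{Γ_N} g v`. -/
def neumannWork (v : Field d) : ℝ :=
  ∑ F ∈ P.neumannFacets, ∫ x in hull F, P.g x * P.mesh.facetTrace F v x ∂(surf d)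

/-- `F(v) = ∫_Ω f v + ∫_{Γ_N} g v`. -/
def load (v : Field d) : ℝ := (∫ x in P.mesh.Ω, P.f x * v.1 x) + P.neumannWork v

/-- `V = {v ∈ H¹(Ω) : v = 0 on Γ_D}`. -/
def V : Set (Field d) :=
  {v | MemH1 P.mesh.Ω v ∧
    ∀ F ∈ P.D, P.mesh.facetTrace F v =ᵐ[(surf d).restrict (hull F)] 0}

/-- `u` is the weak solution: `u ∈ V` and `B(u,v) = F(v)` for all `v ∈ V`. -/
def IsWeakSolution (u : Field d) : Prop := u ∈ P.V ∧ ∀ v ∈ P.V, P.bilin u v = P.load v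

/-- The energy norm `|||v||| = B(v,v)^{1/2}`. -/
def energyNorm (v : Field d) : ℝ := Real.sqrt (P.bilin v v)

/-- The broken energy norm `|||v|||_H = B_H(v,v)^{1/2}`. -/
def brokenEnergyNorm (v : Field d) : ℝ := Real.sqrt (P.brokenBilin v v)

/-- The energy norm of fluxes, `|||p|||_F = (∫_Ω A⁻¹p·p)^{1/2}`. -/
def fluxNorm (p : E d → E d) : ℝ :=
  Real.sqrt (∫ x in P.mesh.Ω, ⟪act ((P.A x)⁻¹) (p x), p x⟫_ℝ)

/-- The constitutive relation error `E_CRE(v,p) = |||p - A∇v|||_F`. -/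
def cre (v : Field d) (p : E d → E d) : ℝ := P.fluxNorm (p - P.flux v)

/-- The statically admissible fluxes: `p ∈ H(div,Ω)` with `∇·p + f = 0` in `Ω` and `p·n = g` on
`Γ_N`. The normal trace of a field of `H(div,Ω)` is the functional
`v ↦ ∫_Ω p·∇v + ∫_Ω (∇·p) v`, here on the functions `v` that vanish on `Γ_D`. -/
structure IsStaticallyAdmissible (p : E d → E d) : Prop where
  memLp : MemLp p 2 (volume.restrict P.mesh.Ω)
  weak_div : HasWeakDiv P.mesh.Ω p (fun x => - P.f x)
  normal_trace : ∀ v ∈ P.V,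
    (∫ x in P.mesh.Ω, ⟪p x, v.2 x⟫_ℝ) + (∫ x in P.mesh.Ω, (- P.f x) * v.1 x) = P.neumannWork v

/-! ### The multiscale method -/

/-- The conforming multiscale basis: on every element `K`, `∇·(A∇φ_i) = 0` in `K` and
`φ_i = φ⁰_i` on `∂K`. -/
def IsMsFEMBasis (φ0 φ : E d → Field d) : Prop :=
  ∀ i ∈ P.mesh.nodes, ∀ K ∈ P.mesh.elements,
    MemH1 (openHull K) (φ i) ∧ HasWeakDiv (openHull K) (P.flux (φ i)) 0 ∧
    MemH10 (openHull K) (φ i - φ0 i)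

/-- The span of the basis functions of the nodes that do not lie on `Γ_D`. -/
def space (φ : E d → Field d) : Submodule ℝ (Field d) :=
  Submodule.span ℝ (φ '' P.freeNodes)

/-- Conforming multiscale method: trial functions `φ` and test functions `φs` are both the
conforming multiscale basis. -/
def IsConforming (φ0 φ φs : E d → Field d) : Prop := P.IsMsFEMBasis φ0 φ ∧ φs = φ

/-- Petrov-Galerkin method: the test functions `φs` are the piecewise affine functions, and the
trial functions `φ` are arbitrary functions that are `H¹` on every element; in particular, they
may be multiscale functions computed by oversampling, discontinuous across the facets. -/
def IsPetrovGalerkin (φ0 φ φs : E d → Field d) : Prop :=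
  (∀ i ∈ P.freeNodes, P.mesh.MemBrokenH1 (φ i)) ∧ φs = φ0

/-- The discrete problem with trial functions `φ` and test functions `φs`. -/
def IsDiscreteSolution (φ φs : E d → Field d) (uH : Field d) : Prop :=
  uH ∈ P.space φ ∧ ∀ v ∈ P.space φs, P.brokenBilin uH v = P.load v

/-! ### Tractions and elementwise fluxes -/

/-- `Q_i^K = ∫_K (q_H·∇φ_i - f φ_i)` with `q_H = A∇u_H`. -/
def nodalResidual (φs : E d → Field d) (uH : Field d) (K : Finset (E d)) (i : E d) : ℝ :=
  ∫ x in hull K, (⟪P.flux uH x, (φs i).2 x⟫_ℝ - P.f x * (φs i).1 x)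

/-- Tractions `ĝ` (one square integrable function on the facets, which gives `ĝ_K = η_K^Γ ĝ`)
with `ĝ = g` on `Γ_N` that satisfy the prolongation condition `∫_{∂K} ĝ_K φ_i = Q_i^K` for every
element `K` and every node `i` of `K`. -/
structure IsProlongation (rk : Finset (E d) → ℕ) (φs : E d → Field d) (uH : Field d)
    (ghat : E d → ℝ) : Prop where
  memLp : ∀ F ∈ P.mesh.facets, MemLp ghat 2 ((surf d).restrict (hull F))
  neumann : ∀ F ∈ P.neumannFacets, ghat =ᵐ[(surf d).restrict (hull F)] P.g
  prolongation : ∀ K ∈ P.mesh.elements, ∀ i ∈ K,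
    P.mesh.tractionWork rk ghat K (φs i) = P.nodalResidual φs uH K i

/-- `∫_Γ h φ_i` for a facet `Γ`. -/
def projection (φs : E d → Field d) (h : E d → ℝ) (i : E d) (F : Finset (E d)) : ℝ :=
  ∫ x in hull F, h x * P.mesh.facetTrace F (φs i) x ∂(surf d)

open Classical in
/-- The local system on the patch of the node `i`, for the projections `b F = ∫_F ĝ φ_i` on the
facets `F` containing `i`. -/
def PatchSystem (rk : Finset (E d) → ℕ) (φs : E d → Field d) (uH : Field d) (i : E d)
    (b : Finset (E d) → ℝ) : Prop :=
  (∀ K ∈ P.mesh.elements, i ∈ K →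
    ∑ F ∈ (K.powersetCard d).filter (fun F => i ∈ F), P.mesh.orient rk K F * b F =
      P.nodalResidual φs uH K i) ∧
  ∀ F ∈ P.neumannFacets, i ∈ F → b F = P.projection φs P.g i F

open Classical in
/-- The least squares cost function, with respect to reference tractions `m`. -/
def patchCost (φs : E d → Field d) (m : E d → ℝ) (i : E d) (b : Finset (E d) → ℝ) : ℝ :=
  ∑ F ∈ P.mesh.facets.filter (fun F => i ∈ F ∧ F ∉ P.neumannFacets),
    (b F - P.projection φs m i F) ^ 2 / ((surf d).real (hull F)) ^ 2

/-- `ĝ` is built from the reference tractions `m` (for example, from the mean normal fluxes of the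
discrete solution): the projections `b` solve the patch systems with least cost; `ĝ = g` on
`Γ_N`; on every other facet, `ĝ` is `m` plus a combination of the test functions of the nodes of
that facet, such that the projections of `ĝ` are those given by `b`. -/
def IsBuiltTraction (rk : Finset (E d) → ℕ) (φs : E d → Field d) (uH : Field d)
    (m ghat : E d → ℝ) : Prop :=
  ∃ (b a : E d → Finset (E d) → ℝ),
    (∀ i ∈ P.mesh.nodes, P.PatchSystem rk φs uH i (b i) ∧
      ∀ b', P.PatchSystem rk φs uH i b' → P.patchCost φs m i (b i) ≤ P.patchCost φs m i b') ∧
    (∀ F ∈ P.neumannFacets, ghat =ᵐ[(surf d).restrict (hull F)] P.g) ∧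
    (∀ F ∈ P.mesh.facets, F ∉ P.neumannFacets →
      (ghat =ᵐ[(surf d).restrict (hull F)]
        fun x => m x + ∑ i ∈ F, a i F * P.mesh.facetTrace F (φs i) x) ∧
      ∀ i ∈ F, P.projection φs ghat i F = b i F)

/-- The local Neumann problem: `w ∈ H¹(K)` with
`∫_K (A∇w)·∇v = ∫_K f v + ∫_{∂K} ĝ_K v` for all `v ∈ H¹(K)`. -/
def IsNeumannSolution (rk : Finset (E d) → ℕ) (ghat : E d → ℝ) (K : Finset (E d))
    (w : Field d) : Prop :=
  MemH1 (openHull K) w ∧ ∀ v, MemH1 (openHull K) v →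
    P.bilinOn (hull K) w v =
      (∫ x in hull K, P.f x * v.1 x) + P.mesh.tractionWork rk ghat K v

/-- The fluxes `q` on `K` with `-∇·q = f` in `K` and `q·n_K = ĝ_K` on `∂K`. -/
structure IsElementFlux (rk : Finset (E d) → ℕ) (ghat : E d → ℝ) (K : Finset (E d))
    (q : E d → E d) : Prop where
  memLp : MemLp q 2 (volume.restrict (openHull K))
  weak_div : HasWeakDiv (openHull K) q (fun x => - P.f x)
  normal_trace : ∀ v, MemH1 (openHull K) v →
    (∫ x in hull K, ⟪q x, v.2 x⟫_ℝ) + (∫ x in hull K, (- P.f x) * v.1 x) =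
      P.mesh.tractionWork rk ghat K v

end Problem

end MsFEM

end

open MeasureTheory Filter Topology
open scoped ENNReal ContDiff InnerProductSpace

noncomputable section

namespace MsFEM

set_option linter.unusedSectionVars false

variable {d : ℕ}

section

/-! ### Square integrable functions -/

section L2
variable {X : Type*} [MeasurableSpace X] {μ : Measure X}
variable {F : Type*} [NormedAddCommGroup F] [InnerProductSpace ℝ F]

/-! The error bounds rest on the Prager–Synge orthogonality. If `qhat` is statically admissible and
`u` is the weak solution, then `qhat` and `A∇u` have the same divergence and the same normal trace
on `Γ_N`, so their difference is `L²`-orthogonal to the gradients of `V`. For `v ∈ V`, the splitting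
`qhat - A∇v = (qhat - A∇u) + A∇(u - v)` is therefore orthogonal for the `A⁻¹` product; this is
`IsStaticallyAdmissible.prager_synge`. The bound is obtained by dropping one square, and the
broken-norm bound by a triangle inequality. The rest of the proof shows that admissible fluxes can
be built from the discrete solution.

Both families of test functions have the four properties collected in `Mesh.IsNodalBasis`:
membership of `H¹(Ω)`, barycentric coordinates as traces, support in the patch, and partition of
unity together with its gradient. Multiscale functions inherit them from the hat functions because
the difference lies in `H¹₀` of each element, where an `A`-harmonic function is zero
(`eq_zero_of_memH10`).

The patch systems are solved by duality (`patch_compatible`). A multiplier orthogonal to the columns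
of the incidence matrix takes equal values on two elements sharing an interior facet, because
orientations are opposite there; by connectedness it is constant on the patch. At a free node the
right-hand sides sum to zero by the discrete equation. At a Dirichlet node the equation of a
Dirichlet facet makes the constant zero. Least squares then selects one solution, and the
nonsingular mass matrix of each facet (`IsNodalBasis.coeff_eq_zero`) turns projections into a
traction.

Summing the prolongation conditions over the vertices of an element gives equilibrium
(`IsProlongation.equilibrium`), so the Neumann data annihilate constants. The Poincaré–Wirtinger
inequality bounds them by the gradient alone, and Lax–Milgram applies on the closed space of
gradients (`exists_weak_solution`). Finally, summing the elementwise normal-trace identities cancels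
the interior facets and leaves the work of `g` on `Γ_N` (`isStaticallyAdmissible`).

All this needs traces with respect to Hausdorff measure on facets. Slicing Lebesgue measure parallel
to a facet gives a cone formula, hence the trace inequality for smooth functions
(`IsSimplex.trace_inequality`). Dilation followed by mollification gives their density in `H¹` of a
simplex (`exists_smooth_approx`). Integration by parts near a facet shows that traces taken from its
two sides agree (`trace_eq_trace_of_adjacent`). -/

theorem MemLp.integrable_inner_two {f g : X → F} (hf : MemLp f 2 μ) (hg : MemLp g 2 μ) :
    Integrable (fun x => ⟪f x, g x⟫_ℝ) μ := by
  have := L2.integrable_inner (𝕜 := ℝ) hf.toLp hg.toLp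
  refine this.congr ?_
  filter_upwards [hf.coeFn_toLp, hg.coeFn_toLp] with x h1 h2
  rw [h1, h2]

theorem MemLp.integrable_mul_two {f g : X → ℝ} (hf : MemLp f 2 μ) (hg : MemLp g 2 μ) :
    Integrable (fun x => f x * g x) μ := hf.integrable_mul hg

theorem MemLp.integrable_smul_two {f : X → ℝ} {g : X → F} (hf : MemLp f 2 μ) (hg : MemLp g 2 μ) :
    Integrable (fun x => f x • g x) μ := by
  rw [← memLp_one_iff_integrable]
  exact hg.smul hf

theorem inner_toLp_eq_integral {f g : X → F} (hf : MemLp f 2 μ) (hg : MemLp g 2 μ) :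
    ⟪hf.toLp, hg.toLp⟫_ℝ = ∫ x, ⟪f x, g x⟫_ℝ ∂μ := by
  rw [L2.inner_def]
  refine integral_congr_ae ?_
  filter_upwards [hf.coeFn_toLp, hg.coeFn_toLp] with x h1 h2
  rw [h1, h2]

theorem tendsto_integral_inner_of_eLpNorm {f : ℕ → X → F} {g h : X → F}
    (hf : ∀ n, MemLp (f n) 2 μ) (hg : MemLp g 2 μ) (hh : MemLp h 2 μ)
    (hfg : Tendsto (fun n => eLpNorm (fun x => f n x - g x) 2 μ) atTop (𝓝 0)) :
    Tendsto (fun n => ∫ x, ⟪f n x, h x⟫_ℝ ∂μ) atTop (𝓝 (∫ x, ⟪g x, h x⟫_ℝ ∂μ)) := by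
  have := (Lp.tendsto_Lp_iff_tendsto_eLpNorm'' f hf g hg).2 hfg
  have h2 := this.inner (𝕜 := ℝ) (tendsto_const_nhds (x := hh.toLp))
  simpa only [inner_toLp_eq_integral] using h2

theorem tendsto_integral_mul_of_eLpNorm {f : ℕ → X → ℝ} {g h : X → ℝ}
    (hf : ∀ n, MemLp (f n) 2 μ) (hg : MemLp g 2 μ) (hh : MemLp h 2 μ)
    (hfg : Tendsto (fun n => eLpNorm (fun x => f n x - g x) 2 μ) atTop (𝓝 0)) :
    Tendsto (fun n => ∫ x, f n x * h x ∂μ) atTop (𝓝 (∫ x, g x * h x ∂μ)) := by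
  simpa [mul_comm] using tendsto_integral_inner_of_eLpNorm hf hg hh hfg

/-- This is completeness of `L²` without passing to classes; it produces traces on the boundary and
potentials of limits of gradients. -/
theorem exists_limit_of_eLpNorm_cauchy [CompleteSpace F] {f : ℕ → X → F}
    (hf : ∀ n, MemLp (f n) 2 μ)
    (hc : Tendsto (fun p : ℕ × ℕ => eLpNorm (fun x => f p.1 x - f p.2 x) 2 μ) atTop (𝓝 0)) :
    ∃ g, MemLp g 2 μ ∧ Tendsto (fun n => eLpNorm (fun x => f n x - g x) 2 μ) atTop (𝓝 0) := by
  have hcau : CauchySeq (fun n => (hf n).toLp) := by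
    rw [EMetric.cauchySeq_iff]
    intro ε hε
    obtain ⟨⟨a, b⟩, h⟩ := (eventually_atTop).1 ((tendsto_order.1 hc).2 ε hε)
    refine ⟨max a b, fun m hm n hn => ?_⟩
    rw [Lp.edist_toLp_toLp]
    exact h (m, n) ⟨le_trans (le_max_left _ _) hm, le_trans (le_max_right _ _) hn⟩
  obtain ⟨g, hg⟩ := cauchySeq_tendsto_of_complete hcau
  refine ⟨g, Lp.memLp g, ?_⟩
  have : (Lp.memLp g).toLp = g := Lp.toLp_coeFn g _
  rw [← this] at hg
  exact (Lp.tendsto_Lp_iff_tendsto_eLpNorm'' f hf g (Lp.memLp g)).1 hg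

theorem tendsto_eLpNorm_sub_sub {f : ℕ → X → F} {g : X → F}
    (hf : ∀ n, AEStronglyMeasurable (f n) μ) (hg : AEStronglyMeasurable g μ)
    (hfg : Tendsto (fun n => eLpNorm (fun x => f n x - g x) 2 μ) atTop (𝓝 0)) :
    Tendsto (fun p : ℕ × ℕ => eLpNorm (fun x => f p.1 x - f p.2 x) 2 μ) atTop (𝓝 0) := by
  have h1 : Tendsto (fun p : ℕ × ℕ => eLpNorm (fun x => f p.1 x - g x) 2 μ +
      eLpNorm (fun x => f p.2 x - g x) 2 μ) atTop (𝓝 (0 + 0)) := by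
    rw [← prod_atTop_atTop_eq]
    exact (hfg.comp tendsto_fst).add (hfg.comp tendsto_snd)
  rw [add_zero] at h1
  refine tendsto_of_tendsto_of_tendsto_of_le_of_le tendsto_const_nhds h1 (fun _ => zero_le) ?_
  intro p
  have e : (fun x => f p.1 x - f p.2 x) = (f p.1 - g) - (f p.2 - g) := by ext x; simp
  simp only [e]
  exact eLpNorm_sub_le ((hf p.1).sub hg) ((hf p.2).sub hg) (p := 2) (by norm_num)

theorem tendsto_eLpNorm_add {f f' : ℕ → X → F} {g g' : X → F}
    (hf : ∀ n, AEStronglyMeasurable (f n) μ) (hg : AEStronglyMeasurable g μ)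
    (hf' : ∀ n, AEStronglyMeasurable (f' n) μ) (hg' : AEStronglyMeasurable g' μ)
    (h : Tendsto (fun n => eLpNorm (fun x => f n x - g x) 2 μ) atTop (𝓝 0))
    (h' : Tendsto (fun n => eLpNorm (fun x => f' n x - g' x) 2 μ) atTop (𝓝 0)) :
    Tendsto (fun n => eLpNorm (fun x => (f n x + f' n x) - (g x + g' x)) 2 μ) atTop (𝓝 0) := by
  have h1 := h.add h'
  rw [add_zero] at h1
  refine tendsto_of_tendsto_of_tendsto_of_le_of_le tendsto_const_nhds h1 (fun _ => zero_le) ?_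
  intro n
  have e : (fun x => (f n x + f' n x) - (g x + g' x)) = (f n - g) + (f' n - g') := by
    ext x; simp; abel
  simp only [e]
  exact eLpNorm_add_le ((hf n).sub hg) ((hf' n).sub hg') (p := 2) (by norm_num)

theorem tendsto_eLpNorm_const_smul (c : ℝ) {f : ℕ → X → F} {g : X → F}
    (h : Tendsto (fun n => eLpNorm (fun x => f n x - g x) 2 μ) atTop (𝓝 0)) :
    Tendsto (fun n => eLpNorm (fun x => c • f n x - c • g x) 2 μ) atTop (𝓝 0) := by
  have h1 := ENNReal.Tendsto.const_mul (a := ‖c‖ₑ) h (Or.inr (by simp))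
  rw [mul_zero] at h1
  refine h1.congr fun n => ?_
  rw [← eLpNorm_const_smul]
  congr 1
  ext x; simp [smul_sub]

theorem ae_eq_of_tendsto_eLpNorm {f : ℕ → X → F} {g g' : X → F}
    (hf : ∀ n, AEStronglyMeasurable (f n) μ) (hg : AEStronglyMeasurable g μ)
    (hg' : AEStronglyMeasurable g' μ)
    (h : Tendsto (fun n => eLpNorm (fun x => f n x - g x) 2 μ) atTop (𝓝 0))
    (h' : Tendsto (fun n => eLpNorm (fun x => f n x - g' x) 2 μ) atTop (𝓝 0)) :
    g =ᵐ[μ] g' := by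
  have h1 := h.add h'
  rw [add_zero] at h1
  have h2 : eLpNorm (g - g') 2 μ ≤ 0 := by
    refine ge_of_tendsto' h1 fun n => ?_
    have e : g - g' = (f n - g') - (f n - g) := by ext x; simp
    rw [e, add_comm]
    exact eLpNorm_sub_le ((hf n).sub hg') ((hf n).sub hg) (p := 2) (by norm_num)
  have h3 := (eLpNorm_eq_zero_iff (hg.sub hg') (by norm_num)).1 (le_antisymm h2 zero_le)
  filter_upwards [h3] with x hx
  simpa [sub_eq_zero] using hx

/-- The square of the `L²` norm as an integral. -/
theorem eLpNorm_two_sq (f : X → F) : eLpNorm f 2 μ ^ 2 = ∫⁻ x, ‖f x‖ₑ ^ 2 ∂μ := by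
  have := eLpNorm_nnreal_pow_eq_lintegral (f := f) (μ := μ) (p := 2) (by norm_num)
  simpa using this

end L2

/-! ### Gradients and test functions -/

theorem gradient_eq_toDual_fderiv (f : E d → ℝ) :
    gradient f = fun x => (InnerProductSpace.toDual ℝ (E d)).symm (fderiv ℝ f x) := rfl

theorem continuous_gradient {f : E d → ℝ} (hf : ContDiff ℝ ∞ f) : Continuous (gradient f) := by
  rw [gradient_eq_toDual_fderiv]
  exact (LinearIsometryEquiv.continuous _).comp (hf.continuous_fderiv (by simp))

theorem gradient_add {f g : E d → ℝ} {x : E d} (hf : DifferentiableAt ℝ f x)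
    (hg : DifferentiableAt ℝ g x) :
    gradient (fun y => f y + g y) x = gradient f x + gradient g x := by
  simp only [gradient]
  rw [show (fun y => f y + g y) = f + g from rfl, fderiv_add hf hg, map_add]

theorem gradient_const_mul (c : ℝ) {f : E d → ℝ} {x : E d} (hf : DifferentiableAt ℝ f x) :
    gradient (fun y => c * f y) x = c • gradient f x := by
  simp only [gradient]
  rw [fderiv_const_mul hf, map_smul]

theorem gradient_congr {f g : E d → ℝ} {x : E d} (h : f =ᶠ[𝓝 x] g) :
    gradient f x = gradient g x := by
  simp only [gradient, h.fderiv_eq]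

/-- An affine function differs from its value at a point by the product with its gradient. -/
theorem hasGradientAt_affine (a : E d →ᵃ[ℝ] ℝ) (x : E d) :
    HasGradientAt (fun y => a y)
      ((InnerProductSpace.toDual ℝ (E d)).symm (LinearMap.toContinuousLinearMap a.linear)) x := by
  rw [hasGradientAt_iff_hasFDerivAt]
  simp only [LinearIsometryEquiv.apply_symm_apply]
  have h : (fun y => a y) = fun y => (LinearMap.toContinuousLinearMap a.linear) y + a 0 := by
    ext y
    have := a.decomp' 
    have h2 := a.map_vadd 0 y
    simpa using h2
  rw [h]
  exact (ContinuousLinearMap.hasFDerivAt _).add_const _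

/-- The gradient of an affine function. -/
def slope (a : E d →ᵃ[ℝ] ℝ) : E d :=
  (InnerProductSpace.toDual ℝ (E d)).symm (LinearMap.toContinuousLinearMap a.linear)

theorem gradient_affine (a : E d →ᵃ[ℝ] ℝ) (x : E d) : gradient (fun y => a y) x = slope a :=
  (hasGradientAt_affine a x).gradient

theorem inner_slope (a : E d →ᵃ[ℝ] ℝ) (v : E d) : ⟪slope a, v⟫_ℝ = a.linear v := by
  simp [slope]

theorem affine_apply_add (a : E d →ᵃ[ℝ] ℝ) (x v : E d) : a (x + v) = a x + ⟪slope a, v⟫_ℝ := by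
  rw [inner_slope, add_comm x v]
  have := a.map_vadd x v
  simp only [vadd_eq_add] at this
  rw [this, add_comm]

theorem contDiff_affine (a : E d →ᵃ[ℝ] ℝ) : ContDiff ℝ ∞ (fun y => a y) := by
  have h : (fun y => a y) = fun y => ⟪slope a, y⟫_ℝ + a 0 := by
    ext y
    have := affine_apply_add a 0 y
    rw [zero_add] at this
    rw [this, add_comm]
  rw [h]
  exact (contDiff_const.inner ℝ contDiff_id).add contDiff_const

theorem IsTestFunction.mono {U U' : Set (E d)} (h : U ⊆ U') {φ : E d → ℝ}
    (hφ : IsTestFunction U φ) : IsTestFunction U' φ :=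
  ⟨hφ.1, hφ.2.1, hφ.2.2.trans h⟩

theorem IsTestFunction.eq_zero {U : Set (E d)} {φ : E d → ℝ} (hφ : IsTestFunction U φ)
    {x : E d} (hx : x ∉ U) : φ x = 0 :=
  image_eq_zero_of_notMem_tsupport fun h => hx (hφ.2.2 h)

theorem tsupport_gradient_subset (f : E d → ℝ) : tsupport (gradient f) ⊆ tsupport f := by
  refine (closure_mono ?_).trans (tsupport_fderiv_subset ℝ (f := f))
  intro x hx
  simp only [Function.mem_support, gradient] at hx ⊢
  intro h
  exact hx (by simp [h])

theorem IsTestFunction.gradient_eq_zero {U : Set (E d)} {φ : E d → ℝ} (hφ : IsTestFunction U φ)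
    {x : E d} (hx : x ∉ U) : gradient φ x = 0 :=
  image_eq_zero_of_notMem_tsupport fun h => hx (hφ.2.2 (tsupport_gradient_subset _ h))

theorem IsTestFunction.memLp {U : Set (E d)} {φ : E d → ℝ} (hφ : IsTestFunction U φ)
    {p : ℝ≥0∞} (μ : Measure (E d)) [IsFiniteMeasureOnCompacts μ] : MemLp φ p μ :=
  hφ.1.continuous.memLp_of_hasCompactSupport hφ.2.1

theorem IsTestFunction.memLp_gradient {U : Set (E d)} {φ : E d → ℝ} (hφ : IsTestFunction U φ)
    {p : ℝ≥0∞} (μ : Measure (E d)) [IsFiniteMeasureOnCompacts μ] : MemLp (gradient φ) p μ :=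
  (continuous_gradient hφ.1).memLp_of_hasCompactSupport
    (hφ.2.1.of_isClosed_subset (isClosed_tsupport _) (tsupport_gradient_subset _))

theorem IsTestFunction.memLp_smul_const {U : Set (E d)} {φ : E d → ℝ} (hφ : IsTestFunction U φ)
    {p : ℝ≥0∞} (μ : Measure (E d)) [IsFiniteMeasureOnCompacts μ] (e : E d) :
    MemLp (fun x => φ x • e) p μ :=
  (hφ.1.continuous.smul continuous_const).memLp_of_hasCompactSupport hφ.2.1.smul_right

theorem memLp_restrict_of_continuous {F : Type*} [NormedAddCommGroup F] {f : E d → F}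
    (hf : Continuous f) {U : Set (E d)} (hU : Bornology.IsBounded U) (p : ℝ≥0∞) :
    MemLp f p (volume.restrict U) := by
  have hK : IsCompact (closure U) := hU.isCompact_closure
  refine MemLp.mono_measure (Measure.restrict_mono subset_closure le_rfl) ?_
  have : IsFiniteMeasure (volume.restrict (closure U)) :=
    ⟨by simpa using hK.measure_lt_top⟩
  obtain ⟨C, hC⟩ := hK.exists_bound_of_continuousOn hf.continuousOn
  refine MemLp.of_bound hf.aestronglyMeasurable C ?_
  filter_upwards [ae_restrict_mem hK.isClosed.measurableSet] with x hx using hC x hx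

/-! ### The space `H¹` -/

/-- Testing one direction `e` at a time replaces a vector identity by scalar integrals. With the
converse `MemH1.of_inner`, all verifications of `H¹` membership are scalar. -/
theorem MemH1.weak_grad_inner {U : Set (E d)} {v : Field d} (hv : MemH1 U v) {φ : E d → ℝ}
    (hφ : IsTestFunction U φ) (e : E d) :
    ∫ x in U, v.1 x * ⟪gradient φ x, e⟫_ℝ = - ∫ x in U, φ x * ⟪v.2 x, e⟫_ℝ := by
  have h := congrArg (fun z => ⟪e, z⟫_ℝ) (hv.weak_grad φ hφ)
  simp only [inner_neg_right] at h
  have i1 : Integrable (fun x => v.1 x • gradient φ x) (volume.restrict U) :=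
    MemLp.integrable_smul_two hv.memLp (hφ.memLp_gradient _)
  have i2 : Integrable (fun x => φ x • v.2 x) (volume.restrict U) :=
    MemLp.integrable_smul_two (hφ.memLp _) hv.memLp_grad
  rw [← integral_inner i1, ← integral_inner i2] at h
  simpa [inner_smul_right, real_inner_comm] using h

theorem MemH1.of_inner {U : Set (E d)} {v : Field d} (h1 : MemLp v.1 2 (volume.restrict U))
    (h2 : MemLp v.2 2 (volume.restrict U))
    (h : ∀ φ, IsTestFunction U φ → ∀ e,
      ∫ x in U, v.1 x * ⟪gradient φ x, e⟫_ℝ = - ∫ x in U, φ x * ⟪v.2 x, e⟫_ℝ) :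
    MemH1 U v := by
  refine ⟨h1, h2, fun φ hφ => ?_⟩
  have i1 : Integrable (fun x => v.1 x • gradient φ x) (volume.restrict U) :=
    MemLp.integrable_smul_two h1 (hφ.memLp_gradient _)
  have i2 : Integrable (fun x => φ x • v.2 x) (volume.restrict U) :=
    MemLp.integrable_smul_two (hφ.memLp _) h2
  refine ext_inner_left ℝ fun e => ?_
  rw [inner_neg_right, ← integral_inner i1, ← integral_inner i2]
  simpa [inner_smul_right, real_inner_comm] using h φ hφ e

/-- `H¹(U)` as a space of fields. -/
def H1 (U : Set (E d)) : Submodule ℝ (Field d) where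
  carrier := {v | MemH1 U v}
  zero_mem' := MemH1.of_inner (by exact MemLp.zero) (by exact MemLp.zero) (by simp)
  add_mem' := by
    intro v w hv hw
    refine MemH1.of_inner (hv.memLp.add hw.memLp) (hv.memLp_grad.add hw.memLp_grad) ?_
    intro φ hφ e
    have ig : MemLp (fun x => ⟪gradient φ x, e⟫_ℝ) 2 (volume.restrict U) :=
      (hφ.memLp_gradient _).inner_const e
    have a := hv.weak_grad_inner hφ e
    have b := hw.weak_grad_inner hφ e
    simp only [Prod.fst_add, Prod.snd_add, Pi.add_apply, add_mul, inner_add_left, mul_add]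
    rw [integral_add (MemLp.integrable_mul_two hv.memLp ig) (MemLp.integrable_mul_two hw.memLp ig),
      integral_add (MemLp.integrable_mul_two (hφ.memLp _) (hv.memLp_grad.inner_const e))
        (MemLp.integrable_mul_two (hφ.memLp _) (hw.memLp_grad.inner_const e)), a, b]
    ring
  smul_mem' := by
    intro c v hv
    refine MemH1.of_inner (hv.memLp.const_smul c) (hv.memLp_grad.const_smul c) ?_
    intro φ hφ e
    have a := hv.weak_grad_inner hφ e
    simp only [Prod.smul_fst, Prod.smul_snd, Pi.smul_apply, smul_eq_mul, inner_smul_left,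
      mul_assoc, mul_left_comm (φ _), conj_trivial]
    rw [integral_const_mul, integral_const_mul, a]
    ring

theorem MemH1.add {U : Set (E d)} {v w : Field d} (hv : MemH1 U v) (hw : MemH1 U w) :
    MemH1 U (v + w) := (H1 U).add_mem hv hw

theorem MemH1.sub {U : Set (E d)} {v w : Field d} (hv : MemH1 U v) (hw : MemH1 U w) :
    MemH1 U (v - w) := (H1 U).sub_mem hv hw

theorem setIntegral_test_eq {U U' : Set (E d)} (hU : MeasurableSet U) (hUU : U ⊆ U')
    {f : E d → ℝ} (hf : ∀ x ∉ U, f x = 0) : ∫ x in U', f x = ∫ x in U, f x := by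
  have : f = U.indicator f := (Set.indicator_eq_self.2 fun x hx => by_contra fun h => hx (hf x h)).symm
  rw [this, setIntegral_indicator hU, setIntegral_indicator hU, Set.inter_self,
    Set.inter_eq_self_of_subset_right hUU]

theorem MemH1.mono {U U' : Set (E d)} (hU : IsOpen U) (hUU : U ⊆ U') {v : Field d}
    (hv : MemH1 U' v) : MemH1 U v := by
  have hm := Measure.restrict_mono hUU (le_refl (volume : Measure (E d)))
  refine MemH1.of_inner (hv.memLp.mono_measure hm) (hv.memLp_grad.mono_measure hm) ?_
  intro φ hφ e
  have := hv.weak_grad_inner (hφ.mono hUU) e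
  rwa [setIntegral_test_eq hU.measurableSet hUU, setIntegral_test_eq hU.measurableSet hUU] at this
  · intro x hx; simp [hφ.eq_zero hx]
  · intro x hx; simp [hφ.gradient_eq_zero hx]

theorem MemH1.congr {U : Set (E d)} {v w : Field d} (hv : MemH1 U v)
    (h1 : v.1 =ᵐ[volume.restrict U] w.1) (h2 : v.2 =ᵐ[volume.restrict U] w.2) : MemH1 U w := by
  refine MemH1.of_inner (hv.memLp.ae_eq h1) (hv.memLp_grad.ae_eq h2) ?_
  intro φ hφ e
  have a : ∫ x in U, w.1 x * ⟪gradient φ x, e⟫_ℝ = ∫ x in U, v.1 x * ⟪gradient φ x, e⟫_ℝ :=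
    integral_congr_ae (by filter_upwards [h1] with x hx; rw [hx])
  have b : ∫ x in U, φ x * ⟪w.2 x, e⟫_ℝ = ∫ x in U, φ x * ⟪v.2 x, e⟫_ℝ :=
    integral_congr_ae (by filter_upwards [h2] with x hx; rw [hx])
  rw [a, b, hv.weak_grad_inner hφ e]

/-- Limits in `L²` of functions and of their weak gradients. -/
theorem MemH1.of_tendsto {U : Set (E d)} {w : ℕ → Field d} {v : Field d}
    (hw : ∀ n, MemH1 U (w n)) (h1 : MemLp v.1 2 (volume.restrict U))
    (h2 : MemLp v.2 2 (volume.restrict U))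
    (t1 : Tendsto (fun n => eLpNorm (fun x => (w n).1 x - v.1 x) 2 (volume.restrict U)) atTop (𝓝 0))
    (t2 : Tendsto (fun n => eLpNorm (fun x => (w n).2 x - v.2 x) 2 (volume.restrict U)) atTop
      (𝓝 0)) : MemH1 U v := by
  refine MemH1.of_inner h1 h2 fun φ hφ e => ?_
  have a := tendsto_integral_mul_of_eLpNorm (fun n => (hw n).memLp) h1
    ((hφ.memLp_gradient (volume.restrict U)).inner_const e) t1
  have b := tendsto_integral_inner_of_eLpNorm (h := fun x => φ x • e)
    (fun n => (hw n).memLp_grad) h2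
    (hφ.memLp_smul_const (volume.restrict U) e) t2
  simp only [inner_smul_right] at b
  refine tendsto_nhds_unique a ?_
  refine b.neg.congr fun n => ?_
  exact ((hw n).weak_grad_inner hφ e).symm

/-- The test function is supported inside `U`, so integration by parts takes place on the whole
space and no regularity of `∂U` enters. Boundedness of `U` is only for square integrability. -/
theorem memH1_of_contDiff {U : Set (E d)} (hU : Bornology.IsBounded U) {ψ : E d → ℝ}
    (hψ : ContDiff ℝ ∞ ψ) : MemH1 U (ψ, gradient ψ) := by
  refine MemH1.of_inner (memLp_restrict_of_continuous hψ.continuous hU 2)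
    (memLp_restrict_of_continuous (continuous_gradient hψ) hU 2) fun φ hφ e => ?_
  simp only [inner_gradient_left]
  have hc : HasCompactSupport (fun x => fderiv ℝ φ x e) := by
    refine (hφ.2.1.fderiv (𝕜 := ℝ)).comp_left (g := fun L : E d →L[ℝ] ℝ => L e) (by simp)
  have z1 : ∀ x ∉ U, ψ x * fderiv ℝ φ x e = 0 := fun x hx => by
    rw [← inner_gradient_left, hφ.gradient_eq_zero hx]; simp
  have z2 : ∀ x ∉ U, φ x * fderiv ℝ ψ x e = 0 := fun x hx => by rw [hφ.eq_zero hx]; simp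
  rw [setIntegral_eq_integral_of_forall_compl_eq_zero z1,
    setIntegral_eq_integral_of_forall_compl_eq_zero z2]
  have c1 := hψ.continuous_fderiv (n := ∞) (by simp)
  have c2 := hφ.1.continuous_fderiv (n := ∞) (by simp)
  have c1' : Continuous fun x => fderiv ℝ ψ x e := by fun_prop
  have c2' : Continuous fun x => fderiv ℝ φ x e := by fun_prop
  simp only [mul_comm (φ _)]
  refine integral_mul_fderiv_eq_neg_fderiv_mul_of_integrable ?_ ?_ ?_ ?_ ?_
  · exact (c1'.mul hφ.1.continuous).integrable_of_hasCompactSupport hφ.2.1.mul_left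
  · exact (hψ.continuous.mul c2').integrable_of_hasCompactSupport hc.mul_left
  · exact (hψ.continuous.mul hφ.1.continuous).integrable_of_hasCompactSupport hφ.2.1.mul_left
  · exact fun x _ => (hψ.differentiable (by simp)) x
  · exact fun x _ => (hφ.1.differentiable (by simp)) x

end

section

/-! ### Simplices and barycentric coordinates -/

/-- The vertices `K` of a `d`-dimensional simplex in `ℝ^d`. -/
structure IsSimplex (K : Finset (E d)) : Prop where
  indep : AffineIndependent ℝ ((↑) : K → E d)
  card : K.card = d + 1

/-- The vertices of a simplex as an affine basis. -/
def IsSimplex.basis {K : Finset (E d)} (hK : IsSimplex K) : AffineBasis K ℝ (E d) where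
  toFun := (↑)
  ind' := hK.indep
  tot' := by
    rw [hK.indep.affineSpan_eq_top_iff_card_eq_finrank_add_one]
    simp [hK.card]

open Classical in
/-- The barycentric coordinate of the vertex `p` of the simplex `K`. -/
def lam (K : Finset (E d)) (p : E d) : E d →ᵃ[ℝ] ℝ :=
  if h : IsSimplex K ∧ p ∈ K then h.1.basis.coord ⟨p, h.2⟩ else 0

namespace IsSimplex

variable {K : Finset (E d)} (hK : IsSimplex K)
include hK

theorem lam_eq {p : E d} (hp : p ∈ K) : lam K p = hK.basis.coord ⟨p, hp⟩ := by
  simp [lam, hK, hp]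

theorem lam_self {p : E d} (hp : p ∈ K) : lam K p p = 1 := by
  rw [hK.lam_eq hp]
  exact hK.basis.coord_apply_eq ⟨p, hp⟩

theorem lam_ne {p q : E d} (hp : p ∈ K) (hq : q ∈ K) (h : q ≠ p) : lam K p q = 0 := by
  rw [hK.lam_eq hp]
  exact hK.basis.coord_apply_ne (i := ⟨p, hp⟩) (j := ⟨q, hq⟩) (by simpa using h.symm)

theorem sum_lam (x : E d) : ∑ p ∈ K, lam K p x = 1 := by
  have h := hK.basis.sum_coord_apply_eq_one x
  rw [← Finset.sum_coe_sort K (fun p => lam K p x)]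
  rw [← h]
  exact Finset.sum_congr rfl fun p _ => by rw [hK.lam_eq p.2]

theorem sum_lam_smul (x : E d) : ∑ p ∈ K, lam K p x • p = x := by
  have h := hK.basis.linear_combination_coord_eq_self x
  rw [← Finset.sum_coe_sort K (fun p => lam K p x • p)]
  conv_rhs => rw [← h]
  exact Finset.sum_congr rfl fun p _ => by rw [hK.lam_eq p.2]; rfl

theorem range_basis : Set.range hK.basis = (K : Set (E d)) := by
  ext x
  constructor
  · rintro ⟨p, rfl⟩; exact p.2
  · intro hx; exact ⟨⟨x, hx⟩, rfl⟩

theorem mem_hull {x : E d} : x ∈ hull K ↔ ∀ p ∈ K, 0 ≤ lam K p x := by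
  rw [hull, ← hK.range_basis, hK.basis.convexHull_eq_nonneg_coord]
  constructor
  · intro h p hp; rw [hK.lam_eq hp]; exact h _
  · intro h p; rw [← hK.lam_eq p.2]; exact h _ p.2

theorem mem_openHull {x : E d} : x ∈ openHull K ↔ ∀ p ∈ K, 0 < lam K p x := by
  rw [openHull, hull, ← hK.range_basis, hK.basis.interior_convexHull]
  constructor
  · intro h p hp; rw [hK.lam_eq hp]; exact h _
  · intro h p; rw [← hK.lam_eq p.2]; exact h _ p.2

theorem lam_le_one {x : E d} (hx : x ∈ hull K) {p : E d} (hp : p ∈ K) : lam K p x ≤ 1 := by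
  rw [← hK.sum_lam x]
  exact Finset.single_le_sum (f := fun p => lam K p x) (fun q hq => hK.mem_hull.1 hx q hq) hp

end IsSimplex

theorem affine_sum {s : Finset (E d)} (a : E d →ᵃ[ℝ] ℝ) (w : E d → ℝ) (hw : ∑ p ∈ s, w p = 1) :
    a (∑ p ∈ s, w p • p) = ∑ p ∈ s, w p * a p := by
  have h : ∀ y, a y = ⟪slope a, y⟫_ℝ + a 0 := fun y => by
    have := affine_apply_add a 0 y
    rw [zero_add] at this
    rw [this, add_comm]
  have e : ∑ p ∈ s, w p * a p = ∑ p ∈ s, (⟪slope a, w p • p⟫_ℝ + w p * a 0) :=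
    Finset.sum_congr rfl fun p _ => by rw [h p, inner_smul_right]; ring
  rw [h, inner_sum, e, Finset.sum_add_distrib, ← Finset.sum_mul, hw, one_mul]

theorem IsSimplex.affine_eq {K : Finset (E d)} (hK : IsSimplex K) (a : E d →ᵃ[ℝ] ℝ) (x : E d) :
    a x = ∑ p ∈ K, lam K p x * a p := by
  conv_lhs => rw [← hK.sum_lam_smul x]
  exact affine_sum a _ (hK.sum_lam x)

theorem IsSimplex.eq_lam {K : Finset (E d)} (hK : IsSimplex K) {a : E d →ᵃ[ℝ] ℝ} {i : E d}
    (hi : i ∈ K) (h : ∀ j ∈ K, (j = i → a j = 1) ∧ (j ≠ i → a j = 0)) : a = lam K i := by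
  ext x
  rw [hK.affine_eq a, Finset.sum_eq_single i]
  · rw [(h i hi).1 rfl, mul_one]
  · intro j hj hji; rw [(h j hj).2 hji, mul_zero]
  · exact fun hh => absurd hi hh

theorem IsSimplex.eq_zero {K : Finset (E d)} (hK : IsSimplex K) {a : E d →ᵃ[ℝ] ℝ}
    (h : ∀ j ∈ K, a j = 0) : a = 0 := by
  ext x
  rw [hK.affine_eq a, Finset.sum_eq_zero]
  · rfl
  · intro j hj; rw [h j hj, mul_zero]

theorem subset_hull (K : Finset (E d)) : (K : Set (E d)) ⊆ hull K := subset_convexHull ℝ _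

theorem hull_mono {K L : Finset (E d)} (h : K ⊆ L) : hull K ⊆ hull L :=
  convexHull_mono (by exact_mod_cast h)

theorem convex_hull (K : Finset (E d)) : Convex ℝ (hull K) := convex_convexHull ℝ _

theorem isCompact_hull (K : Finset (E d)) : IsCompact (hull K) :=
  K.finite_toSet.isCompact_convexHull ℝ

theorem isClosed_hull (K : Finset (E d)) : IsClosed (hull K) := (isCompact_hull K).isClosed

theorem measurableSet_hull (K : Finset (E d)) : MeasurableSet (hull K) :=
  (isClosed_hull K).measurableSet

theorem isOpen_openHull (K : Finset (E d)) : IsOpen (openHull K) := isOpen_interior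

theorem convex_openHull (K : Finset (E d)) : Convex ℝ (openHull K) := (convex_hull K).interior

theorem openHull_subset (K : Finset (E d)) : openHull K ⊆ hull K := interior_subset

theorem isBounded_openHull (K : Finset (E d)) : Bornology.IsBounded (openHull K) :=
  (isCompact_hull K).isBounded.subset (openHull_subset K)

theorem restrict_hull (K : Finset (E d)) :
    (volume.restrict (hull K) : Measure (E d)) = volume.restrict (openHull K) := by
  refine Measure.restrict_congr_set ?_
  exact (interior_ae_eq_of_null_frontier ((convex_hull K).addHaar_frontier volume)).symm

instance isFiniteMeasure_openHull (K : Finset (E d)) :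
    IsFiniteMeasure (volume.restrict (openHull K) : Measure (E d)) :=
  ⟨by simpa using (isBounded_openHull K).measure_lt_top⟩

/-- A simplex has `d + 1` vertices, so a subset of `d` of them omits exactly one. Facets are written
`K.erase p` from here on, with `p` the opposite vertex. -/
theorem mem_powersetCard_facet {K : Finset (E d)} (hK : K.card = d + 1) {F : Finset (E d)} :
    F ∈ K.powersetCard d ↔ ∃ p ∈ K, F = K.erase p := by
  classical
  rw [Finset.mem_powersetCard]
  constructor
  · rintro ⟨h1, h2⟩
    have : (K \ F).card = 1 := by rw [Finset.card_sdiff_of_subset h1]; omega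
    obtain ⟨p, hp⟩ := Finset.card_eq_one.1 this
    have hpm : p ∈ K \ F := by rw [hp]; simp
    refine ⟨p, (Finset.mem_sdiff.1 hpm).1, ?_⟩
    rw [← Finset.sdiff_singleton_eq_erase, ← hp, Finset.sdiff_sdiff_eq_self h1]
  · rintro ⟨p, hp, rfl⟩
    exact ⟨Finset.erase_subset _ _, by rw [Finset.card_erase_of_mem hp]; omega⟩

namespace IsSimplex

variable {K : Finset (E d)} (hK : IsSimplex K)
include hK

theorem mem_facet {p : E d} (hp : p ∈ K) {x : E d} :
    x ∈ hull (K.erase p) ↔ x ∈ hull K ∧ lam K p x = 0 := by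
  constructor
  · intro hx
    refine ⟨hull_mono (Finset.erase_subset _ _) hx, ?_⟩
    obtain ⟨w, -, h2, rfl⟩ := Finset.mem_convexHull'.1 hx
    rw [affine_sum _ _ h2]
    refine Finset.sum_eq_zero fun q hq => ?_
    rw [hK.lam_ne hp (Finset.mem_of_mem_erase hq) (Finset.ne_of_mem_erase hq), mul_zero]
  · rintro ⟨h1, h2⟩
    refine Finset.mem_convexHull'.2 ⟨fun q => lam K q x, ?_, ?_, ?_⟩
    · exact fun q hq => hK.mem_hull.1 h1 q (Finset.mem_of_mem_erase hq)
    · have := hK.sum_lam x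
      rwa [← Finset.add_sum_erase K _ hp, h2, zero_add] at this
    · have := hK.sum_lam_smul x
      rwa [← Finset.add_sum_erase K _ hp, h2, zero_smul, zero_add] at this

theorem frontier_hull : frontier (hull K) = ⋃ p ∈ K, hull (K.erase p) := by
  ext x
  simp only [Set.mem_iUnion, exists_prop]
  rw [(isClosed_hull K).frontier_eq, Set.mem_sdiff]
  change x ∈ hull K ∧ x ∉ openHull K ↔ _
  rw [hK.mem_openHull]
  constructor
  · rintro ⟨h1, h2⟩
    push Not at h2
    obtain ⟨p, hp, h⟩ := h2
    exact ⟨p, hp, (hK.mem_facet hp).2 ⟨h1, le_antisymm h (hK.mem_hull.1 h1 p hp)⟩⟩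
  · rintro ⟨p, hp, h⟩
    obtain ⟨h1, h2⟩ := (hK.mem_facet hp).1 h
    exact ⟨h1, fun h3 => (h3 p hp).ne' h2⟩

theorem nonempty_openHull : (openHull K).Nonempty := by
  have h := hK.basis.centroid_mem_interior_convexHull
  rw [hK.range_basis] at h
  exact ⟨_, h⟩

theorem card_facet {p : E d} (hp : p ∈ K) : (K.erase p).card = d := by
  rw [Finset.card_erase_of_mem hp, hK.card]; rfl

theorem facet_nonempty (hd : 0 < d) {p : E d} (hp : p ∈ K) : (K.erase p).Nonempty := by
  rw [← Finset.card_pos, hK.card_facet hp]; exact hd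

theorem slope_lam_ne_zero (hd : 0 < d) {p : E d} (hp : p ∈ K) : slope (lam K p) ≠ 0 := by
  intro h
  obtain ⟨q, hq⟩ := hK.facet_nonempty hd hp
  have h1 := affine_apply_add (lam K p) q (p - q)
  rw [add_sub_cancel, hK.lam_self hp, hK.lam_ne hp (Finset.mem_of_mem_erase hq)
    (Finset.ne_of_mem_erase hq), h] at h1
  simp at h1

/-- A point of the relative interior of a facet. -/
theorem exists_facet_point (hd : 0 < d) {p : E d} (hp : p ∈ K) :
    ∃ x, lam K p x = 0 ∧ ∀ q ∈ K.erase p, 0 < lam K q x := by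
  have hc : ((K.erase p).card : ℝ) = d := by rw [hK.card_facet hp]
  have hd' : (0 : ℝ) < d := by exact_mod_cast hd
  have hs : ∑ q ∈ K.erase p, (d : ℝ)⁻¹ = 1 := by
    rw [Finset.sum_const, nsmul_eq_mul, hc]; field_simp
  refine ⟨∑ q ∈ K.erase p, (d : ℝ)⁻¹ • q, ?_, ?_⟩
  · rw [affine_sum _ _ hs]
    refine Finset.sum_eq_zero fun q hq => ?_
    rw [hK.lam_ne hp (Finset.mem_of_mem_erase hq) (Finset.ne_of_mem_erase hq), mul_zero]
  · intro r hr
    rw [affine_sum _ _ hs, Finset.sum_eq_single r]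
    · rw [hK.lam_self (Finset.mem_of_mem_erase hr)]; positivity
    · intro q hq hqr
      rw [hK.lam_ne (Finset.mem_of_mem_erase hr) (Finset.mem_of_mem_erase hq) hqr, mul_zero]
    · exact fun h => absurd hr h

end IsSimplex

theorem continuous_affine (a : E d →ᵃ[ℝ] ℝ) : Continuous (fun x => a x) :=
  (contDiff_affine a).continuous

/-! ### Elements of a mesh -/

namespace Mesh

variable (T : Mesh d)

theorem mem_elements {K : Finset (E d)} :
    K ∈ T.elements ↔ K ∈ T.complex.faces ∧ K.card = d + 1 := by
  simp [elements]

theorem mem_facets {F : Finset (E d)} : F ∈ T.facets ↔ F ∈ T.complex.faces ∧ F.card = d := by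
  simp [facets]

variable {T}

theorem isSimplex {K : Finset (E d)} (hK : K ∈ T.elements) : IsSimplex K :=
  ⟨T.complex.indep (T.mem_elements.1 hK).1, (T.mem_elements.1 hK).2⟩

theorem facet_mem (hd : 0 < d) {K : Finset (E d)} (hK : K ∈ T.elements) {p : E d} (hp : p ∈ K) :
    K.erase p ∈ T.facets :=
  T.mem_facets.2 ⟨T.complex.down_closed (T.mem_elements.1 hK).1 (Finset.erase_subset _ _)
    ((isSimplex hK).facet_nonempty hd hp), (isSimplex hK).card_facet hp⟩

theorem exists_element_of_facet {F : Finset (E d)} (hF : F ∈ T.facets) :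
    ∃ K ∈ T.elements, F ⊆ K := by
  obtain ⟨K, h1, h2, h3⟩ := T.pure F (T.mem_facets.1 hF).1
  exact ⟨K, T.mem_elements.2 ⟨h1, h3⟩, h2⟩

theorem exists_eq_erase {F K : Finset (E d)} (hF : F.card = d) (hK : K ∈ T.elements)
    (hFK : F ⊆ K) : ∃ p ∈ K, F = K.erase p :=
  (mem_powersetCard_facet (isSimplex hK).card).1 (Finset.mem_powersetCard.2 ⟨hFK, hF⟩)

theorem hull_inter [DecidableEq (E d)] {K L : Finset (E d)} (hK : K ∈ T.complex.faces)
    (hL : L ∈ T.complex.faces) : hull K ∩ hull L = hull (K ∩ L) := by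
  have := T.complex.convexHull_inter_convexHull hK hL
  rw [hull, hull, hull, Finset.coe_inter]
  exact this

/-- Two distinct elements have equally many vertices, so some vertex `p` of `K` is missing from `L`.
By conformity the intersection is spanned by the common vertices, which avoid `p`. -/
theorem hull_inter_subset_facet {K L : Finset (E d)} (hK : K ∈ T.elements) (hL : L ∈ T.elements)
    (hKL : K ≠ L) : ∃ p ∈ K, p ∉ L ∧ hull K ∩ hull L ⊆ hull (K.erase p) := by
  classical
  have hc : K.card = L.card := by rw [(isSimplex hK).card, (isSimplex hL).card]
  obtain ⟨p, hp, hpL⟩ : ∃ p ∈ K, p ∉ L := by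
    by_contra! h
    exact hKL (Finset.eq_of_subset_of_card_le h hc.ge)
  refine ⟨p, hp, hpL, ?_⟩
  rw [hull_inter (T.mem_elements.1 hK).1 (T.mem_elements.1 hL).1]
  refine hull_mono fun q hq => ?_
  rw [Finset.mem_inter] at hq
  exact Finset.mem_erase.2 ⟨fun h => hpL (h ▸ hq.2), hq.1⟩

theorem disjoint_openHull {K L : Finset (E d)} (hK : K ∈ T.elements) (hL : L ∈ T.elements)
    (hKL : K ≠ L) : Disjoint (openHull K) (hull L) := by
  rw [Set.disjoint_left]
  intro x hx hxL
  obtain ⟨p, hp, -, h⟩ := hull_inter_subset_facet hK hL hKL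
  have := ((isSimplex hK).mem_facet hp).1 (h ⟨openHull_subset K hx, hxL⟩)
  exact ((isSimplex hK).mem_openHull.1 hx p hp).ne' this.2

/-- The vertex opposite to a common facet lies on the other side of that facet. -/
theorem lam_neg_of_adjacent (hd : 0 < d) {K L : Finset (E d)} (hK : K ∈ T.elements)
    (hL : L ∈ T.elements) (hKL : K ≠ L) {p q : E d} (hp : p ∈ K) (hq : q ∈ L)
    (hF : K.erase p = L.erase q) : lam K p q < 0 := by
  have sK := isSimplex hK
  have sL := isSimplex hL
  by_contra! h
  have hpL : p ∉ L := by
    intro hpL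
    refine hKL (Finset.eq_of_subset_of_card_le (fun x hx => ?_) (by rw [sK.card, sL.card]))
    by_cases hxp : x = p
    · exact hxp ▸ hpL
    · exact Finset.mem_of_mem_erase (hF ▸ Finset.mem_erase.2 ⟨hxp, hx⟩ : x ∈ L.erase q)
  obtain ⟨x, hx0, hx⟩ := sK.exists_facet_point hd hp
  have hxF : x ∈ hull (K.erase p) := by
    rw [sK.mem_facet hp]
    refine ⟨sK.mem_hull.2 fun r hr => ?_, hx0⟩
    by_cases hrp : r = p
    · rw [hrp, hx0]
    · exact (hx r (Finset.mem_erase.2 ⟨hrp, hr⟩)).le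
  -- If `q` were on the same side as `p`, a short move from a relative interior point `x` of the
  -- facet towards `q` would stay in `K`: the other coordinates stay positive by continuity. The
  -- point also stays in `L` and leaves the facet, contrary to conformity.
  obtain ⟨y, hyK, hyL, hyq⟩ : ∃ y, y ∈ hull K ∧ y ∈ hull L ∧ 0 < lam L q y := by
    have hxL : x ∈ hull L := hull_mono (Finset.erase_subset _ _) (hF ▸ hxF)
    have hqL : q ∈ hull L := subset_hull L hq
    have hev : ∀ r ∈ K.erase p, ∀ᶠ t : ℝ in 𝓝[>] 0, 0 < lam K r (x + t • (q - x)) := by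
      intro r hr
      have hc : Continuous fun t : ℝ => lam K r (x + t • (q - x)) :=
        (continuous_affine _).comp (by fun_prop)
      have := hc.tendsto 0
      simp only [zero_smul, add_zero] at this
      exact ((tendsto_order.1 this).1 0 (hx r hr)).filter_mono nhdsWithin_le_nhds
    have hev2 := (Filter.eventually_all_finset _).2 hev
    obtain ⟨t, h1, h2⟩ := (hev2.and (Ioo_mem_nhdsGT (show (0 : ℝ) < 1 by norm_num))).exists
    refine ⟨x + t • (q - x), sK.mem_hull.2 fun r hr => ?_, ?_, ?_⟩
    · by_cases hrp : r = p
      · subst hrp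
        have e := affine_apply_add (lam K r) x (q - x)
        rw [add_sub_cancel, hx0] at e
        rw [affine_apply_add, hx0, inner_smul_right]
        have : 0 ≤ ⟪slope (lam K r), q - x⟫_ℝ := by linarith
        have := mul_nonneg h2.1.le this
        linarith
      · exact (h1 r (Finset.mem_erase.2 ⟨hrp, hr⟩)).le
    · exact (convex_hull L).add_smul_sub_mem hxL hqL ⟨h2.1.le, h2.2.le⟩
    · have e := affine_apply_add (lam L q) x (q - x)
      rw [add_sub_cancel, sL.lam_self hq] at e
      have e0 : lam L q x = 0 := ((sL.mem_facet hq).1 (hF ▸ hxF)).2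
      rw [affine_apply_add, e0, inner_smul_right]
      rw [e0] at e
      rw [show ⟪slope (lam L q), q - x⟫_ℝ = 1 by linarith]
      have := h2.1
      linarith
  classical
  have h3 : y ∈ hull (K ∩ L) := by
    rw [← hull_inter (T.mem_elements.1 hK).1 (T.mem_elements.1 hL).1]; exact ⟨hyK, hyL⟩
  have h4 : K ∩ L ⊆ L.erase q := by
    intro r hr
    rw [Finset.mem_inter] at hr
    rw [← hF]
    exact Finset.mem_erase.2 ⟨fun h => hpL (h ▸ hr.2), hr.1⟩
  exact hyq.ne' ((sL.mem_facet hq).1 (hull_mono h4 h3)).2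

/-- Across a facet, the barycentric coordinates of the opposite vertices are proportional. -/
theorem lam_eq_mul_lam {K L : Finset (E d)} (hK : K ∈ T.elements) (hL : L ∈ T.elements)
    {p q : E d} (hp : p ∈ K) (hq : q ∈ L) (hF : K.erase p = L.erase q) (x : E d) :
    lam K p x = lam K p q * lam L q x := by
  have sK := isSimplex hK
  have sL := isSimplex hL
  rw [sL.affine_eq (lam K p) x, Finset.sum_eq_single q, mul_comm]
  · intro r hr hrq
    have : r ∈ K.erase p := hF ▸ Finset.mem_erase.2 ⟨hrq, hr⟩
    rw [sK.lam_ne hp (Finset.mem_of_mem_erase this) (Finset.ne_of_mem_erase this), mul_zero]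
  · exact fun h => absurd hq h

/-- A facet belongs to at most two elements. -/
theorem eq_or_eq_of_facet_subset (hd : 0 < d) {K L M F : Finset (E d)} (hF : F.card = d)
    (hK : K ∈ T.elements) (hL : L ∈ T.elements) (hM : M ∈ T.elements) (hFK : F ⊆ K)
    (hFL : F ⊆ L) (hFM : F ⊆ M) (hKL : K ≠ L) : M = K ∨ M = L := by
  by_contra! h
  obtain ⟨p, hp, rfl⟩ := exists_eq_erase hF hK hFK
  obtain ⟨q, hq, e1⟩ := exists_eq_erase hF hL hFL
  obtain ⟨r, hr, e2⟩ := exists_eq_erase hF hM hFM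
  have h1 := lam_neg_of_adjacent hd hK hL hKL hp hq e1
  have h2 := lam_neg_of_adjacent hd hK hM h.1.symm hp hr e2
  have h3 := lam_neg_of_adjacent hd hL hM h.2.symm hq hr (e1.symm.trans e2)
  -- Three elements on one facet would lie pairwise on opposite sides: `lam K p r` is negative, yet
  -- equals the product of the negative numbers `lam K p q` and `lam L q r`.
  have h4 := lam_eq_mul_lam hK hL hp hq e1 r
  nlinarith

end Mesh

end

section

/-! ### Slicing the Lebesgue measure by parallel hyperplanes -/

/-- The zero set of an affine function. -/
def zeroSet (a : E d →ᵃ[ℝ] ℝ) : Set (E d) := {x | a x = 0}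

/-- The vector orthogonal to the level sets of an affine function along which it grows by one. -/
def unitStep (a : E d →ᵃ[ℝ] ℝ) : E d := (‖slope a‖ ^ 2)⁻¹ • slope a

theorem isClosed_zeroSet (a : E d →ᵃ[ℝ] ℝ) : IsClosed (zeroSet a) :=
  isClosed_eq (continuous_affine a) continuous_const

theorem unitStep_ne_zero {a : E d →ᵃ[ℝ] ℝ} (ha : slope a ≠ 0) : unitStep a ≠ 0 := by
  have : ‖slope a‖ ≠ 0 := norm_ne_zero_iff.2 ha
  simp [unitStep, ha]

theorem inner_slope_unitStep {a : E d →ᵃ[ℝ] ℝ} (ha : slope a ≠ 0) :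
    ⟪slope a, unitStep a⟫_ℝ = 1 := by
  have : ‖slope a‖ ≠ 0 := norm_ne_zero_iff.2 ha
  rw [unitStep, inner_smul_right, real_inner_self_eq_norm_sq]
  field_simp

theorem apply_add_smul_unitStep {a : E d →ᵃ[ℝ] ℝ} (ha : slope a ≠ 0) (x : E d) (s : ℝ) :
    a (x + s • unitStep a) = a x + s := by
  rw [affine_apply_add, inner_smul_right, inner_slope_unitStep ha, mul_one]

theorem finrank_span_unitStep_orthogonal {a : E d →ᵃ[ℝ] ℝ} (ha : slope a ≠ 0) :
    Module.finrank ℝ (ℝ ∙ unitStep a)ᗮ = d - 1 := by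
  have := (ℝ ∙ unitStep a).finrank_add_finrank_orthogonal
  rw [finrank_span_singleton (unitStep_ne_zero ha), finrank_euclideanSpace_fin] at this
  omega

/-- Translation by `p` is an isometry of the direction hyperplane onto the zero set, and on an inner
product space of dimension `d - 1` the normalized Hausdorff measure is Lebesgue measure. This makes
the surface measure s-finite on hyperplanes, as Fubini requires. -/
theorem surf_restrict_zeroSet {a : E d →ᵃ[ℝ] ℝ} (ha : slope a ≠ 0) {p : E d} (hp : a p = 0) :
    (surf d).restrict (zeroSet a) =
      (volume : Measure (ℝ ∙ unitStep a)ᗮ).map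
        (fun z : (ℝ ∙ unitStep a)ᗮ => (z : E d) + p) := by
  have hi : Isometry (fun z : (ℝ ∙ unitStep a)ᗮ => (z : E d) + p) := by
    refine Isometry.of_dist_eq fun x y => ?_
    rw [dist_add_right]; rfl
  have h := hi.map_euclideanHausdorffMeasure (d := d - 1)
  rw [← InnerProductSpace.euclideanHausdorffMeasure_eq_volume,
    finrank_span_unitStep_orthogonal ha, h, surf]
  congr 1
  ext x
  simp only [zeroSet, Set.mem_range, Subtype.exists, exists_prop, Set.mem_ofPred_eq]
  constructor
  · intro hx
    refine ⟨x - p, ?_, by simp⟩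
    rw [Submodule.mem_orthogonal_singleton_iff_inner_right, unitStep, inner_smul_left]
    have := affine_apply_add a p (x - p)
    rw [add_sub_cancel, hx, hp, zero_add] at this
    rw [← this, mul_zero]
  · rintro ⟨z, hz, rfl⟩
    rw [Submodule.mem_orthogonal_singleton_iff_inner_right, unitStep, inner_smul_left] at hz
    have hn : ‖slope a‖ ≠ 0 := norm_ne_zero_iff.2 ha
    rw [add_comm, affine_apply_add, hp, zero_add]
    simpa [hn] using hz

instance sFinite_surf_zeroSet (a : E d →ᵃ[ℝ] ℝ) [h : Fact (slope a ≠ 0)] :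
    SFinite ((surf d).restrict (zeroSet a)) := by
  have hp : a (0 + (-a 0) • unitStep a) = 0 := by
    rw [apply_add_smul_unitStep h.out, add_neg_cancel]
  rw [surf_restrict_zeroSet h.out hp]
  infer_instance

/-- Lebesgue measure is the product measure of a hyperplane and its normal line. The line is
parametrized by multiples of `unitStep a`, whence the factor `‖unitStep a‖`; the parameter then
equals the value of `a`. -/
theorem volume_eq_map_slices {a : E d →ᵃ[ℝ] ℝ} [h : Fact (slope a ≠ 0)] :
    (volume : Measure (E d)) = ‖unitStep a‖ₑ •
      (((surf d).restrict (zeroSet a)).prod (volume : Measure ℝ)).map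
        (fun z => z.1 + z.2 • unitStep a) := by
  have ha := h.out
  obtain ⟨p, hp⟩ : ∃ p, a p = 0 :=
    ⟨0 + (-a 0) • unitStep a, by rw [apply_add_smul_unitStep ha, add_neg_cancel]⟩
  set v := unitStep a with hv
  have hv0 : v ≠ 0 := unitStep_ne_zero ha
  set W : Submodule ℝ (E d) := (ℝ ∙ v)ᗮ with hW
  have hWo : v ∈ Wᗮ := by
    rw [hW, Submodule.orthogonal_orthogonal]; exact Submodule.mem_span_singleton_self v
  have hfr : Module.finrank ℝ Wᗮ = 1 := by
    rw [hW, Submodule.orthogonal_orthogonal, finrank_span_singleton hv0]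
  have h1 := W.measurePreserving_measurableEquivProd p
  rw [finrank_euclideanSpace_fin, EuclideanSpace.euclideanHausdorffMeasure_eq_volume] at h1
  have h2 := h1.symm.map_eq
  have h3 := volume_eq_of_finrank_eq_one hfr (v := ⟨v, hWo⟩) (by simpa using hv0)
  have h4 : (volume : Measure (W × Wᗮ)) = ‖v‖ₑ • ((volume : Measure W).prod (volume : Measure ℝ)).map
      (fun z => (z.1, z.2 • (⟨v, hWo⟩ : Wᗮ))) := by
    rw [Measure.volume_eq_prod, h3, Measure.prod_smul_right]
    congr 1
    have := Measure.map_prod_map (volume : Measure W) (volume : Measure ℝ) measurable_id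
      (show Measurable fun s : ℝ => s • (⟨v, hWo⟩ : Wᗮ) by fun_prop)
    rw [Measure.map_id] at this
    exact this
  have h5 := Measure.map_prod_map (volume : Measure W) (volume : Measure ℝ)
      (show Measurable fun z : W => (z : E d) + p by fun_prop) measurable_id
  rw [Measure.map_id, ← surf_restrict_zeroSet ha hp] at h5
  rw [h5, Measure.map_map (by fun_prop) (by fun_prop), ← h2, h4, Measure.map_smul,
    Measure.map_map (MeasurableEquiv.measurable _) (by fun_prop)]
  congr 2
  ext1 z
  simp [add_right_comm]

theorem lintegral_eq_slices {a : E d →ᵃ[ℝ] ℝ} [h : Fact (slope a ≠ 0)] {G : E d → ℝ≥0∞}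
    (hG : Measurable G) :
    ∫⁻ x, G x = ‖unitStep a‖ₑ * ∫⁻ s : ℝ, ∫⁻ y in zeroSet a, G (y + s • unitStep a) ∂(surf d) := by
  conv_lhs => rw [volume_eq_map_slices (a := a)]
  rw [lintegral_smul_measure, lintegral_map hG (by fun_prop), lintegral_prod_symm']
  · rfl
  · fun_prop

/-- Hausdorff measure of dimension `d - 1` is homogeneous of that degree, and a homothety centred on
the hyperplane preserves the hyperplane. The factor multiplies the image measure so that the
identity can be rewritten inside a slice integral. -/
theorem map_homothety_surf {a : E d →ᵃ[ℝ] ℝ} {p : E d} (hp : a p = 0) {t : ℝ} (ht : 0 < t) :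
    (surf d).restrict (zeroSet a) = ENNReal.ofReal t ^ (d - 1) •
      ((surf d).restrict (zeroSet a)).map (fun y => p + t • (y - p)) := by
  have he : (fun y => p + t • (y - p)) = ⇑(AffineMap.homothety p t) := by
    ext1 y
    simp [AffineMap.homothety_apply, add_comm]
  have hm : Measurable (fun y : E d => p + t • (y - p)) := by fun_prop
  have hz : (fun y => p + t • (y - p)) ⁻¹' zeroSet a = zeroSet a := by
    ext y
    have e := affine_apply_add a p (y - p)
    rw [add_sub_cancel, hp, zero_add] at e
    simp only [zeroSet, Set.mem_preimage, Set.mem_ofPred_eq]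
    rw [affine_apply_add, hp, inner_smul_right, ← e, zero_add]
    simp [ht.ne']
  ext A hA
  rw [Measure.smul_apply, Measure.map_apply hm hA,
    Measure.restrict_apply hA, Measure.restrict_apply (hm hA)]
  nth_rw 2 [← hz]
  rw [← Set.preimage_inter, he, surf, euclideanHausdorffMeasure_homothety_preimage (d - 1) p ht.ne',
    ENNReal.smul_def, smul_eq_mul, smul_eq_mul, ← mul_assoc]
  have : ENNReal.ofReal t ^ (d - 1) * ((‖t‖₊⁻¹ ^ (d - 1) : NNReal) : ℝ≥0∞) = 1 := by
    have h1 : ENNReal.ofReal t = ((‖t‖₊ : NNReal) : ℝ≥0∞) := by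
      rw [← Real.enorm_of_nonneg ht.le]; rfl
    rw [h1, ← ENNReal.coe_pow, ← ENNReal.coe_mul, ← mul_pow, mul_inv_cancel₀ (by simpa using ht.ne')]
    simp
  rw [this, one_mul]

/-- The slice of `K` parallel to the facet opposite to `p`, at barycentric height `1 - t`, is the
image of that facet under the homothety of centre `p` and ratio `t`; its measure scales by `t ^ (d -
1)`. -/
theorem IsSimplex.cone_formula (hd : 0 < d) {K : Finset (E d)} (hK : IsSimplex K) {p : E d}
    (hp : p ∈ K) {G : E d → ℝ≥0∞} (hG : Measurable G) :
    ∫⁻ x in hull K, G x = ‖unitStep (lam K p)‖ₑ * ∫⁻ t in Set.Ioo (0 : ℝ) 1,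
      ENNReal.ofReal t ^ (d - 1) *
        ∫⁻ y in hull (K.erase p), G (p + t • (y - p)) ∂(surf d) := by
  have : Fact (slope (lam K p) ≠ 0) := ⟨hK.slope_lam_ne_zero hd hp⟩
  have ha := this.out
  set a := lam K p with hadef
  set v := unitStep a with hv
  have hGi : Measurable ((hull K).indicator G) := hG.indicator (measurableSet_hull K)
  rw [← lintegral_indicator (measurableSet_hull K), lintegral_eq_slices (a := a) hGi]
  congr 1
  -- The slice parameter is the height above the facet; `s = 1 - t` turns it into the homothety
  -- ratio.
  rw [← lintegral_sub_left_eq_self _ (1 : ℝ), ← lintegral_indicator measurableSet_Ioo]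
  have h01 : ∀ᵐ t : ℝ, t ≠ 0 ∧ t ≠ 1 :=
    (Measure.ae_ne volume 0).and (Measure.ae_ne volume 1)
  refine lintegral_congr_ae ?_
  filter_upwards [h01] with t ht01
  have hF : hull (K.erase p) ⊆ zeroSet a := fun y hy => ((hK.mem_facet hp).1 hy).2
  by_cases ht : t ∈ Set.Ioo (0 : ℝ) 1
  · rw [Set.indicator_of_mem ht]
    -- The scaling lemma needs a centre in the hyperplane, so the foot `p - v` of `p` is used.
    -- Adding `(1 - t) • v` afterwards recovers the homothety centred at `p`.
    have hp0 : a (p + (-1 : ℝ) • v) = 0 := by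
      rw [apply_add_smul_unitStep ha, hadef, hK.lam_self hp]; norm_num
    rw [map_homothety_surf hp0 ht.1, lintegral_smul_measure, smul_eq_mul,
      lintegral_map (by fun_prop) (by fun_prop)]
    congr 1
    rw [← Set.inter_eq_self_of_subset_left hF, ← Measure.restrict_restrict (measurableSet_hull _),
      ← lintegral_indicator (measurableSet_hull _)]
    refine setLIntegral_congr_fun (isClosed_zeroSet a).measurableSet fun y hy => ?_
    have e : p + (-1 : ℝ) • v + t • (y - (p + (-1 : ℝ) • v)) + (1 - t) • v = p + t • (y - p) := by
      module
    rw [e]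
    have hl : ∀ q ∈ K.erase p, lam K q (p + t • (y - p)) = t * lam K q y := by
      intro q hq
      have e1 := affine_apply_add (lam K q) p (y - p)
      have e2 := hK.lam_ne (Finset.mem_of_mem_erase hq) hp (Finset.ne_of_mem_erase hq).symm
      rw [add_sub_cancel, e2, zero_add] at e1
      rw [affine_apply_add, e2, inner_smul_right, ← e1, zero_add]
    have hlp : lam K p (p + t • (y - p)) = 1 - t := by
      have e1 := affine_apply_add (lam K p) p (y - p)
      have hy0 : lam K p y = 0 := hy
      rw [add_sub_cancel, hK.lam_self hp, hy0] at e1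
      rw [affine_apply_add, hK.lam_self hp, inner_smul_right]
      linear_combination -t * e1
    have hiff : p + t • (y - p) ∈ hull K ↔ y ∈ hull (K.erase p) := by
      rw [hK.mem_facet hp, hK.mem_hull, hK.mem_hull]
      constructor
      · intro hx
        refine ⟨fun q hq => ?_, hy⟩
        by_cases hqp : q = p
        · rw [hqp]; exact (show lam K p y = 0 from hy).ge
        · have := hx q hq
          rw [hl q (Finset.mem_erase.2 ⟨hqp, hq⟩)] at this
          exact nonneg_of_mul_nonneg_right this ht.1
      · intro hx q hq
        by_cases hqp : q = p
        · rw [hqp, hlp]; linarith [ht.2]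
        · rw [hl q (Finset.mem_erase.2 ⟨hqp, hq⟩)]
          exact mul_nonneg ht.1.le (hx.1 q hq)
    by_cases hy' : y ∈ hull (K.erase p)
    · rw [Set.indicator_of_mem hy', Set.indicator_of_mem (hiff.2 hy')]
    · rw [Set.indicator_of_notMem hy', Set.indicator_of_notMem (fun h => hy' (hiff.1 h))]
  · rw [Set.indicator_of_notMem ht]
    rw [setLIntegral_congr_fun (g := fun _ => 0) (isClosed_zeroSet a).measurableSet]
    · simp
    · intro y hy
      refine Set.indicator_of_notMem (fun hx => ht ?_) _
      have e : lam K p (y + (1 - t) • v) = 1 - t := by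
        rw [hv, hadef, apply_add_smul_unitStep ha, show lam K p y = 0 from hy, zero_add]
      have h1 := hK.mem_hull.1 hx p hp
      have h2 := hK.lam_le_one hx hp
      rw [e] at h1 h2
      exact ⟨lt_of_le_of_ne (by linarith) ht01.1.symm, lt_of_le_of_ne (by linarith) ht01.2⟩

end

section

/-! ### The surface measure of facets -/

/-- Fewer than `d` points span an affine space of dimension below `d - 1`, and Hausdorff measure
vanishes above the dimension. This discards relative boundaries and overlaps of facets. -/
theorem surf_hull_eq_zero {s : Finset (E d)} (hs : s.card < d) : surf d (hull s) = 0 := by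
  rcases s.eq_empty_or_nonempty with rfl | hne
  · simp [hull]
  · have h1 : Module.finrank ℝ (vectorSpan ℝ (hull s)) < d - 1 := by
      rw [hull, ← direction_affineSpan, affineSpan_convexHull, direction_affineSpan]
      have h2 : s.card = (s.card - 1) + 1 := by have := hne.card_pos; omega
      classical
      have := finrank_vectorSpan_image_finset_le ℝ (id : E d → E d) s h2
      rw [Finset.image_id] at this
      omega
    have h2 := Real.Convex.dimH_eq_finrank_vectorSpan (convex_hull s) (hne.to_set.mono (subset_hull s))
    have h3 : μH[((d - 1 : ℕ) : NNReal)] (hull s) = 0 :=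
      hausdorffMeasure_of_dimH_lt (by rw [h2]; exact_mod_cast h1)
    rw [surf, Measure.euclideanHausdorffMeasure_def, Measure.smul_apply]
    simp only [NNReal.coe_natCast] at h3
    rw [h3, smul_zero]

namespace IsSimplex

variable {K : Finset (E d)} (hK : IsSimplex K)
include hK

theorem facet_subset_zeroSet {p : E d} (hp : p ∈ K) : hull (K.erase p) ⊆ zeroSet (lam K p) :=
  fun _ hy => ((hK.mem_facet hp).1 hy).2

/-- The compact prism swept by the facet along `v` during unit time has finite volume, and each of
its slices for a time in `[0, 1]` has at least the measure of the facet. -/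
theorem surf_facet_lt_top (hd : 0 < d) {p : E d} (hp : p ∈ K) :
    surf d (hull (K.erase p)) < ⊤ := by
  have : Fact (slope (lam K p) ≠ 0) := ⟨hK.slope_lam_ne_zero hd hp⟩
  set a := lam K p
  set v := unitStep a with hv
  have hF := hK.facet_subset_zeroSet hp
  set B : Set (E d) := (fun z : E d × ℝ => z.1 + z.2 • v) '' (hull (K.erase p) ×ˢ Set.Icc 0 1)
  have hB : IsCompact B := ((isCompact_hull _).prod isCompact_Icc).image (by fun_prop)
  have h1 : volume B < ⊤ := hB.measure_lt_top
  rw [← lintegral_indicator_one hB.isClosed.measurableSet,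
    lintegral_eq_slices (a := a) (measurable_one.indicator hB.isClosed.measurableSet)] at h1
  have h2 : ∫⁻ s in Set.Icc (0 : ℝ) 1, surf d (hull (K.erase p)) ≤
      ∫⁻ s : ℝ, ∫⁻ y in zeroSet a, B.indicator 1 (y + s • v) ∂(surf d) := by
    rw [← lintegral_indicator measurableSet_Icc]
    refine lintegral_mono fun s => ?_
    by_cases hs : s ∈ Set.Icc (0 : ℝ) 1
    · rw [Set.indicator_of_mem hs, ← setLIntegral_one]
      refine (setLIntegral_mono_ae' (measurableSet_hull _) (ae_of_all _ fun y hy => ?_)).trans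
        (lintegral_mono_set hF)
      have hyB : y + s • v ∈ B := ⟨(y, s), ⟨hy, hs⟩, rfl⟩
      rw [Set.indicator_of_mem hyB]
      rfl
    · rw [Set.indicator_of_notMem hs]; exact zero_le
  have h3 : ‖v‖ₑ ≠ 0 := by simpa using unitStep_ne_zero this.out
  have h4 := lt_of_le_of_lt h2 (ENNReal.lt_top_of_mul_ne_top_right h1.ne h3)
  simpa using h4

/-- By the cone formula, a null facet would make the whole simplex null, although its interior is
nonempty. -/
theorem surf_facet_pos (hd : 0 < d) {p : E d} (hp : p ∈ K) : 0 < surf d (hull (K.erase p)) := by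
  rw [pos_iff_ne_zero]
  intro h
  have h1 := hK.cone_formula hd hp (G := 1) measurable_one
  have h2 : (surf d).restrict (hull (K.erase p)) = 0 := by
    rw [Measure.restrict_eq_zero]; exact h
  simp only [h2, lintegral_zero_measure, mul_zero, lintegral_zero] at h1
  have h3 : (0 : ℝ≥0∞) < volume (hull K) :=
    lt_of_lt_of_le ((isOpen_openHull K).measure_pos volume hK.nonempty_openHull)
      (measure_mono (openHull_subset K))
  simp at h1
  exact h3.ne' h1

theorem isFiniteMeasure_facet (hd : 0 < d) {p : E d} (hp : p ∈ K) :
    IsFiniteMeasure ((surf d).restrict (hull (K.erase p))) :=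
  ⟨by simpa using hK.surf_facet_lt_top hd hp⟩

theorem isFiniteMeasure_frontier (hd : 0 < d) :
    IsFiniteMeasure ((surf d).restrict (frontier (hull K))) := by
  refine ⟨?_⟩
  rw [Measure.restrict_apply_univ, hK.frontier_hull]
  exact (measure_biUnion_lt_top K.finite_toSet fun p hp => hK.surf_facet_lt_top hd hp)

theorem real_surf_facet_pos (hd : 0 < d) {p : E d} (hp : p ∈ K) :
    0 < (surf d).real (hull (K.erase p)) :=
  ENNReal.toReal_pos (hK.surf_facet_pos hd hp).ne' (hK.surf_facet_lt_top hd hp).ne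

/-- An affine function that vanishes almost everywhere on a facet vanishes at its vertices. -/
theorem eq_zero_of_ae_facet (hd : 0 < d) {p : E d} (hp : p ∈ K) (a : E d →ᵃ[ℝ] ℝ)
    (h : ∀ᵐ y ∂((surf d).restrict (hull (K.erase p))), a y = 0) {q : E d} (hq : q ∈ K.erase p) :
    a q = 0 := by
  -- The correction makes `b` vanish at `p` without changing it on the facet. Vanishing then
  -- propagates along the rays from `p`, so the cone formula gives `b = 0` on the open simplex and
  -- its slope is zero.
  set b : E d →ᵃ[ℝ] ℝ := a - a p • lam K p with hb
  have hbp : b p = 0 := by simp [hb, hK.lam_self hp]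
  have hby : ∀ y ∈ hull (K.erase p), b y = a y := by
    intro y hy
    simp [hb, ((hK.mem_facet hp).1 hy).2]
  have h1 := hK.cone_formula hd hp (G := fun x => ‖b x‖ₑ) (continuous_affine b).measurable.enorm
  have h2 : ∀ t : ℝ, ∫⁻ y in hull (K.erase p), ‖b (p + t • (y - p))‖ₑ ∂(surf d) = 0 := by
    intro t
    rw [← lintegral_zero (μ := (surf d).restrict (hull (K.erase p)))]
    refine lintegral_congr_ae ?_
    filter_upwards [h, ae_restrict_mem (measurableSet_hull _)] with y hy hyF
    have e := affine_apply_add b p (y - p)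
    rw [add_sub_cancel, hbp, hby y hyF, hy, zero_add] at e
    rw [affine_apply_add, hbp, inner_smul_right, ← e]
    simp
  simp only [h2, mul_zero, lintegral_zero] at h1
  have h3 : ∀ᵐ x ∂(volume.restrict (openHull K)), b x = 0 := by
    rw [restrict_hull, lintegral_eq_zero_iff (continuous_affine b).measurable.enorm] at h1
    filter_upwards [h1] with x hx
    simpa using hx
  have h4 : ∀ x ∈ openHull K, b x = 0 := by
    have := Measure.eqOn_open_of_ae_eq (f := fun x => b x) (g := fun _ => 0) h3
      (isOpen_openHull K) (continuous_affine b).continuousOn continuousOn_const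
    exact this
  have h5 : slope b = 0 := by
    obtain ⟨x, hx⟩ := hK.nonempty_openHull
    have e : (fun y => b y) =ᶠ[𝓝 x] fun _ => 0 := by
      filter_upwards [(isOpen_openHull K).mem_nhds hx] with y hy using h4 y hy
    rw [← gradient_affine b x, gradient_congr e]
    simp
  have h6 := affine_apply_add b p (q - p)
  rw [add_sub_cancel, h5, hbp, hby q (subset_hull _ hq)] at h6
  simpa using h6

/-- Integration by parts on a simplex, in the direction orthogonal to a facet, for functions
supported away from the other facets. -/
theorem integral_fderiv_unitStep (hd : 0 < d) {p : E d} (hp : p ∈ K) {χ : E d → ℝ}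
    (hχ : IsTestFunction {x | ∀ q ∈ K.erase p, 0 < lam K q x} χ) :
    ∫ x in hull K, fderiv ℝ χ x (unitStep (lam K p)) =
      - ‖unitStep (lam K p)‖ * ∫ y in hull (K.erase p), χ y ∂(surf d) := by
  have hfact : Fact (slope (lam K p) ≠ 0) := ⟨hK.slope_lam_ne_zero hd hp⟩
  have ha := hfact.out
  set a := lam K p with hadef
  set v := unitStep a with hv
  set U : Set (E d) := {x | ∀ q ∈ K.erase p, 0 < lam K q x}
  have hz : ∀ x ∉ U, fderiv ℝ χ x v = 0 := fun x hx => by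
    rw [← inner_gradient_left, hχ.gradient_eq_zero hx]; simp
  -- On the support of `χ` only the facet opposite to `p` is visible, so the simplex may be replaced
  -- by a half-space.
  have hU : ∀ x ∈ U, (x ∈ hull K ↔ 0 ≤ a x) := by
    intro x hx
    rw [hK.mem_hull]
    refine ⟨fun h => h p hp, fun h q hq => ?_⟩
    by_cases hqp : q = p
    · rw [hqp]; exact h
    · exact (hx q (Finset.mem_erase.2 ⟨hqp, hq⟩)).le
  have hcf := hχ.1.continuous_fderiv (n := ∞) (by simp)
  have hc : Continuous fun x => fderiv ℝ χ x v := by fun_prop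
  have hcs : HasCompactSupport (fun x => fderiv ℝ χ x v) :=
    (hχ.2.1.fderiv (𝕜 := ℝ)).comp_left (g := fun L : E d →L[ℝ] ℝ => L v) (by simp)
  set P : Set (E d) := {x | 0 ≤ a x}
  have hPm : MeasurableSet P := (isClosed_le continuous_const (continuous_affine a)).measurableSet
  have e1 : ∫ x in hull K, fderiv ℝ χ x v = ∫ x, P.indicator (fun x => fderiv ℝ χ x v) x := by
    rw [← integral_indicator (measurableSet_hull K)]
    refine integral_congr_ae (ae_of_all _ fun x => ?_)
    by_cases hx : x ∈ U
    · simp only [Set.indicator, hU x hx]; rfl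
    · simp [Set.indicator, hz x hx]
  have hint : Integrable (P.indicator fun x => fderiv ℝ χ x v) volume :=
    (hc.integrable_of_hasCompactSupport hcs).indicator hPm
  have hmeas : Measurable (fun z : E d × ℝ => z.1 + z.2 • v) := by fun_prop
  have hv0 : ‖v‖ₑ ≠ 0 := by simpa using unitStep_ne_zero ha
  have hint2 : Integrable (P.indicator fun x => fderiv ℝ χ x v)
      ((((surf d).restrict (zeroSet a)).prod (volume : Measure ℝ)).map
        (fun z => z.1 + z.2 • v)) := by
    rw [volume_eq_map_slices (a := a)] at hint
    rwa [integrable_smul_measure hv0 (by simp)] at hint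
  rw [e1, volume_eq_map_slices (a := a), integral_smul_measure,
    integral_map hmeas.aemeasurable hint2.aestronglyMeasurable]
  have hint3 : Integrable (fun z : E d × ℝ => P.indicator (fun x => fderiv ℝ χ x v) (z.1 + z.2 • v))
      (((surf d).restrict (zeroSet a)).prod (volume : Measure ℝ)) :=
    (integrable_map_measure hint2.aestronglyMeasurable hmeas.aemeasurable).1 hint2
  rw [integral_prod _ hint3]
  -- On each normal line the half-space is the half-line `0 ≤ s`; compact support removes the far
  -- end and the fundamental theorem of calculus leaves minus the value at the facet.
  have e2 : ∀ y ∈ zeroSet a, ∫ s : ℝ, P.indicator (fun x => fderiv ℝ χ x v) (y + s • v) = - χ y := by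
    intro y hy
    have e3 : ∀ s : ℝ, P.indicator (fun x => fderiv ℝ χ x v) (y + s • v) =
        (Set.Ici (0 : ℝ)).indicator (deriv fun s : ℝ => χ (y + s • v)) s := by
      intro s
      have hd1 : HasDerivAt (fun s : ℝ => χ (y + s • v)) (fderiv ℝ χ (y + s • v) v) s := by
        have h1 : HasFDerivAt χ (fderiv ℝ χ (y + s • v)) (y + s • v) :=
          ((hχ.1.differentiable (by simp)) _).hasFDerivAt
        have h2 : HasDerivAt (fun s : ℝ => y + s • v) v s := by
          simpa using ((hasDerivAt_id s).smul_const v).const_add y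
        exact h1.comp_hasDerivAt s h2
      have hiff : y + s • v ∈ P ↔ s ∈ Set.Ici (0 : ℝ) := by
        change 0 ≤ a (y + s • v) ↔ 0 ≤ s
        rw [hv, apply_add_smul_unitStep ha, show a y = 0 from hy, zero_add]
      simp only [Set.indicator, hiff, hd1.deriv]
    simp only [e3]
    rw [integral_indicator measurableSet_Ici, integral_Ici_eq_integral_Ioi]
    have hcs1 : HasCompactSupport (fun s : ℝ => χ (y + s • v)) := by
      have hemb : Topology.IsClosedEmbedding (fun s : ℝ => y + s • v) :=
        (Homeomorph.addLeft y).isClosedEmbedding.comp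
          (isClosedEmbedding_smul_left (unitStep_ne_zero ha))
      exact hχ.2.1.comp_isClosedEmbedding hemb
    have hcd : ContDiff ℝ 1 (fun s : ℝ => χ (y + s • v)) :=
      (hχ.1.of_le (by simp)).comp (by fun_prop)
    rw [hcs1.integral_Ioi_deriv_eq hcd]
    simp
  rw [setIntegral_congr_fun (isClosed_zeroSet a).measurableSet e2, integral_neg]
  have e4 : ∫ y in zeroSet a, χ y ∂(surf d) = ∫ y in hull (K.erase p), χ y ∂(surf d) := by
    refine setIntegral_eq_of_subset_of_forall_sdiff_eq_zero (isClosed_zeroSet a).measurableSet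
      (hK.facet_subset_zeroSet hp) fun y hy => ?_
    by_contra h
    have hyU : y ∈ U := by_contra fun h' => h (hχ.eq_zero h')
    exact hy.2 ((hK.mem_facet hp).2 ⟨(hU y hyU).2 (show a y = 0 from hy.1).ge, hy.1⟩)
  rw [e4, ← hv]
  simp

end IsSimplex

end

section

/-! ### The trace inequality -/

/-- Integrate the derivative of `t ^ d * ψ ^ 2` along the ray from `p` to `y`. The power of `t`
removes the endpoint `p` and leaves exactly the weight `t ^ (d - 1)` of the cone formula. -/
theorem sq_le_integral_ray (hd : 0 < d) {ψ : E d → ℝ} (hψ : ContDiff ℝ ∞ ψ) {p y : E d} {R : ℝ}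
    (hR : ‖y - p‖ ≤ R) :
    ψ y ^ 2 ≤ ∫ t in (0 : ℝ)..1, t ^ (d - 1) *
      ((d + R) * (ψ (p + t • (y - p)) ^ 2 + ‖gradient ψ (p + t • (y - p))‖ ^ 2)) := by
  have hc := continuous_gradient hψ
  have hψc := hψ.continuous
  have hder : ∀ t ∈ Set.uIcc (0 : ℝ) 1, HasDerivAt (fun t : ℝ => t ^ d * ψ (p + t • (y - p)) ^ 2)
      (d * t ^ (d - 1) * ψ (p + t • (y - p)) ^ 2 +
        t ^ d * (2 * ψ (p + t • (y - p)) * ⟪gradient ψ (p + t • (y - p)), y - p⟫_ℝ)) t := by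
    intro t _
    have h1 : HasFDerivAt ψ (fderiv ℝ ψ (p + t • (y - p))) (p + t • (y - p)) :=
      ((hψ.differentiable (by simp)) _).hasFDerivAt
    have h2 : HasDerivAt (fun s : ℝ => p + s • (y - p)) (y - p) t := by
      simpa using ((hasDerivAt_id t).smul_const (y - p)).const_add p
    have h3 := h1.comp_hasDerivAt t h2
    have h4 := (hasDerivAt_pow d t).mul (h3.pow 2)
    rw [inner_gradient_left]
    refine h4.congr_deriv ?_
    simp
  have hint := intervalIntegral.integral_eq_sub_of_hasDerivAt hder
    (Continuous.intervalIntegrable (by fun_prop) _ _)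
  have e : (1 : ℝ) ^ d * ψ (p + (1 : ℝ) • (y - p)) ^ 2 - 0 ^ d * ψ (p + (0 : ℝ) • (y - p)) ^ 2 =
      ψ y ^ 2 := by simp [hd.ne']
  rw [← e, ← hint]
  refine intervalIntegral.integral_mono_on (by norm_num)
    (Continuous.intervalIntegrable (by fun_prop) _ _)
    (Continuous.intervalIntegrable (by fun_prop) _ _) fun t ht => ?_
  set z := p + t • (y - p)
  have h1 : |⟪gradient ψ z, y - p⟫_ℝ| ≤ ‖gradient ψ z‖ * R :=
    (abs_real_inner_le_norm _ _).trans (by gcongr)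
  have hR0 : 0 ≤ R := (norm_nonneg _).trans hR
  have h2 : 2 * ψ z * ⟪gradient ψ z, y - p⟫_ℝ ≤ R * (ψ z ^ 2 + ‖gradient ψ z‖ ^ 2) := by
    calc 2 * ψ z * ⟪gradient ψ z, y - p⟫_ℝ ≤ |2 * ψ z * ⟪gradient ψ z, y - p⟫_ℝ| := le_abs_self _
      _ = 2 * |ψ z| * |⟪gradient ψ z, y - p⟫_ℝ| := by rw [abs_mul, abs_mul]; norm_num
      _ ≤ 2 * |ψ z| * (‖gradient ψ z‖ * R) := by gcongr
      _ ≤ R * (ψ z ^ 2 + ‖gradient ψ z‖ ^ 2) := by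
        have := mul_nonneg hR0 (sq_nonneg (|ψ z| - ‖gradient ψ z‖))
        have h3 := sq_abs (ψ z)
        nlinarith
  have h3 : t ^ d = t ^ (d - 1) * t := by rw [← pow_succ]; congr 1; omega
  rw [h3]
  have h4 : 0 ≤ t ^ (d - 1) := pow_nonneg ht.1 _
  have h5 : t * (2 * ψ z * ⟪gradient ψ z, y - p⟫_ℝ) ≤ R * (ψ z ^ 2 + ‖gradient ψ z‖ ^ 2) := by
    have h6 : 0 ≤ R * (ψ z ^ 2 + ‖gradient ψ z‖ ^ 2) := by positivity
    calc t * (2 * ψ z * ⟪gradient ψ z, y - p⟫_ℝ) ≤ t * (R * (ψ z ^ 2 + ‖gradient ψ z‖ ^ 2)) :=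
          mul_le_mul_of_nonneg_left h2 ht.1
      _ ≤ _ := mul_le_of_le_one_left h6 ht.2
  have h7 : 0 ≤ (d : ℝ) * ‖gradient ψ z‖ ^ 2 := by positivity
  calc d * t ^ (d - 1) * ψ z ^ 2 + t ^ (d - 1) * t * (2 * ψ z * ⟪gradient ψ z, y - p⟫_ℝ)
      = t ^ (d - 1) * (d * ψ z ^ 2 + t * (2 * ψ z * ⟪gradient ψ z, y - p⟫_ℝ)) := by ring
    _ ≤ t ^ (d - 1) * ((d + R) * (ψ z ^ 2 + ‖gradient ψ z‖ ^ 2)) := by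
      refine mul_le_mul_of_nonneg_left ?_ h4
      linarith

theorem enorm_sq_eq_ofReal (x : ℝ) : ‖x‖ₑ ^ 2 = ENNReal.ofReal (x ^ 2) := by
  rw [← ofReal_norm, ← ENNReal.ofReal_pow (norm_nonneg _), Real.norm_eq_abs, sq_abs]

/-- Integrate the bound along rays over the facet and exchange the integrals: the right-hand side
becomes the integral over the simplex written by the cone formula. The constant is `(d + R) / ‖v‖`,
with `R` bounding the distance from `p` to the facet. -/
theorem IsSimplex.facet_trace_inequality (hd : 0 < d) {K : Finset (E d)} (hK : IsSimplex K)
    {p : E d} (hp : p ∈ K) : ∃ C : ℝ≥0∞, C ≠ ⊤ ∧ ∀ ψ : E d → ℝ, ContDiff ℝ ∞ ψ →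
      ∫⁻ y in hull (K.erase p), ‖ψ y‖ₑ ^ 2 ∂(surf d) ≤
        C * ((∫⁻ x in hull K, ‖ψ x‖ₑ ^ 2) + ∫⁻ x in hull K, ‖gradient ψ x‖ₑ ^ 2) := by
  obtain ⟨R, hR⟩ := (isCompact_hull (K.erase p)).exists_bound_of_continuousOn
    (f := fun y => y - p) (by fun_prop)
  set v := unitStep (lam K p)
  have hv0 : ‖v‖ₑ ≠ 0 := by simpa using unitStep_ne_zero (hK.slope_lam_ne_zero hd hp)
  have := hK.isFiniteMeasure_facet hd hp
  refine ⟨‖v‖ₑ⁻¹ * ENNReal.ofReal (d + R), ENNReal.mul_ne_top (by simpa using hv0) (by simp),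
    fun ψ hψ => ?_⟩
  have hc := continuous_gradient hψ
  have hψc := hψ.continuous
  have hR0 : 0 ≤ R := by
    obtain ⟨q, hq⟩ := hK.facet_nonempty hd hp
    exact (norm_nonneg _).trans (hR q (subset_hull _ hq))
  set G : E d → ℝ≥0∞ := fun x => ENNReal.ofReal (d + R) * (‖ψ x‖ₑ ^ 2 + ‖gradient ψ x‖ₑ ^ 2)
    with hGdef
  have hG : Measurable G := by
    have h1 := hψc.measurable
    have h2 := hc.measurable
    fun_prop
  have hGe : ∀ x, G x = ENNReal.ofReal ((d + R) * (ψ x ^ 2 + ‖gradient ψ x‖ ^ 2)) := by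
    intro x
    have h1 : 0 ≤ (d : ℝ) + R := by positivity
    rw [ENNReal.ofReal_mul h1, ENNReal.ofReal_add (sq_nonneg (ψ x)) (sq_nonneg _)]
    simp only [hGdef]
    rw [enorm_sq_eq_ofReal, ← ofReal_norm (gradient ψ x),
      ENNReal.ofReal_pow (norm_nonneg _)]
  have h1 : ∀ y ∈ hull (K.erase p), ‖ψ y‖ₑ ^ 2 ≤ ∫⁻ t in Set.Ioo (0 : ℝ) 1,
      ENNReal.ofReal t ^ (d - 1) * G (p + t • (y - p)) := by
    intro y hy
    rw [enorm_sq_eq_ofReal]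
    refine (ENNReal.ofReal_le_ofReal (sq_le_integral_ray hd hψ (hR y hy))).trans_eq ?_
    rw [intervalIntegral.integral_of_le zero_le_one, integral_Ioc_eq_integral_Ioo,
      ofReal_integral_eq_lintegral_ofReal]
    · refine setLIntegral_congr_fun measurableSet_Ioo fun t ht => ?_
      rw [hGe, ENNReal.ofReal_mul (pow_nonneg ht.1.le _), ENNReal.ofReal_pow ht.1.le]
    · exact ((Continuous.integrableOn_Icc (by fun_prop)).mono_set Set.Ioo_subset_Icc_self)
    · filter_upwards [ae_restrict_mem measurableSet_Ioo] with t ht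
      have := ht.1.le
      simp only [Pi.zero_apply]
      positivity
  have h2 : ∫⁻ y in hull (K.erase p), ‖ψ y‖ₑ ^ 2 ∂(surf d) ≤ ∫⁻ t in Set.Ioo (0 : ℝ) 1,
      ENNReal.ofReal t ^ (d - 1) * ∫⁻ y in hull (K.erase p), G (p + t • (y - p)) ∂(surf d) := by
    refine (setLIntegral_mono_ae' (measurableSet_hull _) (ae_of_all _ h1)).trans_eq ?_
    rw [lintegral_lintegral_swap]
    · refine lintegral_congr fun t => ?_
      rw [lintegral_const_mul]
      fun_prop
    · refine Measurable.aemeasurable ?_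
      fun_prop
  have h3 := hK.cone_formula hd hp hG
  have h4 : ∫⁻ x in hull K, G x = ENNReal.ofReal (d + R) *
      ((∫⁻ x in hull K, ‖ψ x‖ₑ ^ 2) + ∫⁻ x in hull K, ‖gradient ψ x‖ₑ ^ 2) := by
    rw [hGdef, lintegral_const_mul, lintegral_add_left]
    · exact (hψc.measurable.enorm.pow_const 2)
    · exact (hψc.measurable.enorm.pow_const 2).add (hc.measurable.enorm.pow_const 2)
  rw [h4] at h3
  rw [mul_assoc, h3, ← mul_assoc, ENNReal.inv_mul_cancel hv0 (by simp), one_mul]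
  exact h2

theorem setLIntegral_biUnion_finset_le {X ι : Type*} [MeasurableSpace X] {μ : Measure X}
    (s : Finset ι) (t : ι → Set X) (f : X → ℝ≥0∞) :
    ∫⁻ x in ⋃ i ∈ s, t i, f x ∂μ ≤ ∑ i ∈ s, ∫⁻ x in t i, f x ∂μ := by
  classical
  induction s using Finset.induction_on with
  | empty => simp
  | insert i s hi ih =>
    rw [Finset.set_biUnion_insert, Finset.sum_insert hi]
    exact (lintegral_union_le _ _ _).trans (by gcongr)

theorem IsSimplex.trace_inequality (hd : 0 < d) {K : Finset (E d)} (hK : IsSimplex K) :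
    ∃ C : ℝ≥0∞, C ≠ ⊤ ∧ ∀ ψ : E d → ℝ, ContDiff ℝ ∞ ψ →
      eLpNorm ψ 2 ((surf d).restrict (frontier (hull K))) ≤
        C * (eLpNorm ψ 2 (volume.restrict (openHull K)) +
          eLpNorm (gradient ψ) 2 (volume.restrict (openHull K))) := by
  choose! C hC h using fun p (hp : p ∈ K) => hK.facet_trace_inequality hd hp
  set S := ∑ p ∈ K, C p with hS
  have hSt : S ≠ ⊤ := by simpa [hS, ENNReal.sum_eq_top] using hC
  -- Replacing `S` by `S + 1` allows a square root to be taken without an explicit root, since `S ≤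
  -- (S + 1) ^ 2`.
  refine ⟨S + 1, by simpa using hSt, fun ψ hψ => ?_⟩
  have h1 : eLpNorm ψ 2 ((surf d).restrict (frontier (hull K))) ^ 2 ≤
      S * (eLpNorm ψ 2 (volume.restrict (openHull K)) ^ 2 +
          eLpNorm (gradient ψ) 2 (volume.restrict (openHull K)) ^ 2) := by
    rw [eLpNorm_two_sq, eLpNorm_two_sq, eLpNorm_two_sq, hK.frontier_hull, ← restrict_hull, hS,
      Finset.sum_mul]
    refine (setLIntegral_biUnion_finset_le _ _ _).trans (Finset.sum_le_sum fun p hp => h p hp ψ hψ)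
  set a := eLpNorm ψ 2 (volume.restrict (openHull K))
  set b := eLpNorm (gradient ψ) 2 (volume.restrict (openHull K))
  have h2 : S * (a ^ 2 + b ^ 2) ≤ ((S + 1) * (a + b)) ^ 2 := by
    rw [mul_pow]
    gcongr
    · calc S ≤ S + 1 := le_self_add
        _ ≤ (S + 1) ^ 2 := le_self_pow₀ (by simp) (by norm_num)
    · ring_nf
      refine add_le_add_left ?_ _
      exact le_add_self
  exact (ENNReal.pow_le_pow_left_iff two_ne_zero).1 (h1.trans h2)

end

section

/-! ### Approximation by smooth functions -/

section Mollify

variable {F : Type*} [NormedAddCommGroup F] [NormedSpace ℝ F]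

/-- The dilation has Jacobian `s ^ d`, and `s ≥ 1 / 2` bounds its inverse by `2 ^ d` uniformly in
the centre and the translation. -/
theorem lintegral_comp_affine_le {G : E d → ℝ≥0∞} (c t : E d) {s : ℝ} (hs : 1 / 2 ≤ s)
    : ∫⁻ x, G (c + s • (x - c) - t) ≤ 2 ^ d * ∫⁻ x, G x := by
  have hs0 : s ≠ 0 := by linarith
  have h1 : ∀ x, c + s • (x - c) - t = s • x + (c - s • c - t) := fun x => by module
  simp only [h1]
  have h2 : MeasurableEmbedding (fun x : E d => s • x + (c - s • c - t)) :=
    (((Homeomorph.smulOfNeZero s hs0)).trans (Homeomorph.addRight _)).measurableEmbedding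
  have h3 := h2.lintegral_map (μ := volume) G
  rw [← h3]
  have h4 : Measure.map (fun x : E d => s • x + (c - s • c - t)) volume =
      ENNReal.ofReal |(s ^ d)⁻¹| • volume := by
    have e : (fun x : E d => s • x + (c - s • c - t)) =
      (fun x => x + (c - s • c - t)) ∘ (fun x => s • x) := rfl
    rw [e, ← Measure.map_map (by fun_prop) (by fun_prop), Measure.map_addHaar_smul _ hs0,
      finrank_euclideanSpace_fin, Measure.map_smul, map_add_right_eq_self]
  rw [h4, lintegral_smul_measure, smul_eq_mul]
  gcongr
  have h5 : |(s ^ d)⁻¹| ≤ 2 ^ d := by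
    rw [abs_inv, abs_pow, abs_of_pos (by linarith : 0 < s), ← inv_pow]
    refine pow_le_pow_left₀ (by positivity) ?_ _
    rw [inv_le_comm₀ (by linarith) (by norm_num)]
    linarith
  refine (ENNReal.ofReal_le_ofReal h5).trans ?_
  rw [ENNReal.ofReal_pow (by norm_num)]
  simp

theorem eLpNorm_comp_affine_le {w : E d → F} (c t : E d) {s : ℝ} (hs : 1 / 2 ≤ s) :
    eLpNorm (fun x => w (c + s • (x - c) - t)) 2 volume ≤ 2 ^ d * eLpNorm w 2 volume := by
  have h2 : ∀ g : E d → F, eLpNorm g 2 volume ^ 2 = ∫⁻ x, ‖g x‖ₑ ^ 2 := fun g => by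
    have := eLpNorm_nnreal_pow_eq_lintegral (f := g) (μ := (volume : Measure (E d))) (p := 2)
      (by norm_num)
    simpa using this
  refine (ENNReal.pow_le_pow_left_iff two_ne_zero).1 ?_
  rw [mul_pow, h2, h2]
  refine (lintegral_comp_affine_le (G := fun x => ‖w x‖ₑ ^ 2) c t hs).trans ?_
  refine mul_le_mul' ?_ le_rfl
  have h1 : (1 : ℝ≥0∞) ≤ 2 := by norm_num
  exact le_self_pow₀ (one_le_pow₀ h1) two_ne_zero

theorem exists_eLpNorm_affine_sub_le_of_continuous {g : E d → F} (hg : Continuous g)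
    (hgs : HasCompactSupport g) (c : E d) {ε : ℝ≥0∞} (hε : ε ≠ 0) :
    ∃ η : ℝ, 0 < η ∧ ∀ s t, 1 / 2 ≤ s → s ≤ 1 → 1 - s ≤ η → ‖t‖ ≤ η →
      eLpNorm (fun x : E d => g (c + s • (x - c) - t) - g x) 2 volume ≤ ε := by
  obtain ⟨M, hM⟩ := hgs.isCompact.isBounded.subset_closedBall c
  have hM0 : ∀ x, g x ≠ 0 → ‖x - c‖ ≤ M := fun x hx => by
    have := hM (subset_tsupport g hx)
    rwa [Metric.mem_closedBall, dist_eq_norm] at this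
  -- One ball contains the support of `g` and of all its dilated translates: `s ≥ 1 / 2` at most
  -- doubles distances from `c`, and `‖t‖ ≤ 1` adds one before doubling.
  set B := Metric.closedBall c (2 * (|M| + 1)) with hB
  have hBm : volume B < ⊤ := (isCompact_closedBall _ _).measure_lt_top
  obtain ⟨e, he0, he⟩ : ∃ e : ℝ, 0 < e ∧ volume B ^ (1 / (2 : ℝ≥0∞).toReal) * ENNReal.ofReal e ≤ ε := by
    have h1 : volume B ^ (1 / (2 : ℝ≥0∞).toReal) ≠ ⊤ := by
      exact ENNReal.rpow_ne_top_of_nonneg (by simp) hBm.ne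
    have h2 : Tendsto (fun e : ℝ => volume B ^ (1 / (2 : ℝ≥0∞).toReal) * ENNReal.ofReal e) (𝓝[>] 0)
        (𝓝 0) := by
      have h3 : Tendsto (fun e : ℝ => ENNReal.ofReal e) (𝓝[>] 0) (𝓝 0) := by
        have := (ENNReal.continuous_ofReal.tendsto 0)
        rw [ENNReal.ofReal_zero] at this
        exact this.mono_left nhdsWithin_le_nhds
      have := ENNReal.Tendsto.const_mul (a := volume B ^ (1 / (2 : ℝ≥0∞).toReal)) h3 (Or.inr h1)
      rwa [mul_zero] at this
    obtain ⟨e, h3, h4⟩ := (((tendsto_order.1 h2).2 ε (pos_iff_ne_zero.2 hε)).and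
      self_mem_nhdsWithin).exists
    exact ⟨e, h4, h3.le⟩
  obtain ⟨θ, hθ0, hθ⟩ := Metric.uniformContinuous_iff.1
    (hgs.uniformContinuous_of_continuous hg) e he0
  -- On `B` a point moves by at most `(1 - s) ‖x - c‖ + ‖t‖`, which this choice keeps below the
  -- modulus of uniform continuity `θ`.
  set η := min 1 (θ / (2 * (2 * (|M| + 1) + 1))) with hη
  have hMp : 0 < 2 * (2 * (|M| + 1) + 1) := by positivity
  have hη0 : 0 < η := by rw [hη]; positivity
  have hη1 : η * (2 * (2 * (|M| + 1) + 1)) ≤ θ := by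
    rw [← le_div_iff₀ hMp]; exact min_le_right _ _
  refine ⟨η, hη0, fun s t hs hs1 h1s ht => ?_⟩
  have ht1 : ‖t‖ ≤ 1 := ht.trans (min_le_left _ _)
  refine (eLpNorm_sub_le_of_dist_bdd (s := B) volume (by norm_num) Metric.isClosed_closedBall.measurableSet
    he0.le (f := fun x => g (c + s • (x - c) - t)) (g := g) ?_ ?_ ?_).trans ?_
  · intro x
    by_cases hx : x ∈ B
    · refine (hθ ?_).le
      rw [hB, Metric.mem_closedBall, dist_eq_norm] at hx
      rw [dist_eq_norm, show c + s • (x - c) - t - x = -((1 - s) • (x - c) + t) by module, norm_neg]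
      calc ‖(1 - s) • (x - c) + t‖ ≤ (1 - s) * ‖x - c‖ + ‖t‖ := by
            refine (norm_add_le _ _).trans ?_
            rw [norm_smul, Real.norm_of_nonneg (by linarith)]
        _ ≤ η * (2 * (|M| + 1)) + η := by gcongr
        _ < η * (2 * (2 * (|M| + 1) + 1)) := by nlinarith [abs_nonneg M]
        _ ≤ θ := hη1
    · have hx' : 2 * (|M| + 1) < ‖x - c‖ := by
        rw [hB, Metric.mem_closedBall, dist_eq_norm] at hx; linarith
      have h1 : g x = 0 := by
        by_contra h
        have := hM0 x h
        linarith [le_abs_self M, abs_nonneg M]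
      have h2 : g (c + s • (x - c) - t) = 0 := by
        by_contra h
        have h3 := hM0 _ h
        rw [show c + s • (x - c) - t - c = s • (x - c) - t by module] at h3
        have h4 := norm_sub_norm_le (s • (x - c)) t
        rw [norm_smul, Real.norm_of_nonneg (by linarith)] at h4
        have h5 : 1 / 2 * ‖x - c‖ ≤ s * ‖x - c‖ := by gcongr
        linarith [le_abs_self M]
      rw [h1, h2, dist_self]; exact he0.le
  · intro x hx
    rw [hB, Metric.mem_closedBall, dist_eq_norm]
    have h3 := hM0 _ hx
    rw [show c + s • (x - c) - t - c = s • (x - c) - t by module] at h3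
    have h4 := norm_sub_norm_le (s • (x - c)) t
    rw [norm_smul, Real.norm_of_nonneg (by linarith)] at h4
    have h5 : 1 / 2 * ‖x - c‖ ≤ s * ‖x - c‖ := by gcongr
    linarith [le_abs_self M]
  · intro x hx
    rw [hB, Metric.mem_closedBall, dist_eq_norm]
    have := hM0 x hx
    linarith [le_abs_self M, abs_nonneg M]
  · rwa [mul_comm] 

/-- Approximate `w` by a continuous function of compact support. The denominator `2 ^ d + 1 + 1`
counts the three errors, of which the composed one costs a factor `2 ^ d`. -/
theorem exists_eLpNorm_affine_sub_le {w : E d → F} (hw : MemLp w 2 volume)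
    (hws : StronglyMeasurable w)
    (c : E d) {ε : ℝ≥0∞} (hε : ε ≠ 0) :
    ∃ η : ℝ, 0 < η ∧ ∀ s t, 1 / 2 ≤ s → s ≤ 1 → 1 - s ≤ η → ‖t‖ ≤ η →
      eLpNorm (fun x : E d => w (c + s • (x - c) - t) - w x) 2 volume ≤ ε := by
  have hk : ((2 : ℝ≥0∞) ^ d + 1 + 1) ≠ 0 := by simp
  have hk' : ((2 : ℝ≥0∞) ^ d + 1 + 1) ≠ ⊤ := by simp
  set e := ε / (2 ^ d + 1 + 1) with he
  have he0 : e ≠ 0 := ENNReal.div_ne_zero.2 ⟨hε, hk'⟩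
  obtain ⟨g, hgs, hge, hgc, -⟩ := hw.exists_hasCompactSupport_eLpNorm_sub_le (by norm_num) he0
  obtain ⟨η, hη0, hη⟩ := exists_eLpNorm_affine_sub_le_of_continuous hgc hgs c he0
  refine ⟨η, hη0, fun s t hs hs1 h1 h2 => ?_⟩
  have hA : Measurable fun x : E d => c + s • (x - c) - t := by fun_prop
  have m1 : StronglyMeasurable (fun x => (w - g) (c + s • (x - c) - t)) :=
    (hws.sub hgc.stronglyMeasurable).comp_measurable hA
  have m2 : StronglyMeasurable (fun x => g (c + s • (x - c) - t) - g x) :=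
    (hgc.stronglyMeasurable.comp_measurable hA).sub hgc.stronglyMeasurable
  have e1 : (fun x : E d => w (c + s • (x - c) - t) - w x) =
      ((fun x => (w - g) (c + s • (x - c) - t)) + (fun x => g (c + s • (x - c) - t) - g x)) +
        (g - w) := by
    ext x; simp
  rw [e1]
  calc _ ≤ eLpNorm (fun x => (w - g) (c + s • (x - c) - t)) 2 volume +
        eLpNorm (fun x => g (c + s • (x - c) - t) - g x) 2 volume + eLpNorm (g - w) 2 volume := by
        refine (eLpNorm_add_le (m1.add m2).aestronglyMeasurable
          (hgc.stronglyMeasurable.sub hws).aestronglyMeasurable (by norm_num)).trans ?_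
        gcongr
        exact eLpNorm_add_le m1.aestronglyMeasurable m2.aestronglyMeasurable (by norm_num)
    _ ≤ 2 ^ d * e + e + e := by
        gcongr
        · exact (eLpNorm_comp_affine_le c t hs).trans (by gcongr)
        · exact hη s t hs hs1 h1 h2
        · rwa [eLpNorm_sub_comm]
    _ = (2 ^ d + 1 + 1) * e := by ring
    _ ≤ ε := by rw [he]; exact ENNReal.mul_div_le

/-- The mollification of `w` with the kernel `ρ`. -/
def mollify (ρ : E d → ℝ) (w : E d → F) (y : E d) : F := ∫ z, ρ (y - z) • w z

theorem integrable_kernel_smul {ρ : E d → ℝ} (hρ : Continuous ρ) (hρs : HasCompactSupport ρ)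
    {w : E d → F} (hw : MemLp w 2 volume) (y : E d) :
    Integrable (fun t => ρ t • w (y - t)) volume := by
  rw [← memLp_one_iff_integrable]
  have h1 : MemLp (fun t => w (y - t)) 2 volume :=
    hw.comp_measurePreserving (Measure.measurePreserving_sub_left volume y)
  exact h1.smul (hρ.memLp_of_hasCompactSupport hρs (p := 2))

theorem mollify_eq (ρ : E d → ℝ) (w : E d → F) (y : E d) :
    mollify ρ w y = ∫ t, ρ t • w (y - t) := by
  rw [mollify, ← integral_sub_left_eq_self _ volume y]
  simp

theorem sq_lintegral_le {X : Type*} [MeasurableSpace X] (ν : Measure X) [IsProbabilityMeasure ν]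
    {f : X → ℝ≥0∞} (hf : AEMeasurable f ν) : (∫⁻ x, f x ∂ν) ^ 2 ≤ ∫⁻ x, f x ^ 2 ∂ν := by
  have h := ENNReal.lintegral_mul_le_Lp_mul_Lq ν (Real.HolderConjugate.two_two) hf
    (aemeasurable_const (b := (1 : ℝ≥0∞)))
  simp only [Pi.mul_apply, mul_one, ENNReal.one_rpow, lintegral_const, measure_univ] at h
  calc (∫⁻ x, f x ∂ν) ^ 2 ≤ ((∫⁻ x, f x ^ (2 : ℝ) ∂ν) ^ (1 / (2 : ℝ))) ^ 2 := by gcongr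
    _ = ∫⁻ x, f x ^ (2 : ℝ) ∂ν := by
      rw [← ENNReal.rpow_natCast, ← ENNReal.rpow_mul]; norm_num
    _ = _ := by norm_num

/-- The kernel is a probability density, so this is Jensen's inequality for the square. -/
theorem enorm_mollify_sub_sq_le [CompleteSpace F] {ρ : E d → ℝ} (hρ : Continuous ρ)
    (hρs : HasCompactSupport ρ) (hρ0 : ∀ t, 0 ≤ ρ t) (hρ1 : ∫ t, ρ t = 1)
    {w : E d → F} (hw : MemLp w 2 volume) (hws : StronglyMeasurable w) (y : E d) (z : F) :
    ‖mollify ρ w y - z‖ₑ ^ 2 ≤ ∫⁻ t, ENNReal.ofReal (ρ t) * ‖w (y - t) - z‖ₑ ^ 2 := by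
  have hρi : Integrable ρ := hρ.integrable_of_hasCompactSupport hρs
  have hρm : Measurable fun t => ENNReal.ofReal (ρ t) := hρ.measurable.ennreal_ofReal
  have hprob : IsProbabilityMeasure (volume.withDensity fun t => ENNReal.ofReal (ρ t)) := by
    refine ⟨?_⟩
    rw [withDensity_apply _ MeasurableSet.univ, setLIntegral_univ,
      ← ofReal_integral_eq_lintegral_ofReal hρi (ae_of_all _ hρ0), hρ1, ENNReal.ofReal_one]
  have hwt : StronglyMeasurable (fun t : E d => w (y - t)) :=
    hws.comp_measurable (measurable_const.sub measurable_id)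
  have hDt : StronglyMeasurable (fun t : E d => w (y - t) - z) := hwt.sub stronglyMeasurable_const
  have e1 : mollify ρ w y - z = ∫ t, ρ t • (w (y - t) - z) := by
    simp only [smul_sub]
    rw [integral_sub (integrable_kernel_smul hρ hρs hw _) (hρi.smul_const _), mollify_eq,
      integral_smul_const, hρ1, one_smul]
  have e2 : ‖∫ t, ρ t • (w (y - t) - z)‖ₑ ≤
      ∫⁻ t, ‖w (y - t) - z‖ₑ ∂(volume.withDensity fun t => ENNReal.ofReal (ρ t)) := by
    refine (enorm_integral_le_lintegral_enorm _).trans_eq ?_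
    rw [lintegral_withDensity_eq_lintegral_mul _ hρm hDt.enorm]
    refine lintegral_congr fun t => ?_
    rw [enorm_smul, Pi.mul_apply, Real.enorm_of_nonneg (hρ0 t)]
  rw [e1]
  refine (pow_le_pow_left' e2 2).trans ((sq_lintegral_le _ hDt.enorm.aemeasurable).trans_eq ?_)
  rw [lintegral_withDensity_eq_lintegral_mul _ hρm (hDt.enorm.pow_const 2)]
  rfl

/-- Integrating the pointwise Jensen bound and exchanging the integrals averages the translation
errors over the support of the kernel, where each is at most `ε`. -/
theorem eLpNorm_mollify_sub_le [CompleteSpace F] {ρ : E d → ℝ} (hρ : Continuous ρ)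
    (hρs : HasCompactSupport ρ) (hρ0 : ∀ t, 0 ≤ ρ t) (hρ1 : ∫ t, ρ t = 1) {δ : ℝ}
    (hδ : ∀ t, ρ t ≠ 0 → ‖t‖ ≤ δ) {w : E d → F} (hw : MemLp w 2 volume) (hws : StronglyMeasurable w)
    (c : E d) (s : ℝ) {ε : ℝ≥0∞}
    (h : ∀ t : E d, ‖t‖ ≤ δ →
      eLpNorm (fun x : E d => w (c + s • (x - c) - t) - w x) 2 volume ≤ ε) :
    eLpNorm (fun x => mollify ρ w (c + s • (x - c)) - w x) 2 volume ≤ ε := by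
  have h2 : ∀ g : E d → F, eLpNorm g 2 volume ^ 2 = ∫⁻ x, ‖g x‖ₑ ^ 2 := fun g => by
    have := eLpNorm_nnreal_pow_eq_lintegral (f := g) (μ := (volume : Measure (E d))) (p := 2)
      (by norm_num)
    simpa using this
  have hρi : Integrable ρ := hρ.integrable_of_hasCompactSupport hρs
  have hρm : Measurable fun t => ENNReal.ofReal (ρ t) := hρ.measurable.ennreal_ofReal
  have hg : Measurable fun z : E d × E d => c + s • (z.1 - c) - z.2 := by fun_prop
  have hD1 : StronglyMeasurable (fun z : E d × E d => w (c + s • (z.1 - c) - z.2)) :=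
    hws.comp_measurable hg
  have hD2 : StronglyMeasurable (fun z : E d × E d => w z.1) := hws.comp_measurable measurable_fst
  have hD := hD1.sub hD2
  have hDm : Measurable (fun z : E d × E d => ENNReal.ofReal (ρ z.2) *
      ‖w (c + s • (z.1 - c) - z.2) - w z.1‖ₑ ^ 2) :=
    (hρm.comp measurable_snd).mul (hD.enorm.pow_const 2)
  refine (ENNReal.pow_le_pow_left_iff two_ne_zero).1 ?_
  rw [h2]
  calc ∫⁻ x, ‖mollify ρ w (c + s • (x - c)) - w x‖ₑ ^ 2
      ≤ ∫⁻ x, ∫⁻ t, ENNReal.ofReal (ρ t) * ‖w (c + s • (x - c) - t) - w x‖ₑ ^ 2 :=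
        lintegral_mono fun x => enorm_mollify_sub_sq_le hρ hρs hρ0 hρ1 hw hws _ _
    _ = ∫⁻ t, ∫⁻ x, ENNReal.ofReal (ρ t) * ‖w (c + s • (x - c) - t) - w x‖ₑ ^ 2 :=
        lintegral_lintegral_swap hDm.aemeasurable
    _ ≤ ∫⁻ t, ENNReal.ofReal (ρ t) * ε ^ 2 := by
        refine lintegral_mono fun t => ?_
        rw [lintegral_const_mul' _ _ ENNReal.ofReal_ne_top, ← h2]
        by_cases ht : ρ t = 0
        · simp [ht]
        · gcongr
          exact h t (hδ t ht)
    _ = ε ^ 2 := by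
        rw [lintegral_mul_const _ hρm, ← ofReal_integral_eq_lintegral_ofReal hρi
          (ae_of_all _ hρ0), hρ1, ENNReal.ofReal_one, one_mul]

end Mollify

theorem hasFDerivAt_mollify {ρ : E d → ℝ} (hρ : ContDiff ℝ ∞ ρ) (hρs : HasCompactSupport ρ)
    {w : E d → ℝ} (hw : MemLp w 2 volume) (y e : E d) :
    fderiv ℝ (mollify ρ w) y e = ∫ z, w z * fderiv ℝ ρ (y - z) e := by
  have e1 : mollify ρ w = convolution w ρ (ContinuousLinearMap.mul ℝ ℝ) volume := by
    ext y
    simp [mollify, convolution, mul_comm]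
  have hl : LocallyIntegrable w volume := hw.locallyIntegrable (by norm_num)
  have h := hρs.hasFDerivAt_convolution_right (ContinuousLinearMap.mul ℝ ℝ) hl
    (hρ.of_le (by simp)) y
  rw [e1, h.fderiv, convolution_precompR_apply (ContinuousLinearMap.mul ℝ ℝ) hl (hρs.fderiv (𝕜 := ℝ))
    (hρ.continuous_fderiv (by simp))]
  simp [convolution]

theorem continuous_mollify {F : Type*} [NormedAddCommGroup F] [NormedSpace ℝ F] {ρ : E d → ℝ}
    (hρ : Continuous ρ) (hρs : HasCompactSupport ρ)
    {w : E d → F} (hw : MemLp w 2 volume) : Continuous (mollify ρ w) := by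
  have e1 : mollify ρ w = convolution w ρ (ContinuousLinearMap.lsmul ℝ ℝ).flip volume := by
    ext y
    simp [mollify, convolution]
  rw [e1]
  exact hρs.continuous_convolution_right _ (hw.locallyIntegrable (by norm_num)) hρ

theorem contDiff_mollify {ρ : E d → ℝ} (hρ : ContDiff ℝ ∞ ρ) (hρs : HasCompactSupport ρ)
    {w : E d → ℝ} (hw : MemLp w 2 volume) : ContDiff ℝ ∞ (mollify ρ w) := by
  have e1 : mollify ρ w = convolution w ρ (ContinuousLinearMap.mul ℝ ℝ) volume := by
    ext y
    simp [mollify, convolution, mul_comm]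
  rw [e1]
  exact hρs.contDiff_convolution_right _ (hw.locallyIntegrable (by norm_num)) hρ

/-- When all points sampled around `y` lie in `U`, the reflected kernel `ρ (y - ·)` is a test
function on `U`; the definition of the weak gradient moves the derivative from the kernel to `v`.
Extension by zero creates no boundary term at such a `y`. -/
theorem gradient_mollify {U : Set (E d)} {v : Field d} (hv : MemH1 U v) (hU : MeasurableSet U)
    {ρ : E d → ℝ} (hρ : ContDiff ℝ ∞ ρ) (hρs : HasCompactSupport ρ) {y : E d}
    (hy : ∀ t, t ∈ tsupport ρ → y - t ∈ U) :
    gradient (mollify ρ (U.indicator v.1)) y = mollify ρ (U.indicator v.2) y := by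
  have hw1 : MemLp (U.indicator v.1) 2 volume := (memLp_indicator_iff_restrict hU).2 hv.memLp
  have hw2 : MemLp (U.indicator v.2) 2 volume := (memLp_indicator_iff_restrict hU).2 hv.memLp_grad
  have htest : IsTestFunction U (fun z => ρ (y - z)) := by
    refine ⟨hρ.comp (by fun_prop), hρs.comp_homeomorph (Homeomorph.subLeft y), ?_⟩
    intro z hz
    have := tsupport_comp_subset_preimage ρ (f := fun z => y - z) (by fun_prop) hz
    have h2 := hy _ this
    simpa using h2
  refine ext_inner_right ℝ fun e => ?_
  rw [inner_gradient_left, hasFDerivAt_mollify hρ hρs hw1]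
  have h1 := hv.weak_grad_inner htest e
  have h2 : ∀ z, ⟪gradient (fun z => ρ (y - z)) z, e⟫_ℝ = - fderiv ℝ ρ (y - z) e := by
    intro z
    have h3 : HasFDerivAt ρ (fderiv ℝ ρ (y - z)) (y - z) :=
      ((hρ.differentiable (by simp)) _).hasFDerivAt
    have h4 : HasFDerivAt (fun z : E d => y - z) (-ContinuousLinearMap.id ℝ (E d)) z :=
      (hasFDerivAt_id z).const_sub y
    rw [inner_gradient_left, show (fun z => ρ (y - z)) = ρ ∘ (fun z => y - z) from rfl,
      (h3.comp z h4).fderiv]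
    simp
  simp only [h2, mul_neg, integral_neg, neg_inj] at h1
  have i1 : Integrable (fun z => ρ (y - z) • U.indicator v.2 z) volume :=
    MemLp.integrable_smul_two (htest.memLp volume) hw2
  rw [mollify, real_inner_comm, ← integral_inner i1]
  have e1 : ∫ z, U.indicator v.1 z * fderiv ℝ ρ (y - z) e = ∫ z in U, v.1 z * fderiv ℝ ρ (y - z) e := by
    rw [← integral_indicator hU]
    refine integral_congr_ae (ae_of_all _ fun z => ?_)
    by_cases hz : z ∈ U <;> simp [hz]
  have e2 : ∫ z, ⟪e, ρ (y - z) • U.indicator v.2 z⟫_ℝ = ∫ z in U, ρ (y - z) * ⟪v.2 z, e⟫_ℝ := by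
    rw [← integral_indicator hU]
    refine integral_congr_ae (ae_of_all _ fun z => ?_)
    by_cases hz : z ∈ U <;> simp [hz, inner_smul_right, real_inner_comm]
  rw [e1, e2, h1]

/-- Mollification alone would sample outside `U` near the boundary. Contracting towards an interior
point `c` first makes room: by convexity, a neighbourhood of the contracted point lies in `U`, of
size proportional to `τ = 1 - s`. -/
theorem exists_smooth_approx {U : Set (E d)} (hU : IsOpen U) (hUc : Convex ℝ U)
    (hUne : U.Nonempty) {v : Field d} (hv : MemH1 U v) {ε : ℝ≥0∞} (hε : ε ≠ 0) :
    ∃ ψ : E d → ℝ, ContDiff ℝ ∞ ψ ∧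
      eLpNorm (fun x => ψ x - v.1 x) 2 (volume.restrict U) ≤ ε ∧
      eLpNorm (fun x => gradient ψ x - v.2 x) 2 (volume.restrict U) ≤ ε := by
  wlog hm : StronglyMeasurable v.1 ∧ StronglyMeasurable v.2 generalizing v
  · have h1 := hv.memLp.1
    have h2 := hv.memLp_grad.1
    obtain ⟨ψ, h3, h4, h5⟩ := this (v := (h1.mk v.1, h2.mk v.2))
      (hv.congr h1.ae_eq_mk h2.ae_eq_mk) ⟨h1.stronglyMeasurable_mk, h2.stronglyMeasurable_mk⟩
    refine ⟨ψ, h3, ?_, ?_⟩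
    · rw [eLpNorm_congr_ae (g := fun x => ψ x - h1.mk v.1 x)]
      · exact h4
      · filter_upwards [h1.ae_eq_mk] with x hx; rw [← hx]
    · rw [eLpNorm_congr_ae (g := fun x => gradient ψ x - h2.mk v.2 x)]
      · exact h5
      · filter_upwards [h2.ae_eq_mk] with x hx; rw [← hx]
  have hUm := hU.measurableSet
  set w1 := U.indicator v.1 with hw1d
  set w2 := U.indicator v.2 with hw2d
  have hw1 : MemLp w1 2 volume := (memLp_indicator_iff_restrict hUm).2 hv.memLp
  have hw2 : MemLp w2 2 volume := (memLp_indicator_iff_restrict hUm).2 hv.memLp_grad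
  have hs1 : StronglyMeasurable w1 := hm.1.indicator hUm
  have hs2 : StronglyMeasurable w2 := hm.2.indicator hUm
  obtain ⟨c, hc⟩ := hUne
  obtain ⟨r, hr0, hr⟩ := Metric.isOpen_iff.1 hU c hc
  have hε2 : ε / 2 ≠ 0 := by simpa using hε
  obtain ⟨η1, h10, h1⟩ := exists_eLpNorm_affine_sub_le hw1 hs1 c hε
  obtain ⟨η2, h20, h2⟩ := exists_eLpNorm_affine_sub_le hw2 hs2 c hε2
  -- The chain rule multiplies the gradient by `s = 1 - τ`. The missing part `τ • w2` is paid for by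
  -- the second half of `ε`.
  obtain ⟨η3, h30, h3⟩ : ∃ η : ℝ, 0 < η ∧ ENNReal.ofReal η * eLpNorm w2 2 volume ≤ ε / 2 := by
    have h3 : Tendsto (fun e : ℝ => ENNReal.ofReal e * eLpNorm w2 2 volume) (𝓝[>] 0) (𝓝 0) := by
      have := (ENNReal.continuous_ofReal.tendsto 0)
      rw [ENNReal.ofReal_zero] at this
      have := ENNReal.Tendsto.mul_const (b := eLpNorm w2 2 volume)
        (this.mono_left (nhdsWithin_le_nhds (s := Set.Ioi 0))) (Or.inr hw2.2.ne)
      rwa [zero_mul] at this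
    obtain ⟨e, h3, h4⟩ := (((tendsto_order.1 h3).2 _ (pos_iff_ne_zero.2 hε2)).and
      self_mem_nhdsWithin).exists
    exact ⟨e, h4, h3.le⟩
  set τ := min (1 / 2) (min η1 (min η2 η3)) with hτ
  have hτ0 : 0 < τ := by simp [hτ, h10, h20, h30]
  have hτ2 : τ ≤ 1 / 2 := min_le_left _ _
  have hτ1' : τ ≤ η1 := (min_le_right _ _).trans (min_le_left _ _)
  have hτ2' : τ ≤ η2 := (min_le_right _ _).trans ((min_le_right _ _).trans (min_le_left _ _))
  have hτ3' : τ ≤ η3 := (min_le_right _ _).trans ((min_le_right _ _).trans (min_le_right _ _))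
  set s := 1 - τ with hs
  set δ := min (min η1 η2) (τ * r / 2) with hδ
  have hδ0 : 0 < δ := by simp [hδ, h10, h20]; positivity
  have hδ1 : δ ≤ η1 := (min_le_left _ _).trans (min_le_left _ _)
  have hδ2 : δ ≤ η2 := (min_le_left _ _).trans (min_le_right _ _)
  have hδr : δ < τ * r := by
    have : 0 < τ * r := by positivity
    exact (min_le_right _ _).trans_lt (by linarith)
  let b : ContDiffBump (0 : E d) := ⟨δ / 2, δ, by positivity, by linarith⟩
  set ρ := b.normed volume with hρd
  have hρ : ContDiff ℝ ∞ ρ := b.contDiff_normed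
  have hρs : HasCompactSupport ρ := b.hasCompactSupport_normed
  have hρ0 : ∀ t, 0 ≤ ρ t := b.nonneg_normed
  have hρ1 : ∫ t, ρ t = 1 := b.integral_normed
  have hts : tsupport ρ = Metric.closedBall 0 δ := b.tsupport_normed_eq
  have hsupp : ∀ t, ρ t ≠ 0 → ‖t‖ ≤ δ := by
    intro t ht
    have := subset_tsupport ρ ht
    rwa [hts, mem_closedBall_zero_iff] at this
  set ψ : E d → ℝ := fun x => mollify ρ w1 (c + s • (x - c)) with hψ
  have hA1 := eLpNorm_mollify_sub_le hρ.continuous hρs hρ0 hρ1 hsupp hw1 hs1 c s (ε := ε)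
    fun t ht => h1 s t (by linarith) (by linarith) (by linarith) (ht.trans hδ1)
  have hA2 := eLpNorm_mollify_sub_le hρ.continuous hρs hρ0 hρ1 hsupp hw2 hs2 c s (ε := ε / 2)
    fun t ht => h2 s t (by linarith) (by linarith) (by linarith) (ht.trans hδ2)
  have hgrad : ∀ x ∈ U, gradient ψ x = s • mollify ρ w2 (c + s • (x - c)) := by
    intro x hx
    have hy : ∀ t, t ∈ tsupport ρ → c + s • (x - c) - t ∈ U := by
      intro t ht
      rw [hts, mem_closedBall_zero_iff] at ht
      -- Every sampled point is the convex combination `s • x + τ • (c - τ⁻¹ • t)`. The bound `δ < τ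
      -- * r` keeps its second point in the ball of radius `r` about `c`.
      have hz : c - τ⁻¹ • t ∈ U := by
        refine hr ?_
        rw [Metric.mem_ball, dist_eq_norm, show c - τ⁻¹ • t - c = -(τ⁻¹ • t) by abel, norm_neg,
          norm_smul, Real.norm_of_nonneg (by positivity), inv_mul_lt_iff₀ hτ0]
        linarith
      have h4 := hUc hx hz (show 0 ≤ s by linarith) hτ0.le (by rw [hs]; ring)
      have e : s • x + τ • (c - τ⁻¹ • t) = c + s • (x - c) - t := by
        rw [smul_sub, smul_smul, mul_inv_cancel₀ hτ0.ne', hs]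
        module
      rwa [e] at h4
    rw [hw2d, ← gradient_mollify hv hUm hρ hρs hy, ← hw1d]
    refine ext_inner_right ℝ fun e => ?_
    rw [inner_gradient_left, inner_smul_left, inner_gradient_left]
    have d1 : HasFDerivAt (mollify ρ w1) (fderiv ℝ (mollify ρ w1) (c + s • (x - c)))
        (c + s • (x - c)) := ((contDiff_mollify hρ hρs hw1).differentiable (by simp) _).hasFDerivAt
    have d2 : HasFDerivAt (fun x : E d => c + s • (x - c)) (s • ContinuousLinearMap.id ℝ (E d)) x :=
      (((hasFDerivAt_id x).sub_const c).const_smul s).const_add c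
    rw [show ψ = mollify ρ w1 ∘ (fun x : E d => c + s • (x - c)) from rfl, (d1.comp x d2).fderiv]
    simp
  refine ⟨ψ, (contDiff_mollify hρ hρs hw1).comp (by fun_prop), ?_, ?_⟩
  · rw [eLpNorm_congr_ae (g := fun x => mollify ρ w1 (c + s • (x - c)) - w1 x)]
    · exact (eLpNorm_mono_measure _ Measure.restrict_le_self).trans hA1
    · filter_upwards [ae_restrict_mem hUm] with x hx
      rw [hw1d, Set.indicator_of_mem hx]
  · have hmeas : Continuous (mollify ρ w2) := continuous_mollify hρ.continuous hρs hw2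
    rw [eLpNorm_congr_ae (g := (s • fun x => mollify ρ w2 (c + s • (x - c)) - w2 x) - τ • w2)]
    · refine (eLpNorm_mono_measure _ Measure.restrict_le_self).trans ?_
      refine (eLpNorm_sub_le ?_ ?_ (by norm_num)).trans ?_
      · exact (((hmeas.comp (by fun_prop : Continuous fun x : E d => c + s • (x - c))).aestronglyMeasurable.sub
          hw2.1).const_smul s)
      · exact hw2.1.const_smul τ
      · rw [← ENNReal.add_halves ε, eLpNorm_const_smul, eLpNorm_const_smul]
        gcongr
        · refine le_trans ?_ hA2
          refine mul_le_of_le_one_left zero_le ?_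
          rw [Real.enorm_of_nonneg (by linarith)]
          simp [hs, hτ0.le]
        · refine le_trans ?_ h3
          rw [Real.enorm_of_nonneg hτ0.le]
          gcongr
    · filter_upwards [ae_restrict_mem hUm] with x hx
      rw [hgrad x hx, ← Set.indicator_of_mem hx v.2, ← hw2d]
      simp only [Pi.sub_apply, Pi.smul_apply, hs]
      module

theorem exists_tendstoH1 {U : Set (E d)} (hU : IsOpen U) (hUc : Convex ℝ U)
    (hUne : U.Nonempty) {v : Field d} (hv : MemH1 U v) :
    ∃ ψ : ℕ → E d → ℝ, (∀ n, ContDiff ℝ ∞ (ψ n)) ∧ TendstoH1 U ψ v := by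
  have hn : ∀ n : ℕ, ((n : ℝ≥0∞) + 1)⁻¹ ≠ 0 := fun n => by simp
  choose ψ h1 h2 h3 using fun n : ℕ => exists_smooth_approx hU hUc hUne hv (hn n)
  have ht : Tendsto (fun n : ℕ => ((n : ℝ≥0∞) + 1)⁻¹) atTop (𝓝 0) := by
    have := (tendsto_add_atTop_iff_nat 1).2 ENNReal.tendsto_inv_nat_nhds_zero
    simpa using this
  exact ⟨ψ, h1, tendsto_of_tendsto_of_tendsto_of_le_of_le tendsto_const_nhds ht
    (fun _ => zero_le) h2, tendsto_of_tendsto_of_tendsto_of_le_of_le tendsto_const_nhds ht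
    (fun _ => zero_le) h3⟩

end

section

/-! ### Traces -/

theorem tendsto_eLpNorm_sub {X F : Type*} [MeasurableSpace X] {μ : Measure X}
    [NormedAddCommGroup F] {f f' : ℕ → X → F} {g : X → F}
    (hf : ∀ n, AEStronglyMeasurable (f n) μ) (hg : AEStronglyMeasurable g μ)
    (hf' : ∀ n, AEStronglyMeasurable (f' n) μ)
    (h : Tendsto (fun n => eLpNorm (fun x => f n x - g x) 2 μ) atTop (𝓝 0))
    (h' : Tendsto (fun n => eLpNorm (fun x => f' n x - g x) 2 μ) atTop (𝓝 0)) :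
    Tendsto (fun n => eLpNorm (fun x => f n x - f' n x) 2 μ) atTop (𝓝 0) := by
  have h1 := h.add h'
  rw [add_zero] at h1
  refine tendsto_of_tendsto_of_tendsto_of_le_of_le tendsto_const_nhds h1 (fun _ => zero_le) ?_
  intro n
  have e : (fun x => f n x - f' n x) = (f n - g) - (f' n - g) := by ext x; simp
  simp only [e]
  exact eLpNorm_sub_le ((hf n).sub hg) ((hf' n).sub hg) (p := 2) (by norm_num)

theorem gradient_sub {f g : E d → ℝ} {x : E d} (hf : DifferentiableAt ℝ f x)
    (hg : DifferentiableAt ℝ g x) :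
    gradient (fun y => f y - g y) x = gradient f x - gradient g x := by
  have h := gradient_add hf (hg.const_mul (-1))
  rw [gradient_const_mul _ hg] at h
  simpa [sub_eq_add_neg] using h

theorem MemH1.smul {U : Set (E d)} {v : Field d} (hv : MemH1 U v) (c : ℝ) : MemH1 U (c • v) :=
  (H1 U).smul_mem c hv

variable {K : Finset (E d)} {v w : Field d} {τ σ : E d → ℝ}

theorem IsSimplex.memLp_frontier (hd : 0 < d) (hK : IsSimplex K) {f : E d → ℝ}
    (hf : Continuous f) : MemLp f 2 ((surf d).restrict (frontier (hull K))) := by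
  have := hK.isFiniteMeasure_frontier hd
  obtain ⟨C, hC⟩ := ((isCompact_hull K).of_isClosed_subset isClosed_frontier
    (isClosed_hull K).frontier_subset).exists_bound_of_continuousOn hf.continuousOn
  refine MemLp.of_bound hf.aestronglyMeasurable C ?_
  filter_upwards [ae_restrict_mem isClosed_frontier.measurableSet] with x hx using hC x hx

theorem IsSimplex.tendsto_frontier (hd : 0 < d) (hK : IsSimplex K) {ι : Type*} {l : Filter ι}
    {ψ ψ' : ι → E d → ℝ} (hψ : ∀ n, ContDiff ℝ ∞ (ψ n)) (hψ' : ∀ n, ContDiff ℝ ∞ (ψ' n))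
    (h1 : Tendsto (fun n => eLpNorm (fun x => ψ n x - ψ' n x) 2 (volume.restrict (openHull K)))
      l (𝓝 0))
    (h2 : Tendsto (fun n => eLpNorm (fun x => gradient (ψ n) x - gradient (ψ' n) x) 2
      (volume.restrict (openHull K))) l (𝓝 0)) :
    Tendsto (fun n => eLpNorm (fun x => ψ n x - ψ' n x) 2
      ((surf d).restrict (frontier (hull K)))) l (𝓝 0) := by
  obtain ⟨C, hC, h⟩ := hK.trace_inequality hd
  have h3 := ENNReal.Tendsto.const_mul (a := C) (h1.add h2) (Or.inr hC)
  rw [add_zero, mul_zero] at h3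
  refine tendsto_of_tendsto_of_tendsto_of_le_of_le tendsto_const_nhds h3 (fun _ => zero_le) ?_
  intro n
  refine (h _ ((hψ n).sub (hψ' n))).trans_eq ?_
  congr 3
  ext1 x
  exact gradient_sub ((hψ n).differentiable (by simp) _) ((hψ' n).differentiable (by simp) _)

/-- The trace inequality applied to differences makes boundary values of an `H¹`-convergent smooth
sequence Cauchy in `L²` of the boundary. -/
theorem IsSimplex.isTrace_of_tendsto (hd : 0 < d) (hK : IsSimplex K) (hv : MemH1 (openHull K) v)
    {ψ : ℕ → E d → ℝ} (hψ : ∀ n, ContDiff ℝ ∞ (ψ n)) (h : TendstoH1 (openHull K) ψ v) :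
    ∃ τ, IsTrace K v τ ∧ Tendsto (fun n => eLpNorm (fun x => ψ n x - τ x) 2
      ((surf d).restrict (frontier (hull K)))) atTop (𝓝 0) := by
  have h1 := tendsto_eLpNorm_sub_sub (fun n => (hψ n).continuous.aestronglyMeasurable)
    hv.memLp.1 h.1
  have h2 := tendsto_eLpNorm_sub_sub
    (fun n => (continuous_gradient (hψ n)).aestronglyMeasurable) hv.memLp_grad.1 h.2
  obtain ⟨τ, h3, h4⟩ := exists_limit_of_eLpNorm_cauchy
    (fun n => hK.memLp_frontier hd (hψ n).continuous)
    (hK.tendsto_frontier hd (fun p : ℕ × ℕ => hψ p.1) (fun p => hψ p.2) h1 h2)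
  exact ⟨τ, ⟨h3, ψ, hψ, h, h4⟩, h4⟩

/-- Density of smooth functions shows that the default value in the definition of `trace` is never
taken for `H¹` functions. -/
theorem IsSimplex.isTrace_trace (hd : 0 < d) (hK : IsSimplex K) (hv : MemH1 (openHull K) v) :
    IsTrace K v (trace K v) := by
  obtain ⟨ψ, hψ, h⟩ := exists_tendstoH1 (isOpen_openHull K) (convex_openHull K)
    hK.nonempty_openHull hv
  obtain ⟨τ, h1, -⟩ := hK.isTrace_of_tendsto hd hv hψ h
  have h2 : ∃ τ, IsTrace K v τ := ⟨τ, h1⟩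
  rw [trace, dif_pos h2]
  exact h2.choose_spec

/-- Two smooth sequences with the same `H¹` limit have asymptotically equal boundary values by the
trace inequality. Hence the approximating sequence may be changed, and traces are unique almost
everywhere. -/
theorem IsTrace.tendsto (hd : 0 < d) (hK : IsSimplex K) (hv : MemH1 (openHull K) v)
    (hτ : IsTrace K v τ) {ψ : ℕ → E d → ℝ} (hψ : ∀ n, ContDiff ℝ ∞ (ψ n))
    (h : TendstoH1 (openHull K) ψ v) :
    Tendsto (fun n => eLpNorm (fun x => ψ n x - τ x) 2
      ((surf d).restrict (frontier (hull K)))) atTop (𝓝 0) := by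
  obtain ⟨h1, ψ', hψ', h2, h3⟩ := hτ
  have h4 := hK.tendsto_frontier hd hψ hψ'
    (tendsto_eLpNorm_sub (fun n => (hψ n).continuous.aestronglyMeasurable) hv.memLp.1
      (fun n => (hψ' n).continuous.aestronglyMeasurable) h.1 h2.1)
    (tendsto_eLpNorm_sub (fun n => (continuous_gradient (hψ n)).aestronglyMeasurable)
      hv.memLp_grad.1 (fun n => (continuous_gradient (hψ' n)).aestronglyMeasurable) h.2 h2.2)
  have h5 := h4.add h3
  rw [add_zero] at h5
  refine tendsto_of_tendsto_of_tendsto_of_le_of_le tendsto_const_nhds h5 (fun _ => zero_le) ?_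
  intro n
  have e : (fun x => ψ n x - τ x) = (fun x => ψ n x - ψ' n x) + fun x => ψ' n x - τ x := by
    ext x; simp
  simp only [e]
  have c1 := (hψ n).continuous
  have c2 := (hψ' n).continuous
  exact eLpNorm_add_le (by fun_prop : Continuous _).aestronglyMeasurable
    (c2.aestronglyMeasurable.sub h1.1) (by norm_num)

theorem IsTrace.ae_eq (hd : 0 < d) (hK : IsSimplex K) (hv : MemH1 (openHull K) v)
    (hτ : IsTrace K v τ) (hσ : IsTrace K v σ) :
    τ =ᵐ[(surf d).restrict (frontier (hull K))] σ := by
  have ⟨h1, ψ, hψ, h2, h3⟩ := hτ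
  exact ae_eq_of_tendsto_eLpNorm (fun n => (hψ n).continuous.aestronglyMeasurable) h1.1 hσ.1.1 h3
    (hσ.tendsto hd hK hv hψ h2)

theorem IsTrace.congr (hτ : IsTrace K v τ) (h1 : v.1 =ᵐ[volume.restrict (openHull K)] w.1)
    (h2 : v.2 =ᵐ[volume.restrict (openHull K)] w.2) : IsTrace K w τ := by
  obtain ⟨h0, ψ, hψ, h4, h3⟩ := hτ
  refine ⟨h0, ψ, hψ, ⟨h4.1.congr fun n => eLpNorm_congr_ae ?_,
    h4.2.congr fun n => eLpNorm_congr_ae ?_⟩, h3⟩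
  · filter_upwards [h1] with x hx
    rw [hx]
  · filter_upwards [h2] with x hx
    rw [hx]

theorem IsTrace.add (hv : MemH1 (openHull K) v) (hw : MemH1 (openHull K) w)
    (hτ : IsTrace K v τ) (hσ : IsTrace K w σ) : IsTrace K (v + w) (fun x => τ x + σ x) := by
  obtain ⟨h1, ψ, hψ, h2, h3⟩ := hτ
  obtain ⟨h1', ψ', hψ', h2', h3'⟩ := hσ
  have c := fun n => (hψ n).continuous
  have c' := fun n => (hψ' n).continuous
  have g := fun n => continuous_gradient (hψ n)
  have g' := fun n => continuous_gradient (hψ' n)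
  refine ⟨h1.add h1', fun n x => ψ n x + ψ' n x, fun n => (hψ n).add (hψ' n), ⟨?_, ?_⟩, ?_⟩
  · exact tendsto_eLpNorm_add (fun n => (c n).aestronglyMeasurable) hv.memLp.1
      (fun n => (c' n).aestronglyMeasurable) hw.memLp.1 h2.1 h2'.1
  · refine (tendsto_eLpNorm_add (fun n => (g n).aestronglyMeasurable) hv.memLp_grad.1
      (fun n => (g' n).aestronglyMeasurable) hw.memLp_grad.1 h2.2 h2'.2).congr fun n => ?_
    congr 1
    ext1 x
    rw [gradient_add ((hψ n).differentiable (by simp) _) ((hψ' n).differentiable (by simp) _)]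
    rfl
  · exact tendsto_eLpNorm_add (fun n => (c n).aestronglyMeasurable) h1.1
      (fun n => (c' n).aestronglyMeasurable) h1'.1 h3 h3'

theorem IsTrace.const_smul (hτ : IsTrace K v τ) (c : ℝ) :
    IsTrace K (c • v) (fun x => c * τ x) := by
  obtain ⟨h1, ψ, hψ, h2, h3⟩ := hτ
  refine ⟨h1.const_mul c, fun n x => c * ψ n x, fun n => contDiff_const.mul (hψ n), ⟨?_, ?_⟩, ?_⟩
  · exact tendsto_eLpNorm_const_smul c h2.1
  · refine (tendsto_eLpNorm_const_smul c h2.2).congr fun n => ?_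
    congr 1
    ext1 x
    rw [gradient_const_mul _ ((hψ n).differentiable (by simp) _)]
    rfl
  · exact tendsto_eLpNorm_const_smul c h3

theorem IsSimplex.isTrace_of_contDiff (hd : 0 < d) (hK : IsSimplex K) {ψ : E d → ℝ}
    (hψ : ContDiff ℝ ∞ ψ) : IsTrace K (ψ, gradient ψ) ψ :=
  ⟨hK.memLp_frontier hd hψ.continuous, fun _ => ψ, fun _ => hψ, by simp [TendstoH1], by simp⟩

theorem IsSimplex.eLpNorm_trace_le (hd : 0 < d) (hK : IsSimplex K) :
    ∃ C : ℝ≥0∞, C ≠ ⊤ ∧ ∀ v τ, MemH1 (openHull K) v → IsTrace K v τ →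
      eLpNorm τ 2 ((surf d).restrict (frontier (hull K))) ≤
        C * (eLpNorm v.1 2 (volume.restrict (openHull K)) +
          eLpNorm v.2 2 (volume.restrict (openHull K))) := by
  obtain ⟨C, hC, h⟩ := hK.trace_inequality hd
  refine ⟨C, hC, fun v τ hv hτ => ?_⟩
  obtain ⟨h1, ψ, hψ, h2, h3⟩ := hτ
  have c := fun n => (hψ n).continuous
  have g := fun n => continuous_gradient (hψ n)
  have t := h3.add (ENNReal.Tendsto.const_mul (a := C) ((h2.1.add_const
    (eLpNorm v.1 2 (volume.restrict (openHull K)))).add (h2.2.add_const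
    (eLpNorm v.2 2 (volume.restrict (openHull K))))) (Or.inr hC))
  rw [zero_add, zero_add, zero_add] at t
  refine ge_of_tendsto' t fun n => ?_
  have e : τ = ψ n - (fun x => ψ n x - τ x) := by ext x; simp
  calc eLpNorm τ 2 ((surf d).restrict (frontier (hull K)))
      ≤ eLpNorm (ψ n) 2 ((surf d).restrict (frontier (hull K))) +
        eLpNorm (fun x => ψ n x - τ x) 2 ((surf d).restrict (frontier (hull K))) := by
        conv_lhs => rw [e]
        exact eLpNorm_sub_le (c n).aestronglyMeasurable
          ((c n).aestronglyMeasurable.sub h1.1) (by norm_num)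
    _ ≤ _ := by
      rw [add_comm]
      gcongr
      refine (h _ (hψ n)).trans ?_
      have e1 : ψ n = (fun x => ψ n x - v.1 x) + v.1 := by ext x; simp
      have e2 : gradient (ψ n) = (fun x => gradient (ψ n) x - v.2 x) + v.2 := by ext x; simp
      gcongr
      · conv_lhs => rw [e1]
        exact eLpNorm_add_le ((c n).aestronglyMeasurable.sub hv.memLp.1) hv.memLp.1 (by norm_num)
      · conv_lhs => rw [e2]
        exact eLpNorm_add_le ((g n).aestronglyMeasurable.sub hv.memLp_grad.1) hv.memLp_grad.1
          (by norm_num)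

/-- The approximating test functions themselves vanish on the boundary of the element. -/
theorem MemH10.isTrace_zero (hv : MemH10 (openHull K) v) : IsTrace K v 0 := by
  obtain ⟨h1, ψ, hψ, h2⟩ := hv
  refine ⟨MemLp.zero, ψ, fun n => (hψ n).1, h2, ?_⟩
  have e : ∀ n, eLpNorm (fun x => ψ n x - (0 : E d → ℝ) x) 2
      ((surf d).restrict (frontier (hull K))) = 0 := by
    intro n
    rw [eLpNorm_congr_ae (g := 0), eLpNorm_zero]
    filter_upwards [ae_restrict_mem isClosed_frontier.measurableSet] with x hx
    have : x ∉ openHull K := fun h => hx.2 h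
    simp [(hψ n).eq_zero this]
  simp only [e]
  exact tendsto_const_nhds

/-- Integration by parts holds for the products `ψ n * φ`, which are supported away from the other
facets; every term passes to the limit in `L²`. -/
theorem IsTrace.integral_unitStep (hd : 0 < d) (hK : IsSimplex K) (hv : MemH1 (openHull K) v)
    (hτ : IsTrace K v τ) {p : E d} (hp : p ∈ K) {φ : E d → ℝ}
    (hφ : IsTestFunction {x | ∀ q ∈ K.erase p, 0 < lam K q x} φ) :
    ∫ x in openHull K, (v.1 x * ⟪gradient φ x, unitStep (lam K p)⟫_ℝ +
        ⟪v.2 x, φ x • unitStep (lam K p)⟫_ℝ) =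
      - ‖unitStep (lam K p)‖ * ∫ y in hull (K.erase p), τ y * φ y ∂(surf d) := by
  obtain ⟨h1, ψ, hψ, h2, h3⟩ := hτ
  set e := unitStep (lam K p)
  have hcφ := hφ.1.continuous
  have hgφ := continuous_gradient hφ.1
  have b := isBounded_openHull K
  have m1 := fun n => memLp_restrict_of_continuous (hψ n).continuous b 2
  have m2 := fun n => memLp_restrict_of_continuous (continuous_gradient (hψ n)) b 2
  have m3 : MemLp (fun x => ⟪gradient φ x, e⟫_ℝ) 2 (volume.restrict (openHull K)) :=
    memLp_restrict_of_continuous (by fun_prop) b 2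
  have m4 : MemLp (fun x => φ x • e) 2 (volume.restrict (openHull K)) :=
    memLp_restrict_of_continuous (by fun_prop) b 2
  have hF : hull (K.erase p) ⊆ frontier (hull K) := by
    rw [hK.frontier_hull]
    exact Set.subset_biUnion_of_mem (u := fun p => hull (K.erase p)) hp
  have t1 := tendsto_integral_mul_of_eLpNorm m1 hv.memLp m3 h2.1
  have t2 := tendsto_integral_inner_of_eLpNorm m2 hv.memLp_grad m4 h2.2
  have hr := Measure.restrict_mono hF (le_refl (surf d))
  have t3 := tendsto_integral_mul_of_eLpNorm (f := ψ) (g := τ) (h := φ)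
    (μ := (surf d).restrict (hull (K.erase p)))
    (fun n => (hK.memLp_frontier hd (hψ n).continuous).mono_measure hr) (h1.mono_measure hr)
    ((hK.memLp_frontier hd hcφ).mono_measure hr)
    (tendsto_of_tendsto_of_tendsto_of_le_of_le tendsto_const_nhds h3 (fun _ => zero_le)
      fun n => eLpNorm_mono_measure _ hr)
  rw [integral_add (MemLp.integrable_mul_two hv.memLp m3)
    (MemLp.integrable_inner_two hv.memLp_grad m4)]
  refine tendsto_nhds_unique (t1.add t2) ((t3.const_mul (-‖e‖)).congr fun n => ?_)
  have hχ : IsTestFunction {x | ∀ q ∈ K.erase p, 0 < lam K q x} (fun x => ψ n x * φ x) :=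
    ⟨(hψ n).mul hφ.1, hφ.2.1.mul_left, (tsupport_mul_subset_right).trans hφ.2.2⟩
  rw [← hK.integral_fderiv_unitStep hd hp hχ, restrict_hull, ← integral_add
    (MemLp.integrable_mul_two (m1 n) m3) (MemLp.integrable_inner_two (m2 n) m4)]
  refine integral_congr_ae (ae_of_all _ fun x => ?_)
  have d1 := (hψ n).differentiable (by simp) x
  have d2 := hφ.1.differentiable (by simp) x
  simp only
  rw [fderiv_fun_mul d1 d2, inner_smul_right, inner_gradient_left, inner_gradient_left]
  simp [e]

end

section

/-! ### Traces on both sides of a facet -/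

variable {K : Finset (E d)} {v w : Field d}

theorem IsSimplex.facet_subset_frontier (hK : IsSimplex K) {p : E d} (hp : p ∈ K) :
    hull (K.erase p) ⊆ frontier (hull K) := by
  rw [hK.frontier_hull]
  exact Set.subset_biUnion_of_mem (u := fun p => hull (K.erase p)) hp

theorem IsSimplex.restrict_facet_le (hK : IsSimplex K) {p : E d} (hp : p ∈ K) :
    (surf d).restrict (hull (K.erase p)) ≤ (surf d).restrict (frontier (hull K)) :=
  Measure.restrict_mono (hK.facet_subset_frontier hp) le_rfl

theorem IsSimplex.memLp_trace_facet (hd : 0 < d) (hK : IsSimplex K) (hv : MemH1 (openHull K) v)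
    {p : E d} (hp : p ∈ K) : MemLp (trace K v) 2 ((surf d).restrict (hull (K.erase p))) :=
  (hK.isTrace_trace hd hv).1.mono_measure (hK.restrict_facet_le hp)

theorem IsTrace.ae_eq_facet (hd : 0 < d) (hK : IsSimplex K) (hv : MemH1 (openHull K) v)
    {τ : E d → ℝ} (hτ : IsTrace K v τ) {p : E d} (hp : p ∈ K) :
    trace K v =ᵐ[(surf d).restrict (hull (K.erase p))] τ :=
  ae_mono (hK.restrict_facet_le hp) ((hK.isTrace_trace hd hv).ae_eq hd hK hv hτ)

theorem slope_of_eq_mul {a b : E d →ᵃ[ℝ] ℝ} {c : ℝ} (h : ∀ x, a x = c * b x) :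
    slope a = c • slope b := by
  refine ext_inner_right ℝ fun e => ?_
  have h1 := affine_apply_add a 0 e
  have h2 := affine_apply_add b 0 e
  have h3 := h 0
  have h4 := h (0 + e)
  rw [inner_smul_left]
  simp only [conj_trivial]
  linear_combination -h1 + h4 + c * h2 - h3

/-- A step of unit growth scales inversely to the slope. For the two coordinates of a common facet
the factor is negative, so their steps point to opposite sides. -/
theorem unitStep_of_eq_mul {a b : E d →ᵃ[ℝ] ℝ} {c : ℝ} (hc : c ≠ 0) (h : ∀ x, a x = c * b x) :
    unitStep a = c⁻¹ • unitStep b := by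
  rw [unitStep, unitStep, slope_of_eq_mul h, norm_smul, smul_smul, smul_smul, mul_pow,
    Real.norm_eq_abs, sq_abs]
  congr 1
  field_simp

/-- The points of a facet outside of its relative interior. -/
theorem IsSimplex.surf_relative_boundary (hK : IsSimplex K) {p q : E d} (hp : p ∈ K)
    (hq : q ∈ K.erase p) : surf d (hull (K.erase p) ∩ {x | lam K q x = 0}) = 0 := by
  have hd : 0 < d := by
    have := Finset.card_pos.2 ⟨q, hq⟩
    rwa [hK.card_facet hp] at this
  refine measure_mono_null (t := hull ((K.erase p).erase q)) ?_ (surf_hull_eq_zero ?_)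
  · rintro x ⟨hx, hxq⟩
    obtain ⟨hx1, hxp⟩ := (hK.mem_facet hp).1 hx
    have hqK := Finset.mem_of_mem_erase hq
    have h1 : ∑ r ∈ (K.erase p).erase q, lam K r x = 1 := by
      rw [← hK.sum_lam x, ← Finset.add_sum_erase K _ hp, ← Finset.add_sum_erase _ _ hq, hxp,
        show lam K q x = 0 from hxq]
      simp
    have h2 : ∑ r ∈ (K.erase p).erase q, lam K r x • r = x := by
      conv_rhs => rw [← hK.sum_lam_smul x, ← Finset.add_sum_erase K _ hp,
        ← Finset.add_sum_erase _ _ hq, hxp, show lam K q x = 0 from hxq]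
      simp
    rw [← h2]
    refine (convex_hull _).sum_mem (fun r hr => ?_) h1 fun r hr => subset_hull _ hr
    exact hK.mem_hull.1 hx1 r (Finset.mem_of_mem_erase (Finset.mem_of_mem_erase hr))
  · rw [Finset.card_erase_of_mem hq, hK.card_facet hp]
    omega

namespace Mesh

variable (T : Mesh d)

theorem isOpen_Ω : IsOpen T.Ω := isOpen_interior

variable {T}

theorem hull_subset_space {K : Finset (E d)} (hK : K ∈ T.elements) :
    hull K ⊆ T.complex.space :=
  T.complex.convexHull_subset_space ((mem_elements T).1 hK).1

theorem openHull_subset_Ω {K : Finset (E d)} (hK : K ∈ T.elements) : openHull K ⊆ T.Ω :=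
  interior_mono (hull_subset_space hK)

theorem memH1_openHull {v : Field d} (hv : MemH1 T.Ω v) {K : Finset (E d)}
    (hK : K ∈ T.elements) : MemH1 (openHull K) v :=
  MemH1.mono (isOpen_openHull K) (openHull_subset_Ω hK) hv

theorem aedisjoint_hull {K L : Finset (E d)} (hK : K ∈ T.elements) (hL : L ∈ T.elements)
    (hKL : K ≠ L) : AEDisjoint volume (hull K) (hull L) := by
  refine measure_mono_null (t := frontier (hull K)) ?_ ((convex_hull K).addHaar_frontier volume)
  rintro x ⟨h1, h2⟩
  refine ⟨subset_closure h1, fun h3 => ?_⟩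
  exact Set.disjoint_left.1 (disjoint_openHull hK hL hKL) h3 h2

/-- The weak gradient identity on `Ω`, tested by functions supported near the facet, splits into
integrals over the two elements. Integrating each by parts leaves the jump of the traces against an
arbitrary test function, so the jump is zero. -/
theorem trace_eq_trace_of_adjacent (hd : 0 < d) {K L : Finset (E d)} (hK : K ∈ T.elements)
    (hL : L ∈ T.elements) (hKL : K ≠ L) {p q : E d} (hp : p ∈ K) (hq : q ∈ L)
    (hF : K.erase p = L.erase q) {v : Field d} (hv : MemH1 T.Ω v) :
    trace K v =ᵐ[(surf d).restrict (hull (K.erase p))] trace L v := by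
  have sK := T.isSimplex hK
  have sL := T.isSimplex hL
  have vK := memH1_openHull hv hK
  have vL := memH1_openHull hv hL
  set c := lam K p q with hc
  have hc0 : c < 0 := lam_neg_of_adjacent hd hK hL hKL hp hq hF
  have hlam : ∀ x, lam K p x = c * lam L q x := lam_eq_mul_lam hK hL hp hq hF
  have hstep := unitStep_of_eq_mul hc0.ne hlam
  set eK := unitStep (lam K p)
  set eL := unitStep (lam L q)
  -- Near the relative interior of the facet, the two simplices cover a full neighbourhood. `U` is
  -- open and contained in their union, hence in `Ω`, and it meets no other facet of either.
  set U : Set (E d) := {x | ∀ r ∈ K.erase p, 0 < lam K r x} ∩ {x | ∀ r ∈ L.erase q, 0 < lam L r x}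
    with hU
  have hop : ∀ M : Finset (E d), ∀ r, IsOpen {x : E d | ∀ s ∈ M.erase r, 0 < lam M s x} := by
    intro M r
    have : {x : E d | ∀ s ∈ M.erase r, 0 < lam M s x} =
        ⋂ s ∈ M.erase r, {x | 0 < lam M s x} := by ext; simp
    rw [this]
    exact isOpen_biInter_finset fun s _ => isOpen_lt continuous_const (continuous_affine _)
  have hUo : IsOpen U := (hop K p).inter (hop L q)
  have hUsub : U ⊆ hull K ∪ hull L := by
    rintro x ⟨h1, h2⟩
    rcases le_or_gt 0 (lam K p x) with h | h
    · left
      refine sK.mem_hull.2 fun r hr => ?_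
      by_cases e : r = p
      · rwa [e]
      · exact (h1 r (Finset.mem_erase.2 ⟨e, hr⟩)).le
    · right
      refine sL.mem_hull.2 fun r hr => ?_
      by_cases e : r = q
      · rw [e]
        have := hlam x
        nlinarith
      · exact (h2 r (Finset.mem_erase.2 ⟨e, hr⟩)).le
  have hUΩ : U ⊆ T.Ω := interior_maximal (hUsub.trans
    (Set.union_subset (hull_subset_space hK) (hull_subset_space hL))) hUo
  have mK : MemLp (trace K v) 2 ((surf d).restrict (hull (K.erase p))) :=
    sK.memLp_trace_facet hd vK hp
  have mL : MemLp (trace L v) 2 ((surf d).restrict (hull (K.erase p))) := by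
    rw [hF]; exact sL.memLp_trace_facet hd vL hq
  have fin := sK.isFiniteMeasure_facet hd hp
  have key : ∀ φ, IsTestFunction U φ →
      ∫ y in hull (K.erase p), φ y • (trace K v y - trace L v y) ∂(surf d) = 0 := by
    intro φ hφ
    have i1 := (sK.isTrace_trace hd vK).integral_unitStep hd sK vK hp
      (hφ.mono Set.inter_subset_left)
    have i2 := (sL.isTrace_trace hd vL).integral_unitStep hd sL vL hq
      (hφ.mono Set.inter_subset_right)
    have w1 := hv.weak_grad_inner (hφ.mono hUΩ) eK
    have q1 : MemLp (fun x => ⟪gradient φ x, eK⟫_ℝ) 2 (volume.restrict T.Ω) := by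
      have hc : HasCompactSupport (fun x => ⟪gradient φ x, eK⟫_ℝ) :=
        HasCompactSupport.comp_left (g := fun z : E d => ⟪z, eK⟫_ℝ)
          (hφ.2.1.mono' ((subset_tsupport _).trans (tsupport_gradient_subset φ))) (by simp)
      have := continuous_gradient hφ.1
      exact (by fun_prop : Continuous fun x => ⟪gradient φ x, eK⟫_ℝ).memLp_of_hasCompactSupport hc
    have q2 : MemLp (fun x => φ x • eK) 2 (volume.restrict T.Ω) := hφ.memLp_smul_const _ eK
    have j1 := MemLp.integrable_mul_two hv.memLp q1
    have j2 := MemLp.integrable_inner_two hv.memLp_grad q2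
    have w2 : ∫ x in T.Ω, (v.1 x * ⟪gradient φ x, eK⟫_ℝ + ⟪v.2 x, φ x • eK⟫_ℝ) = 0 := by
      rw [integral_add j1 j2, w1]
      simp only [inner_smul_right]
      ring
    have z : ∀ x ∉ U, v.1 x * ⟪gradient φ x, eK⟫_ℝ + ⟪v.2 x, φ x • eK⟫_ℝ = 0 := fun x hx => by
      rw [hφ.gradient_eq_zero hx, hφ.eq_zero hx]; simp
    have w3 : ∫ x in hull K ∪ hull L,
        (v.1 x * ⟪gradient φ x, eK⟫_ℝ + ⟪v.2 x, φ x • eK⟫_ℝ) = 0 := by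
      rw [setIntegral_test_eq hUo.measurableSet hUsub z,
        ← setIntegral_test_eq hUo.measurableSet hUΩ z, w2]
    have j := j1.add j2
    simp only [Pi.add_def] at j
    have jK := j.mono_measure (Measure.restrict_mono (openHull_subset_Ω hK) le_rfl)
    have jL := j.mono_measure (Measure.restrict_mono (openHull_subset_Ω hL) le_rfl)
    rw [← restrict_hull] at jK jL
    rw [setIntegral_union₀ (aedisjoint_hull hK hL hKL) (measurableSet_hull L).nullMeasurableSet
      jK jL, restrict_hull, restrict_hull, i1] at w3
    have e2 : ∫ x in openHull L, (v.1 x * ⟪gradient φ x, eK⟫_ℝ + ⟪v.2 x, φ x • eK⟫_ℝ) =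
        c⁻¹ * ∫ x in openHull L, (v.1 x * ⟪gradient φ x, eL⟫_ℝ + ⟪v.2 x, φ x • eL⟫_ℝ) := by
      rw [← integral_const_mul]
      refine integral_congr_ae (ae_of_all _ fun x => ?_)
      simp only [hstep, inner_smul_right]
      ring
    -- As `c < 0`, the two boundary terms have equal weights and opposite signs.
    have hn : ‖eK‖ = -c⁻¹ * ‖eL‖ := by
      rw [hstep, norm_smul, norm_inv, Real.norm_of_nonpos hc0.le, inv_neg]
    rw [e2, i2, ← hF] at w3
    have hs : ∫ y in hull (K.erase p), φ y • (trace K v y - trace L v y) ∂(surf d) =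
        (∫ y in hull (K.erase p), trace K v y * φ y ∂(surf d)) -
          ∫ y in hull (K.erase p), trace L v y * φ y ∂(surf d) := by
      have hφ2 := hφ.memLp (p := 2) ((surf d).restrict (hull (K.erase p)))
      rw [← integral_sub (MemLp.integrable_mul_two mK hφ2) (MemLp.integrable_mul_two mL hφ2)]
      refine integral_congr_ae (ae_of_all _ fun x => ?_)
      simp only [smul_eq_mul]
      ring
    rw [hs]
    have hne : ‖eK‖ ≠ 0 := norm_ne_zero_iff.2 (unitStep_ne_zero (sK.slope_lam_ne_zero hd hp))
    refine (mul_eq_zero.1 (?_ : ‖eK‖ * _ = 0)).resolve_left hne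
    rw [hn] at w3 ⊢
    linear_combination -w3
  have hloc : LocallyIntegrableOn (fun y => trace K v y - trace L v y) U
      ((surf d).restrict (hull (K.erase p))) :=
    ((mK.sub mL).integrable (by norm_num)).integrableOn.locallyIntegrableOn
  have h0 := hUo.ae_eq_zero_of_integral_contDiff_smul_eq_zero hloc
    fun g g1 g2 g3 => key g ⟨g1, g2, g3⟩
  -- The jump vanishes almost everywhere on `U`; the facet points outside `U` form its relative
  -- boundary, which is null.
  have hin : ∀ᵐ y ∂((surf d).restrict (hull (K.erase p))), y ∈ U := by
    have a1 : ∀ᵐ y ∂((surf d).restrict (hull (K.erase p))), ∀ r ∈ K.erase p, 0 < lam K r y := by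
      refine (Finset.eventually_all _).2 fun r hr => ?_
      have := sK.surf_relative_boundary hp hr
      rw [ae_restrict_iff' (measurableSet_hull _), ae_iff]
      refine measure_mono_null (fun y hy => ?_) this
      simp only [Classical.not_imp, not_lt, Set.mem_ofPred_eq] at hy
      exact ⟨hy.1, le_antisymm hy.2 (sK.mem_hull.1 ((sK.mem_facet hp).1 hy.1).1 r
        (Finset.mem_of_mem_erase hr))⟩
    have a2 : ∀ᵐ y ∂((surf d).restrict (hull (K.erase p))), ∀ r ∈ L.erase q, 0 < lam L r y := by
      rw [hF]
      refine (Finset.eventually_all _).2 fun r hr => ?_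
      have := sL.surf_relative_boundary hq hr
      rw [ae_restrict_iff' (measurableSet_hull _), ae_iff]
      refine measure_mono_null (fun y hy => ?_) this
      simp only [Classical.not_imp, not_lt, Set.mem_ofPred_eq] at hy
      exact ⟨hy.1, le_antisymm hy.2 (sL.mem_hull.1 ((sL.mem_facet hq).1 hy.1).1 r
        (Finset.mem_of_mem_erase hr))⟩
    filter_upwards [a1, a2] with y h1 h2 using ⟨h1, h2⟩
  filter_upwards [h0, hin] with y h1 h2
  exact sub_eq_zero.1 (h1 h2)

theorem trace_eq_trace (hd : 0 < d) {K L F : Finset (E d)} (hK : K ∈ T.elements)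
    (hL : L ∈ T.elements) (hF : F.card = d) (hFK : F ⊆ K) (hFL : F ⊆ L) {v : Field d}
    (hv : MemH1 T.Ω v) : trace K v =ᵐ[(surf d).restrict (hull F)] trace L v := by
  by_cases hKL : K = L
  · rw [hKL]
  obtain ⟨p, hp, rfl⟩ := exists_eq_erase hF hK hFK
  obtain ⟨q, hq, h⟩ := exists_eq_erase hF hL hFL
  exact trace_eq_trace_of_adjacent hd hK hL hKL hp hq h hv

theorem facetTrace_eq_trace (hd : 0 < d) {K F : Finset (E d)} (hK : K ∈ T.elements)
    (hF : F.card = d) (hFK : F ⊆ K) {v : Field d} (hv : MemH1 T.Ω v) :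
    T.facetTrace F v =ᵐ[(surf d).restrict (hull F)] trace K v := by
  have h : ∃ K ∈ T.elements, F ⊆ K := ⟨K, hK, hFK⟩
  rw [facetTrace, dif_pos h]
  exact trace_eq_trace hd h.choose_spec.1 hK hF h.choose_spec.2 hFK hv

end Mesh

end

section

/-! ### The Poincaré-Wirtinger inequality -/

theorem tendsto_integral_norm_sq {X F : Type*} [MeasurableSpace X] {μ : Measure X}
    [NormedAddCommGroup F] [InnerProductSpace ℝ F] {f : ℕ → X → F} {g : X → F}
    (hf : ∀ n, MemLp (f n) 2 μ) (hg : MemLp g 2 μ)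
    (hfg : Tendsto (fun n => eLpNorm (fun x => f n x - g x) 2 μ) atTop (𝓝 0)) :
    Tendsto (fun n => ∫ x, ‖f n x‖ ^ 2 ∂μ) atTop (𝓝 (∫ x, ‖g x‖ ^ 2 ∂μ)) := by
  have h1 := (Lp.tendsto_Lp_iff_tendsto_eLpNorm'' f hf g hg).2 hfg
  have h2 := h1.inner h1 (𝕜 := ℝ)
  simp only [inner_toLp_eq_integral] at h2
  simpa only [real_inner_self_eq_norm_sq] using h2

/-- Fundamental theorem of calculus on the segment, then Cauchy–Schwarz on the unit interval. -/
theorem enorm_sub_sq_le {ψ : E d → ℝ} (hψ : ContDiff ℝ ∞ ψ) {x y : E d} {D : ℝ}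
    (hD : ‖y - x‖ ≤ D) : ‖ψ y - ψ x‖ₑ ^ 2 ≤ ENNReal.ofReal (D ^ 2) *
      ∫⁻ t in Set.Ioo (0 : ℝ) 1, ‖gradient ψ (x + t • (y - x))‖ₑ ^ 2 := by
  have hc := continuous_gradient hψ
  have hD0 : 0 ≤ D := (norm_nonneg _).trans hD
  have hder : ∀ t ∈ Set.uIcc (0 : ℝ) 1, HasDerivAt (fun t : ℝ => ψ (x + t • (y - x)))
      ⟪gradient ψ (x + t • (y - x)), y - x⟫_ℝ t := by
    intro t _
    have h1 : HasFDerivAt ψ (fderiv ℝ ψ (x + t • (y - x))) (x + t • (y - x)) :=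
      ((hψ.differentiable (by simp)) _).hasFDerivAt
    have h2 : HasDerivAt (fun s : ℝ => x + s • (y - x)) (y - x) t := by
      simpa using ((hasDerivAt_id t).smul_const (y - x)).const_add x
    rw [inner_gradient_left]
    exact h1.comp_hasDerivAt t h2
  have hint := intervalIntegral.integral_eq_sub_of_hasDerivAt hder
    (Continuous.intervalIntegrable (by fun_prop) _ _)
  have e : ψ (x + (1 : ℝ) • (y - x)) - ψ (x + (0 : ℝ) • (y - x)) = ψ y - ψ x := by simp
  have hp : IsProbabilityMeasure (volume.restrict (Set.Ioo (0 : ℝ) 1)) := ⟨by simp⟩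
  have hm : Measurable fun t : ℝ => ‖gradient ψ (x + t • (y - x))‖ₑ :=
    (by fun_prop : Continuous fun t : ℝ => gradient ψ (x + t • (y - x))).measurable.enorm
  rw [← e, ← hint, intervalIntegral.integral_of_le zero_le_one, integral_Ioc_eq_integral_Ioo]
  calc _ ≤ (∫⁻ t in Set.Ioo (0 : ℝ) 1, ENNReal.ofReal D * ‖gradient ψ (x + t • (y - x))‖ₑ) ^ 2 := by
        refine pow_le_pow_left' ((enorm_integral_le_lintegral_enorm _).trans
          (lintegral_mono fun t => ?_)) 2
        rw [← ofReal_norm, ← ofReal_norm, ← ENNReal.ofReal_mul hD0]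
        refine ENNReal.ofReal_le_ofReal ?_
        rw [mul_comm]
        exact (norm_inner_le_norm _ _).trans (by gcongr)
    _ = ENNReal.ofReal (D ^ 2) *
        (∫⁻ t in Set.Ioo (0 : ℝ) 1, ‖gradient ψ (x + t • (y - x))‖ₑ) ^ 2 := by
        rw [lintegral_const_mul _ hm, mul_pow, ENNReal.ofReal_pow hD0]
    _ ≤ _ := by
        gcongr
        exact sq_lintegral_le _ hm.aemeasurable

variable {U : Set (E d)}

/-- For `t ≥ 1 / 2`, change variables in `y` at fixed `x`, where the Jacobian costs at most `2 ^ d`.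
For smaller `t`, exchange the roles of `x` and `y`, which replaces `t` by `1 - t`. -/
theorem lintegral_lintegral_segment_le {G : E d → ℝ≥0∞} (hG : Measurable G) {t : ℝ} :
    ∫⁻ x in U, ∫⁻ y in U, G (x + t • (y - x)) ≤ 2 ^ d * volume U * ∫⁻ x, G x := by
  have main : ∀ s : ℝ, 1 / 2 ≤ s → ∫⁻ x in U, ∫⁻ y in U, G (x + s • (y - x)) ≤
      2 ^ d * volume U * ∫⁻ x, G x := by
    intro s hs
    calc ∫⁻ x in U, ∫⁻ y in U, G (x + s • (y - x)) ≤ ∫⁻ _ in U, 2 ^ d * ∫⁻ x, G x := by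
          refine lintegral_mono fun x => ?_
          refine (lintegral_mono' Measure.restrict_le_self le_rfl).trans ?_
          simpa using lintegral_comp_affine_le (G := G) x 0 hs
      _ = _ := by
          rw [lintegral_const, Measure.restrict_apply_univ]
          ring
  rcases le_total (1 / 2) t with h | h
  · exact main t h
  · have : ∀ x y : E d, x + t • (y - x) = y + (1 - t) • (x - y) := fun x y => by module
    simp only [this]
    rw [lintegral_lintegral_swap (Measurable.aemeasurable (by fun_prop))]
    exact main (1 - t) (by linarith)

theorem lintegral_lintegral_sub_sq_le (hU : MeasurableSet U) (hUc : Convex ℝ U) {D : ℝ}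
    (hD : ∀ x ∈ U, ∀ y ∈ U, ‖y - x‖ ≤ D) {ψ : E d → ℝ} (hψ : ContDiff ℝ ∞ ψ) :
    ∫⁻ x in U, ∫⁻ y in U, ‖ψ y - ψ x‖ₑ ^ 2 ≤
      ENNReal.ofReal (D ^ 2) * (2 ^ d * volume U * ∫⁻ x in U, ‖gradient ψ x‖ₑ ^ 2) := by
  have hc := continuous_gradient hψ
  set G : E d → ℝ≥0∞ := U.indicator fun x => ‖gradient ψ x‖ₑ ^ 2 with hGd
  have hG : Measurable G := (hc.measurable.enorm.pow_const 2).indicator hU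
  have hGx : ∀ x ∈ U, ∀ y ∈ U, ∀ t ∈ Set.Ioo (0 : ℝ) 1,
      ‖gradient ψ (x + t • (y - x))‖ₑ ^ 2 = G (x + t • (y - x)) := by
    intro x hx y hy t ht
    have h := hUc hx hy (by linarith [ht.2] : 0 ≤ 1 - t) ht.1.le (by ring)
    rw [show (1 - t) • x + t • y = x + t • (y - x) by module] at h
    rw [hGd, Set.indicator_of_mem h]
  have hm : Measurable fun z : (E d × E d) × ℝ => G (z.1.1 + z.2 • (z.1.2 - z.1.1)) := by fun_prop
  have hm1 : Measurable fun z : E d × ℝ => ∫⁻ y in U, G (z.1 + z.2 • (y - z.1)) := by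
    refine Measurable.lintegral_prod_right' (f := fun z : (E d × ℝ) × E d =>
      G (z.1.1 + z.1.2 • (z.2 - z.1.1))) ?_
    fun_prop
  calc ∫⁻ x in U, ∫⁻ y in U, ‖ψ y - ψ x‖ₑ ^ 2
      ≤ ∫⁻ x in U, ∫⁻ y in U, ENNReal.ofReal (D ^ 2) *
        ∫⁻ t in Set.Ioo (0 : ℝ) 1, G (x + t • (y - x)) := by
        refine setLIntegral_mono_ae' hU (ae_of_all _ fun x hx => ?_)
        refine setLIntegral_mono_ae' hU (ae_of_all _ fun y hy => ?_)
        refine (enorm_sub_sq_le hψ (hD x hx y hy)).trans_eq ?_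
        rw [setLIntegral_congr_fun measurableSet_Ioo (hGx x hx y hy)]
    _ = ENNReal.ofReal (D ^ 2) * ∫⁻ t in Set.Ioo (0 : ℝ) 1, ∫⁻ x in U, ∫⁻ y in U,
          G (x + t • (y - x)) := by
        simp only [lintegral_const_mul' _ _ ENNReal.ofReal_ne_top]
        congr 1
        refine Eq.trans ?_ (lintegral_lintegral_swap hm1.aemeasurable)
        refine lintegral_congr fun x => ?_
        rw [lintegral_lintegral_swap]
        exact Measurable.aemeasurable (by fun_prop)
    _ ≤ ENNReal.ofReal (D ^ 2) * ∫⁻ t in Set.Ioo (0 : ℝ) 1, (2 ^ d * volume U * ∫⁻ x, G x) := by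
        gcongr with t
        exact lintegral_lintegral_segment_le hG
    _ = _ := by
        rw [lintegral_const, hGd, lintegral_indicator hU]
        simp

/-- Expanding the square, the double integral of `(ψ y - ψ x) ^ 2` is `2 |U| ∫ ψ² - 2 (∫ ψ)²`, while
the segment estimate bounds it by the gradient. The inequality passes to `H¹` by density. -/
theorem exists_poincare (hU : IsOpen U) (hUc : Convex ℝ U) (hUb : Bornology.IsBounded U)
    (hUn : U.Nonempty) : ∃ C : ℝ, 0 ≤ C ∧ ∀ v : Field d, MemH1 U v →
      volume.real U * ∫ x in U, ‖v.1 x‖ ^ 2 ≤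
        (∫ x in U, v.1 x) ^ 2 + C * ∫ x in U, ‖v.2 x‖ ^ 2 := by
  have hfin : volume U < ⊤ := hUb.measure_lt_top
  have : IsFiniteMeasure (volume.restrict U) := ⟨by simpa using hfin⟩
  set D := Metric.diam U
  have hD : ∀ x ∈ U, ∀ y ∈ U, ‖y - x‖ ≤ D := fun x hx y hy => by
    rw [← dist_eq_norm]; exact Metric.dist_le_diam_of_mem hUb hy hx
  set C := D ^ 2 * (2 ^ d * volume.real U) / 2
  refine ⟨C, by positivity, fun v hv => ?_⟩
  obtain ⟨ψ, hψ, h1, h2⟩ := exists_tendstoH1 hU hUc hUn hv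
  have m1 := fun n => memLp_restrict_of_continuous (hψ n).continuous hUb 2
  have m2 := fun n => memLp_restrict_of_continuous (continuous_gradient (hψ n)) hUb 2
  have t1 := tendsto_integral_norm_sq m1 hv.memLp h1
  have t2 := tendsto_integral_norm_sq m2 hv.memLp_grad h2
  have t3 := tendsto_integral_mul_of_eLpNorm m1 hv.memLp
    (memLp_const (1 : ℝ) (μ := volume.restrict U)) h1
  simp only [mul_one] at t3
  refine le_of_tendsto_of_tendsto' (t1.const_mul _) ((t3.pow 2).add (t2.const_mul C)) fun n => ?_
  have hc := (hψ n).continuous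
  have i1 : Integrable (ψ n) (volume.restrict U) := (m1 n).integrable (by norm_num)
  have i2 : Integrable (fun x => ψ n x ^ 2) (volume.restrict U) := (m1 n).integrable_sq
  have i3 : Integrable (fun x => ‖gradient (ψ n) x‖ ^ 2) (volume.restrict U) :=
    (m2 n).integrable_norm_pow two_ne_zero
  have i4 : Integrable (fun _ : E d => (1 : ℝ)) (volume.restrict U) := integrable_const 1
  set μ := volume.restrict U
  have j1 : Integrable (fun z : E d × E d => ψ n z.2 ^ 2) (μ.prod μ) := by
    simpa using i4.mul_prod i2
  have j2 : Integrable (fun z : E d × E d => ψ n z.1 ^ 2) (μ.prod μ) := by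
    simpa using i2.mul_prod i4
  have j3 : Integrable (fun z : E d × E d => ψ n z.1 * ψ n z.2) (μ.prod μ) := i1.mul_prod i1
  have hμ : μ.real Set.univ = volume.real U := by simp [μ, Measure.real]
  have e1 : ∫ z, (ψ n z.2 - ψ n z.1) ^ 2 ∂(μ.prod μ) =
      2 * (volume.real U * ∫ x, ‖ψ n x‖ ^ 2 ∂μ) - 2 * (∫ x, ψ n x ∂μ) ^ 2 := by
    have k1 : ∫ z : E d × E d, ψ n z.2 ^ 2 ∂(μ.prod μ) = volume.real U * ∫ x, ψ n x ^ 2 ∂μ := by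
      have := integral_prod_mul (μ := μ) (ν := μ) (fun _ => (1 : ℝ)) (fun x => ψ n x ^ 2)
      simpa [hμ] using this
    have k2 : ∫ z : E d × E d, ψ n z.1 ^ 2 ∂(μ.prod μ) = volume.real U * ∫ x, ψ n x ^ 2 ∂μ := by
      have := integral_prod_mul (μ := μ) (ν := μ) (fun x => ψ n x ^ 2) (fun _ => (1 : ℝ))
      simpa [hμ, mul_comm] using this
    have k3 := integral_prod_mul (μ := μ) (ν := μ) (ψ n) (ψ n)
    have k4 : (fun z : E d × E d => (ψ n z.2 - ψ n z.1) ^ 2) =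
        fun z => (ψ n z.2 ^ 2 + ψ n z.1 ^ 2) - 2 * (ψ n z.1 * ψ n z.2) := by ext z; ring
    have j12 := j1.add j2
    simp only [Pi.add_def] at j12
    rw [k4, integral_sub j12 (j3.const_mul 2), integral_add j1 j2, integral_const_mul,
      k1, k2, k3]
    simp only [Real.norm_eq_abs, sq_abs]
    ring
  have e2 : ENNReal.ofReal (∫ z, (ψ n z.2 - ψ n z.1) ^ 2 ∂(μ.prod μ)) ≤
      ENNReal.ofReal (D ^ 2 * (2 ^ d * volume.real U) * ∫ x, ‖gradient (ψ n) x‖ ^ 2 ∂μ) := by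
    rw [ofReal_integral_eq_lintegral_ofReal, lintegral_prod]
    · have := lintegral_lintegral_sub_sq_le hU.measurableSet hUc hD (hψ n)
      simp only [enorm_sq_eq_ofReal] at this
      refine this.trans_eq ?_
      rw [ENNReal.ofReal_mul (by positivity), ENNReal.ofReal_mul (by positivity),
        ENNReal.ofReal_mul (by positivity), ENNReal.ofReal_pow (by norm_num : (0 : ℝ) ≤ 2),
        ofReal_integral_eq_lintegral_ofReal i3 (ae_of_all _ fun x => by positivity),
        Measure.real, ENNReal.ofReal_toReal hfin.ne, ENNReal.ofReal_ofNat, mul_assoc]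
      simp only [ENNReal.ofReal_pow (norm_nonneg _), ofReal_norm, mul_assoc, μ]
    · exact (Continuous.measurable (by fun_prop)).ennreal_ofReal.aemeasurable
    · refine ((j1.add j2).sub (j3.const_mul 2)).congr (ae_of_all _ fun z => ?_)
      simp only [Pi.add_apply, Pi.sub_apply]
      ring
    · exact ae_of_all _ fun z => sq_nonneg _
  rw [ENNReal.ofReal_le_ofReal_iff (by positivity), e1] at e2
  simp only [C]
  linarith

theorem memH1_const (hUb : Bornology.IsBounded U) (c : ℝ) :
    MemH1 U ((fun _ => c, fun _ => 0) : Field d) := by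
  have := memH1_of_contDiff hUb (contDiff_const (c := c))
  have e : gradient (fun _ : E d => c) = fun _ => 0 := by
    ext1 x; simp [gradient]
  rwa [e] at this

theorem MemH1.ae_eq_const (hU : IsOpen U) (hUc : Convex ℝ U) (hUb : Bornology.IsBounded U)
    (hUn : U.Nonempty) {v : Field d} (hv : MemH1 U v) (h : v.2 =ᵐ[volume.restrict U] 0) :
    ∃ c : ℝ, v.1 =ᵐ[volume.restrict U] fun _ => c := by
  obtain ⟨C, -, hC⟩ := exists_poincare hU hUc hUb hUn
  have hfin : volume U < ⊤ := hUb.measure_lt_top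
  have hpos : 0 < volume.real U := ENNReal.toReal_pos (hU.measure_pos _ hUn).ne' hfin.ne
  have : IsFiniteMeasure (volume.restrict U) := ⟨by simpa using hfin⟩
  set c := (volume.real U)⁻¹ * ∫ x in U, v.1 x
  refine ⟨c, ?_⟩
  have h1 := hC _ (hv.sub (memH1_const hUb c))
  have i1 := hv.memLp.integrable (by norm_num : (1 : ℝ≥0∞) ≤ 2)
  have e1 : ∫ x in U, (v - ((fun _ => c, fun _ => 0) : Field d)).1 x = 0 := by
    simp only [Prod.fst_sub, Pi.sub_apply]
    rw [integral_sub i1 (integrable_const c)]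
    simp only [integral_const, smul_eq_mul, Measure.real, Measure.restrict_apply_univ]
    change _ - volume.real U * c = 0
    simp only [c]
    rw [mul_inv_cancel_left₀ hpos.ne', sub_self]
  have e2 : ∫ x in U, ‖(v - ((fun _ => c, fun _ => 0) : Field d)).2 x‖ ^ 2 = 0 := by
    rw [integral_congr_ae (g := fun _ => (0 : ℝ)), integral_zero]
    filter_upwards [h] with x hx
    simp [hx]
  rw [e1, e2, zero_pow two_ne_zero, mul_zero, add_zero] at h1
  have hL := (hv.sub (memH1_const hUb c)).memLp
  have h2 : ∫ x in U, ‖(v - ((fun _ => c, fun _ => 0) : Field d)).1 x‖ ^ 2 = 0 :=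
    le_antisymm (nonpos_of_mul_nonpos_right h1 hpos) (integral_nonneg fun x => by positivity)
  rw [integral_eq_zero_iff_of_nonneg (fun x => by positivity)
    (hL.integrable_norm_pow two_ne_zero)] at h2
  filter_upwards [h2] with x hx
  simpa [sub_eq_zero] using hx

end

section

/-! ### Integration over the mesh -/

namespace Mesh

variable {T : Mesh d}

theorem space_subset : T.complex.space ⊆ ⋃ K ∈ T.elements, hull K := by
  intro x hx
  obtain ⟨s, hs, hxs⟩ := T.complex.mem_space_iff.1 hx
  obtain ⟨K, hK, hsK, hc⟩ := T.pure s hs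
  exact Set.mem_biUnion ((mem_elements T).2 ⟨hK, hc⟩) (hull_mono hsK hxs)

theorem Ω_subset : T.Ω ⊆ ⋃ K ∈ T.elements, hull K := interior_subset.trans space_subset

theorem isBounded_Ω : Bornology.IsBounded T.Ω :=
  ((Bornology.isBounded_biUnion_finset T.elements).2
    fun K _ => (isCompact_hull K).isBounded).subset Ω_subset

/-- The points of the domain missing from the open elements lie on boundaries of finitely many
convex sets, which are null. Integrals and almost-everywhere statements thereby split over elements.
-/
theorem restrict_Ω_eq : (volume.restrict T.Ω : Measure (E d)) =
    volume.restrict (⋃ K ∈ T.elements, openHull K) := by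
  have hnull : volume (⋃ K ∈ T.elements, frontier (hull K)) = 0 :=
    (measure_biUnion_null_iff T.elements.countable_toSet).2
      fun K _ => (convex_hull K).addHaar_frontier volume
  refine Measure.restrict_congr_set (Filter.EventuallyLE.antisymm ?_ ?_)
  · rw [ae_le_set]
    refine measure_mono_null ?_ hnull
    rintro x ⟨h1, h2⟩
    obtain ⟨K, hK, hx⟩ := Set.mem_iUnion₂.1 (Ω_subset h1)
    refine Set.mem_biUnion hK ⟨subset_closure hx, fun h => h2 (Set.mem_biUnion hK h)⟩
  · exact (Set.iUnion₂_subset fun K hK => openHull_subset_Ω hK).eventuallyLE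

theorem pairwise_disjoint_openHull :
    (T.elements : Set (Finset (E d))).Pairwise (Function.onFun Disjoint openHull) :=
  fun _ hK _ hL h => (disjoint_openHull hK hL h).mono_right (openHull_subset _)

theorem ae_Ω_iff {p : E d → Prop} : (∀ᵐ x ∂(volume.restrict T.Ω), p x) ↔
    ∀ K ∈ T.elements, ∀ᵐ x ∂(volume.restrict (openHull K)), p x := by
  rw [restrict_Ω_eq, ae_restrict_biUnion_finset_iff]

theorem integrable_Ω_iff {F : Type*} [NormedAddCommGroup F] {f : E d → F} :
    Integrable f (volume.restrict T.Ω) ↔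
      ∀ K ∈ T.elements, Integrable f (volume.restrict (openHull K)) := by
  rw [restrict_Ω_eq]
  exact integrableOn_finset_iUnion

theorem integral_Ω {f : E d → ℝ} (hf : Integrable f (volume.restrict T.Ω)) :
    ∫ x in T.Ω, f x = ∑ K ∈ T.elements, ∫ x in hull K, f x := by
  rw [restrict_Ω_eq, integral_biUnion_finset _ (fun K _ => (isOpen_openHull K).measurableSet)
    pairwise_disjoint_openHull (fun K hK => integrable_Ω_iff.1 hf K hK)]
  exact Finset.sum_congr rfl fun K _ => by rw [restrict_hull]

theorem aestronglyMeasurable_Ω {F : Type*} [NormedAddCommGroup F] {f : E d → F}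
    (h : ∀ K ∈ T.elements, AEStronglyMeasurable f (volume.restrict (openHull K))) :
    AEStronglyMeasurable f (volume.restrict T.Ω) := by
  rw [restrict_Ω_eq, Finset.set_biUnion_coe T.elements openHull |>.symm, Set.biUnion_eq_iUnion]
  exact (aestronglyMeasurable_iUnion_iff).2 fun K => h K K.2

theorem memLp_Ω {F : Type*} [NormedAddCommGroup F] {f : E d → F}
    (h : ∀ K ∈ T.elements, MemLp f 2 (volume.restrict (openHull K))) :
    MemLp f 2 (volume.restrict T.Ω) := by
  refine (memLp_two_iff_integrable_sq_norm (aestronglyMeasurable_Ω fun K hK => (h K hK).1)).2 ?_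
  exact integrable_Ω_iff.2 fun K hK => (h K hK).integrable_norm_pow two_ne_zero

theorem memLp_openHull {F : Type*} [NormedAddCommGroup F] {f : E d → F}
    (h : MemLp f 2 (volume.restrict T.Ω)) {K : Finset (E d)} (hK : K ∈ T.elements) :
    MemLp f 2 (volume.restrict (openHull K)) :=
  h.mono_measure (Measure.restrict_mono (openHull_subset_Ω hK) le_rfl)

end Mesh

/-! ### Lipschitz functions on a finite closed cover -/

/-- The pieces need not be convex, so the estimate is continued along the segment from `x` to `y`:
the times at which it holds form a closed set, shown to extend always to the right. -/
theorem lipschitzWith_of_finite_closed_cover {ι V : Type*} [Finite ι] [NormedAddCommGroup V]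
    [NormedSpace ℝ V] {S : ι → Set V} (hS : ∀ i, IsClosed (S i)) (hcov : ⋃ i, S i = Set.univ)
    {C : NNReal} {f : V → ℝ} (hf : ∀ i, LipschitzOnWith C f (S i)) : LipschitzWith C f := by
  have hcont : Continuous f := (locallyFinite_of_finite S).continuous hcov hS
    fun i => (hf i).continuousOn
  refine LipschitzWith.of_dist_le_mul fun x y => ?_
  set γ : ℝ → V := fun t => x + t • (y - x) with hγ
  have hγc : Continuous γ := by fun_prop
  have hγd : ∀ s t, s ≤ t → dist (γ s) (γ t) = (t - s) * dist x y := by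
    intro s t hst
    rw [dist_eq_norm, dist_eq_norm, show γ s - γ t = (t - s) • (x - y) by simp only [hγ]; module,
      norm_smul, Real.norm_of_nonneg (by linarith)]
  set A : Set ℝ := {t | dist (f x) (f (γ t)) ≤ C * (t * dist x y)} with hA
  have hAc : IsClosed A := isClosed_le (by fun_prop) (by fun_prop)
  have h0 : (0 : ℝ) ∈ A := by simp [hA, hγ]
  have h1 : Set.Icc (0 : ℝ) 1 ⊆ A := by
    refine (hAc.inter isClosed_Icc).Icc_subset_of_forall_exists_gt h0 ?_
    rintro s ⟨hs, -⟩ z hz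
    -- With finitely many pieces, one is visited at times arbitrarily close to `s` from the right.
    -- It is closed, hence contains `γ s`, and its own Lipschitz bound covers the next step.
    have hev : ∃ i, ∃ᶠ t in 𝓝[>] s, γ t ∈ S i := by
      by_contra! hne
      have h2 := eventually_all.2 hne
      obtain ⟨t, ht⟩ := h2.exists
      have : γ t ∈ ⋃ i, S i := by rw [hcov]; trivial
      obtain ⟨i, hi⟩ := Set.mem_iUnion.1 this
      exact ht i hi
    obtain ⟨i, hi⟩ := hev
    have hsi : γ s ∈ S i :=
      ((hS i).preimage hγc).mem_of_frequently_of_tendsto hi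
        (tendsto_id.mono_right nhdsWithin_le_nhds)
    obtain ⟨t, ht, hst⟩ := (hi.and_eventually (Ioc_mem_nhdsGT hz)).exists
    refine ⟨t, ?_, hst⟩
    have h3 := (hf i).dist_le_mul _ hsi _ ht
    rw [hγd s t hst.1.le] at h3
    have hs' : dist (f x) (f (γ s)) ≤ C * (s * dist x y) := hs
    calc dist (f x) (f (γ t)) ≤ dist (f x) (f (γ s)) + dist (f (γ s)) (f (γ t)) :=
          dist_triangle _ _ _
      _ ≤ C * (s * dist x y) + C * ((t - s) * dist x y) := add_le_add hs' h3
      _ = C * (t * dist x y) := by ring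
  have h2 : (1 : ℝ) ∈ A := h1 ⟨zero_le_one, le_rfl⟩
  simpa [hA, hγ] using h2

theorem integral_lineDeriv_eq_zero {g : E d → ℝ} {C : NNReal} (hg : LipschitzWith C g)
    (hgs : HasCompactSupport g) (e : E d) : ∫ x, lineDeriv ℝ g x e = 0 := by
  have h := LipschitzWith.integral_lineDeriv_mul_eq (μ := (volume : Measure (E d)))
    (LipschitzWith.const (1 : ℝ)) hg hgs (-e)
  have h1 : ∀ x : E d, lineDeriv ℝ (fun _ : E d => (1 : ℝ)) x (-e) = 0 := fun x => by
    simp [lineDeriv]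
  simpa [h1] using h.symm

/-! ### The piecewise affine basis functions -/

namespace Mesh

variable {T : Mesh d} {φ0 : E d → Field d} {i : E d} {K : Finset (E d)}

theorem IsHatBasis.eq_on (h : T.IsHatBasis φ0) (hi : i ∈ T.nodes) (hK : K ∈ T.elements) :
    ∃ a : E d →ᵃ[ℝ] ℝ, (i ∈ K → a = lam K i) ∧ (i ∉ K → a = 0) ∧
      (∀ x ∈ hull K, (φ0 i).1 x = a x) ∧ (∀ x ∈ openHull K, (φ0 i).2 x = slope a) := by
  obtain ⟨a, h1, h2, h3⟩ := h i hi K hK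
  have sK := T.isSimplex hK
  refine ⟨a, fun hiK => sK.eq_lam hiK h1, fun hiK => sK.eq_zero fun j hj =>
    (h1 j hj).2 fun e => hiK (e ▸ hj), h2, fun x hx => ?_⟩
  rw [h3 x hx, gradient_affine]

theorem IsHatBasis.eq_affine (h : T.IsHatBasis φ0) (hi : i ∈ T.nodes) (hK : K ∈ T.elements) :
    ∃ a : E d →ᵃ[ℝ] ℝ, (i ∈ K → a = lam K i) ∧ (i ∉ K → a = 0) ∧
      (φ0 i).1 =ᵐ[volume.restrict (openHull K)] (fun x => a x) ∧
      (φ0 i).2 =ᵐ[volume.restrict (openHull K)] fun _ => slope a := by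
  obtain ⟨a, h1, h2, h3, h4⟩ := h.eq_on hi hK
  refine ⟨a, h1, h2, ?_, ?_⟩
  · filter_upwards [ae_restrict_mem (isOpen_openHull K).measurableSet] with x hx
      using h3 x (openHull_subset K hx)
  · filter_upwards [ae_restrict_mem (isOpen_openHull K).measurableSet] with x hx using h4 x hx

theorem memH1_affine (K : Finset (E d)) (a : E d →ᵃ[ℝ] ℝ) :
    MemH1 (openHull K) ((fun x => a x, fun _ => slope a) : Field d) := by
  have := memH1_of_contDiff (isBounded_openHull K) (contDiff_affine a)
  have e : gradient (fun x => a x) = fun _ => slope a := by ext1 x; exact gradient_affine a x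
  rwa [e] at this

theorem isTrace_affine (hd : 0 < d) (hK : IsSimplex K) (a : E d →ᵃ[ℝ] ℝ) :
    IsTrace K ((fun x => a x, fun _ => slope a) : Field d) (fun x => a x) := by
  have := hK.isTrace_of_contDiff hd (contDiff_affine a)
  have e : gradient (fun x => a x) = fun _ => slope a := by ext1 x; exact gradient_affine a x
  rwa [e] at this

theorem IsHatBasis.memH1_openHull (h : T.IsHatBasis φ0) (hi : i ∈ T.nodes)
    (hK : K ∈ T.elements) : MemH1 (openHull K) (φ0 i) := by
  obtain ⟨a, -, -, h1, h2⟩ := h.eq_affine hi hK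
  exact (memH1_affine K a).congr h1.symm h2.symm

theorem IsHatBasis.isTrace_of_mem (hd : 0 < d) (h : T.IsHatBasis φ0) (hi : i ∈ K)
    (hK : K ∈ T.elements) : IsTrace K (φ0 i) (fun x => lam K i x) := by
  obtain ⟨a, h0, -, h1, h2⟩ := h.eq_affine ⟨K, hK, hi⟩ hK
  rw [← h0 hi]
  exact (isTrace_affine hd (T.isSimplex hK) a).congr h1.symm h2.symm

/-- The product of a hat function with a test function is Lipschitz with compact support, so its
directional derivative integrates to zero over the space. The product rule on each open element
turns this into the weak gradient identity, with no facet terms to cancel. -/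
theorem IsHatBasis.memH1_Ω (h : T.IsHatBasis φ0) (hi : i ∈ T.nodes) :
    MemH1 T.Ω (φ0 i) := by
  have m1 : MemLp (φ0 i).1 2 (volume.restrict T.Ω) :=
    memLp_Ω fun K hK => (h.memH1_openHull hi hK).memLp
  have m2 : MemLp (φ0 i).2 2 (volume.restrict T.Ω) :=
    memLp_Ω fun K hK => (h.memH1_openHull hi hK).memLp_grad
  refine MemH1.of_inner m1 m2 fun φ hφ e => ?_
  choose! a ha0 ha1 ha ha' using fun K (hK : K ∈ T.elements) => h.eq_on hi hK
  set g : E d → ℝ := fun x => (φ0 i).1 x * φ x with hg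
  have hgs : HasCompactSupport g := hφ.2.1.mul_left
  have hsm : ∀ K, ContDiff ℝ ∞ (fun x => a K x * φ x) := fun K => (contDiff_affine (a K)).mul hφ.1
  have hcs : ∀ K, HasCompactSupport (fun x => a K x * φ x) := fun K => hφ.2.1.mul_left
  have hLip : ∃ C, LipschitzWith C g := by
    choose C hC using fun K => ContDiff.lipschitzWith_of_hasCompactSupport (hcs K) (hsm K)
      (by simp)
    refine ⟨∑ K ∈ T.elements, C K, ?_⟩
    -- The extra index `none` is the complement of `Ω`, where the test function, hence the product,
    -- is zero.
    refine lipschitzWith_of_finite_closed_cover (ι := Option T.elements)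
      (S := fun o => o.elim T.Ωᶜ fun K => hull K) ?_ ?_ ?_
    · rintro (_ | K)
      · exact T.isOpen_Ω.isClosed_compl
      · exact isClosed_hull _
    · refine Set.eq_univ_of_forall fun x => ?_
      by_cases hx : x ∈ T.Ω
      · obtain ⟨K, hK, hxK⟩ := Set.mem_iUnion₂.1 (Ω_subset hx)
        exact Set.mem_iUnion.2 ⟨some ⟨K, hK⟩, hxK⟩
      · exact Set.mem_iUnion.2 ⟨none, hx⟩
    · rintro (_ | K)
      · intro x hx y hy
        have hx0 : φ x = 0 := hφ.eq_zero hx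
        have hy0 : φ y = 0 := hφ.eq_zero hy
        simp [hg, hx0, hy0]
      · refine LipschitzOnWith.weaken (K := C K) ?_ (Finset.single_le_sum (f := C)
          (fun _ _ => zero_le) K.2)
        intro x hx y hy
        simp only [hg]
        rw [ha K K.2 x hx, ha K K.2 y hy]
        exact hC K x y
  obtain ⟨C, hC⟩ := hLip
  have h0 := integral_lineDeriv_eq_zero hC hgs e
  have hz : ∀ x ∉ T.Ω, lineDeriv ℝ g x e = 0 := by
    intro x hx
    have h1 : x ∉ tsupport φ := fun h => hx (hφ.2.2 h)
    have h2 : g =ᶠ[𝓝 x] fun _ => 0 := by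
      filter_upwards [notMem_tsupport_iff_eventuallyEq.1 h1] with y hy
      simp [hg, hy]
    rw [h2.lineDeriv_eq]
    simp [lineDeriv]
  rw [← setIntegral_eq_integral_of_forall_compl_eq_zero hz] at h0
  have q1 : MemLp (fun x => ⟪gradient φ x, e⟫_ℝ) 2 (volume.restrict T.Ω) := by
    have := continuous_gradient hφ.1
    exact memLp_restrict_of_continuous (by fun_prop) isBounded_Ω 2
  have q2 : MemLp (fun x => φ x • e) 2 (volume.restrict T.Ω) := hφ.memLp_smul_const _ e
  have j1 := MemLp.integrable_mul_two m1 q1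
  have j2 := MemLp.integrable_inner_two m2 q2
  have hae : ∀ᵐ x ∂(volume.restrict T.Ω), lineDeriv ℝ g x e =
      (φ0 i).1 x * ⟪gradient φ x, e⟫_ℝ + ⟪(φ0 i).2 x, φ x • e⟫_ℝ := by
    refine ae_Ω_iff.2 fun K hK => ?_
    filter_upwards [ae_restrict_mem (isOpen_openHull K).measurableSet] with x hx
    have h2 : g =ᶠ[𝓝 x] fun y => a K y * φ y := by
      filter_upwards [(isOpen_openHull K).mem_nhds hx] with y hy
      simp only [hg]
      rw [ha K hK y (openHull_subset K hy)]
    have d1 := (contDiff_affine (a K)).differentiable (by simp) x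
    have d2 := hφ.1.differentiable (by simp) x
    rw [h2.lineDeriv_eq, ((hsm K).differentiable (by simp) x).lineDeriv_eq_fderiv,
      fderiv_fun_mul d1 d2, ha K hK x (openHull_subset K hx), ha' K hK x hx,
      ← gradient_affine (a K) x, inner_smul_right, inner_gradient_left, inner_gradient_left]
    simp
  rw [integral_congr_ae hae, integral_add j1 j2] at h0
  simp only [inner_smul_right] at h0
  linarith

end Mesh

end

section

/-! ### The coefficient matrix -/

theorem act_apply (M : Matrix (Fin d) (Fin d) ℝ) (ξ : E d) (i : Fin d) :
    act M ξ i = ∑ j, M i j * ξ j := by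
  simp [act, Matrix.toEuclideanLin, Matrix.mulVec, dotProduct]

theorem act_add (M : Matrix (Fin d) (Fin d) ℝ) (ξ η : E d) : act M (ξ + η) = act M ξ + act M η :=
  map_add _ _ _

theorem act_sub (M : Matrix (Fin d) (Fin d) ℝ) (ξ η : E d) : act M (ξ - η) = act M ξ - act M η :=
  map_sub _ _ _

theorem act_smul (M : Matrix (Fin d) (Fin d) ℝ) (c : ℝ) (ξ : E d) : act M (c • ξ) = c • act M ξ :=
  map_smul _ _ _

theorem act_zero (M : Matrix (Fin d) (Fin d) ℝ) : act M (0 : E d) = 0 := map_zero _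

theorem act_mul (M N : Matrix (Fin d) (Fin d) ℝ) (ξ : E d) : act (M * N) ξ = act M (act N ξ) := by
  ext i
  simp [act, Matrix.toEuclideanLin, Matrix.mulVec_mulVec]

theorem act_one (ξ : E d) : act (1 : Matrix (Fin d) (Fin d) ℝ) ξ = ξ := by
  ext i
  simp [act, Matrix.toEuclideanLin]

/-- Symmetric matrices with `α |ξ|² ≤ M ξ · ξ ≤ β |ξ|²`. -/
structure IsCoefficient (α β : ℝ) (M : Matrix (Fin d) (Fin d) ℝ) : Prop where
  symm : M.IsSymm
  lower : ∀ ξ : E d, α * ‖ξ‖ ^ 2 ≤ ⟪act M ξ, ξ⟫_ℝ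
  upper : ∀ ξ : E d, ⟪act M ξ, ξ⟫_ℝ ≤ β * ‖ξ‖ ^ 2

namespace IsCoefficient

variable {α β : ℝ} {M : Matrix (Fin d) (Fin d) ℝ} (hα : 0 < α) (hM : IsCoefficient α β M)
include hM

theorem inner_act_comm (ξ η : E d) : ⟪act M ξ, η⟫_ℝ = ⟪ξ, act M η⟫_ℝ := by
  simp only [PiLp.inner_apply, act_apply, RCLike.inner_apply, conj_trivial, Finset.mul_sum,
    Finset.sum_mul]
  rw [Finset.sum_comm]
  refine Finset.sum_congr rfl fun i _ => Finset.sum_congr rfl fun j _ => ?_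
  rw [hM.symm.apply i j]
  ring

include hα

/-- Only the quadratic form is bounded, so symmetry is used: nonnegativity of the form at `β • ξ - M
ξ`, with its upper bound at `M ξ`, gives `‖M ξ‖² ≤ β ⟪M ξ, ξ⟫`. The absolute value covers `ξ = 0`,
where the sign of `β` is not known. -/
theorem norm_act_le (ξ : E d) : ‖act M ξ‖ ≤ |β| * ‖ξ‖ := by
  rcases eq_or_ne ξ 0 with rfl | hξ
  · simp [act_zero]
  have hp : 0 < ‖ξ‖ ^ 2 := by positivity
  have hβ : 0 < β := by
    have h := (hM.lower ξ).trans (hM.upper ξ)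
    have := le_of_mul_le_mul_right h hp
    linarith
  rw [abs_of_pos hβ]
  set η := act M ξ
  have h1 := (mul_nonneg hα.le (sq_nonneg _)).trans (hM.lower (β • ξ - η))
  have h2 := hM.upper ξ
  have h3 := hM.upper η
  rw [act_sub, act_smul, inner_sub_left, inner_sub_right, inner_sub_right, inner_smul_left,
    inner_smul_left, inner_smul_right, inner_smul_right, hM.inner_act_comm η ξ] at h1
  change 0 ≤ _ * (β * ⟪η, ξ⟫_ℝ) - _ * ⟪η, η⟫_ℝ - (β * ⟪η, η⟫_ℝ - _) at h1
  simp only [conj_trivial, real_inner_self_eq_norm_sq] at h1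
  change ⟪η, ξ⟫_ℝ ≤ _ at h2
  have h4 : β * (β * ⟪η, ξ⟫_ℝ) ≤ β * (β * (β * ‖ξ‖ ^ 2)) := by gcongr
  have h5 : β * ‖η‖ ^ 2 ≤ β * (β * ‖ξ‖) ^ 2 := by nlinarith
  exact (pow_le_pow_iff_left₀ (norm_nonneg _) (by positivity) two_ne_zero).1
    (le_of_mul_le_mul_left h5 hβ)

theorem isUnit : IsUnit M := by
  rw [← Matrix.mulVec_injective_iff_isUnit]
  intro ξ η h
  have h1 : act M (WithLp.toLp 2 ξ - WithLp.toLp 2 η) = 0 := by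
    rw [act_sub, sub_eq_zero]
    ext i
    simpa [act, Matrix.toEuclideanLin] using congrFun h i
  have h2 := hM.lower (WithLp.toLp 2 ξ - WithLp.toLp 2 η)
  rw [h1, inner_zero_left] at h2
  have h3 : ‖WithLp.toLp 2 ξ - WithLp.toLp 2 η‖ = 0 := by
    have : ‖WithLp.toLp 2 ξ - WithLp.toLp 2 η‖ ^ 2 ≤ 0 := nonpos_of_mul_nonpos_right h2 hα
    nlinarith [norm_nonneg (WithLp.toLp 2 ξ - WithLp.toLp 2 η)]
  have h4 := sub_eq_zero.1 (norm_eq_zero.1 h3)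
  simpa using h4

theorem act_inv_act (ξ : E d) : act M⁻¹ (act M ξ) = ξ := by
  rw [← act_mul, Matrix.nonsing_inv_mul _ ((Matrix.isUnit_iff_isUnit_det _).1 (hM.isUnit hα)),
    act_one]

theorem act_act_inv (ξ : E d) : act M (act M⁻¹ ξ) = ξ := by
  rw [← act_mul, Matrix.mul_nonsing_inv _ ((Matrix.isUnit_iff_isUnit_det _).1 (hM.isUnit hα)),
    act_one]

theorem inner_act_inv_comm (ξ η : E d) : ⟪act M⁻¹ ξ, η⟫_ℝ = ⟪ξ, act M⁻¹ η⟫_ℝ := by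
  conv_lhs => rw [← hM.act_act_inv hα η]
  rw [← hM.inner_act_comm, hM.act_act_inv hα]

theorem inner_act_inv_nonneg (ξ : E d) : 0 ≤ ⟪act M⁻¹ ξ, ξ⟫_ℝ := by
  have h := hM.lower (act M⁻¹ ξ)
  rw [hM.act_act_inv hα, real_inner_comm] at h
  exact (mul_nonneg hα.le (sq_nonneg _)).trans h

theorem norm_act_inv_le (ξ : E d) : ‖act M⁻¹ ξ‖ ≤ α⁻¹ * ‖ξ‖ := by
  have h := hM.lower (act M⁻¹ ξ)
  rw [hM.act_act_inv hα] at h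
  have h2 := real_inner_le_norm ξ (act M⁻¹ ξ)
  rw [inv_mul_eq_div, le_div_iff₀ hα]
  rcases (norm_nonneg (act M⁻¹ ξ)).eq_or_lt with h3 | h3
  · rw [← h3]; simp
  · nlinarith

end IsCoefficient

theorem aestronglyMeasurable_act {μ : Measure (E d)} {A : E d → Matrix (Fin d) (Fin d) ℝ}
    {p : E d → E d} (hA : ∀ i j, AEStronglyMeasurable (fun x => A x i j) μ)
    (hp : AEStronglyMeasurable p μ) : AEStronglyMeasurable (fun x => act (A x) (p x)) μ := by
  have h1 : AEMeasurable (fun x => fun i => act (A x) (p x) i) μ := by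
    refine aemeasurable_pi_lambda _ fun i => ?_
    simp only [act_apply]
    refine Finset.aemeasurable_fun_sum _ fun j _ => ?_
    refine (hA i j).aemeasurable.mul ?_
    exact ((EuclideanSpace.proj (𝕜 := ℝ) j).continuous.comp_aestronglyMeasurable hp).aemeasurable
  have h2 := (PiLp.continuous_toLp 2 (fun _ : Fin d => ℝ)).comp_aestronglyMeasurable
    h1.aestronglyMeasurable
  exact h2

theorem aestronglyMeasurable_det {n : Type*} [Fintype n] [DecidableEq n] {μ : Measure (E d)}
    {A : E d → Matrix n n ℝ} (hA : ∀ i j, AEStronglyMeasurable (fun x => A x i j) μ) :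
    AEStronglyMeasurable (fun x => (A x).det) μ := by
  simp only [Matrix.det_apply]
  refine Finset.aestronglyMeasurable_fun_sum _ fun σ _ => ?_
  exact (Finset.aestronglyMeasurable_fun_prod _ fun i _ => hA _ _).const_smul _

/-- Cramer's formula writes the entries of the inverse through determinants, which are polynomials
in the measurable entries. -/
theorem aestronglyMeasurable_inv {μ : Measure (E d)} {A : E d → Matrix (Fin d) (Fin d) ℝ}
    (hA : ∀ i j, AEStronglyMeasurable (fun x => A x i j) μ) (i j : Fin d) :
    AEStronglyMeasurable (fun x => (A x)⁻¹ i j) μ := by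
  simp only [Matrix.inv_def, Matrix.smul_apply, Ring.inverse_eq_inv', Matrix.adjugate_apply,
    smul_eq_mul]
  refine (aestronglyMeasurable_det hA).aemeasurable.inv.aestronglyMeasurable.mul ?_
  refine aestronglyMeasurable_det fun k l => ?_
  simp only [Matrix.updateRow_apply]
  split_ifs
  · exact aestronglyMeasurable_const
  · exact hA k l

namespace Problem

variable (P : Problem d)

theorem ae_isCoefficient : ∀ᵐ x ∂(volume.restrict P.mesh.Ω), IsCoefficient P.α P.β (P.A x) := by
  filter_upwards [P.A_symm, P.A_elliptic] with x h1 h2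
  exact ⟨h1, fun ξ => (h2 ξ).1, fun ξ => (h2 ξ).2⟩

variable {U : Set (E d)} (hU : U ⊆ P.mesh.Ω)

theorem flux_add (v w : Field d) : P.flux (v + w) = P.flux v + P.flux w := by
  ext1 x; exact act_add _ _ _

theorem flux_sub (v w : Field d) : P.flux (v - w) = P.flux v - P.flux w := by
  ext1 x; exact act_sub _ _ _

include hU

theorem ae_isCoefficient_of_subset :
    ∀ᵐ x ∂(volume.restrict U), IsCoefficient P.α P.β (P.A x) :=
  ae_mono (Measure.restrict_mono hU le_rfl) P.ae_isCoefficient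

theorem memLp_act {p : E d → E d} (hp : MemLp p 2 (volume.restrict U)) :
    MemLp (fun x => act (P.A x) (p x)) 2 (volume.restrict U) := by
  refine hp.of_le_mul (c := |P.β|) (aestronglyMeasurable_act (fun i j =>
    (P.A_meas i j).mono_measure (Measure.restrict_mono hU le_rfl)) hp.1) ?_
  filter_upwards [P.ae_isCoefficient_of_subset hU] with x hx
  exact hx.norm_act_le P.α_pos _

theorem memLp_flux {v : Field d} (hv : MemLp v.2 2 (volume.restrict U)) :
    MemLp (P.flux v) 2 (volume.restrict U) := P.memLp_act hU hv

theorem memLp_act_inv {p : E d → E d} (hp : MemLp p 2 (volume.restrict U)) :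
    MemLp (fun x => act (P.A x)⁻¹ (p x)) 2 (volume.restrict U) := by
  refine hp.of_le_mul (c := P.α⁻¹) (aestronglyMeasurable_act (aestronglyMeasurable_inv fun i j =>
    (P.A_meas i j).mono_measure (Measure.restrict_mono hU le_rfl)) hp.1) ?_
  filter_upwards [P.ae_isCoefficient_of_subset hU] with x hx
  exact hx.norm_act_inv_le P.α_pos _

theorem gradient_ae_eq_zero {v : Field d} (hv : MemLp v.2 2 (volume.restrict U))
    (h : ∫ x in U, ⟪P.flux v x, v.2 x⟫_ℝ ≤ 0) : v.2 =ᵐ[volume.restrict U] 0 := by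
  have h0 : 0 ≤ᵐ[volume.restrict U] fun x => ⟪P.flux v x, v.2 x⟫_ℝ := by
    filter_upwards [P.ae_isCoefficient_of_subset hU] with x hx
    exact (mul_nonneg P.α_pos.le (sq_nonneg _)).trans (hx.lower _)
  have h1 := (integral_eq_zero_iff_of_nonneg_ae h0
    (MemLp.integrable_inner_two (P.memLp_flux hU hv) hv)).1
    (le_antisymm h (integral_nonneg_of_ae h0))
  filter_upwards [h1, P.ae_isCoefficient_of_subset hU] with x hx hx2
  have h2 := hx2.lower (v.2 x)
  change _ ≤ ⟪P.flux v x, v.2 x⟫_ℝ at h2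
  rw [hx] at h2
  have h3 : ‖v.2 x‖ ^ 2 ≤ 0 := nonpos_of_mul_nonpos_right h2 P.α_pos
  have h4 : ‖v.2 x‖ = 0 := by nlinarith [norm_nonneg (v.2 x)]
  simpa using h4

end Problem

end

section

/-! ### The space `H¹₀` -/

theorem MemH10.congr {U : Set (E d)} {v w : Field d} (hv : MemH10 U v)
    (h1 : v.1 =ᵐ[volume.restrict U] w.1) (h2 : v.2 =ᵐ[volume.restrict U] w.2) : MemH10 U w := by
  obtain ⟨h, ψ, hψ, t1, t2⟩ := hv
  refine ⟨h.congr h1 h2, ψ, hψ, t1.congr fun n => eLpNorm_congr_ae ?_,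
    t2.congr fun n => eLpNorm_congr_ae ?_⟩
  · filter_upwards [h1] with x hx
    rw [hx]
  · filter_upwards [h2] with x hx
    rw [hx]

theorem MemH10.add {U : Set (E d)} {v w : Field d} (hv : MemH10 U v) (hw : MemH10 U w) :
    MemH10 U (v + w) := by
  obtain ⟨h1, ψ, hψ, h2⟩ := hv
  obtain ⟨h1', ψ', hψ', h2'⟩ := hw
  have c := fun n => (hψ n).1.continuous
  have c' := fun n => (hψ' n).1.continuous
  have g := fun n => continuous_gradient (hψ n).1
  have g' := fun n => continuous_gradient (hψ' n).1
  refine ⟨h1.add h1', fun n x => ψ n x + ψ' n x, fun n => ⟨(hψ n).1.add (hψ' n).1,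
    (hψ n).2.1.add (hψ' n).2.1, (tsupport_add _ _).trans
      (Set.union_subset (hψ n).2.2 (hψ' n).2.2)⟩, ?_, ?_⟩
  · exact tendsto_eLpNorm_add (fun n => (c n).aestronglyMeasurable) h1.memLp.1
      (fun n => (c' n).aestronglyMeasurable) h1'.memLp.1 h2.1 h2'.1
  · refine (tendsto_eLpNorm_add (fun n => (g n).aestronglyMeasurable) h1.memLp_grad.1
      (fun n => (g' n).aestronglyMeasurable) h1'.memLp_grad.1 h2.2 h2'.2).congr fun n => ?_
    congr 1
    ext1 x
    rw [gradient_add ((hψ n).1.differentiable (by simp) _)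
      ((hψ' n).1.differentiable (by simp) _)]
    rfl

theorem memH10_zero (U : Set (E d)) : MemH10 U (0 : Field d) := by
  refine ⟨(H1 U).zero_mem, fun _ _ => 0, fun n => ⟨contDiff_const, HasCompactSupport.zero, ?_⟩,
    ?_, ?_⟩
  · simp [tsupport]
  · simp
  · simp [gradient]

theorem MemH10.sum {U : Set (E d)} {ι : Type*} {s : Finset ι} {z : ι → Field d}
    (hz : ∀ i ∈ s, MemH10 U (z i)) : MemH10 U (∑ i ∈ s, z i) := by
  classical
  induction s using Finset.induction_on with
  | empty => simpa using memH10_zero U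
  | insert i s hi ih =>
    rw [Finset.sum_insert hi]
    exact (hz i (Finset.mem_insert_self i s)).add
      (ih fun j hj => hz j (Finset.mem_insert_of_mem hj))

/-- Here `φ` need not vanish on the boundary: the approximations of `z` supply the compact support.
This is what lets elementwise bubbles be tested by functions defined on all of `Ω`. -/
theorem MemH10.integral_gradient {U : Set (E d)} (hU : Bornology.IsBounded U) {z : Field d}
    (hz : MemH10 U z) {φ : E d → ℝ} (hφ : ContDiff ℝ ∞ φ) (e : E d) :
    ∫ x in U, (z.1 x * ⟪gradient φ x, e⟫_ℝ + ⟪z.2 x, φ x • e⟫_ℝ) = 0 := by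
  obtain ⟨h1, ψ, hψ, t1, t2⟩ := hz
  have hg := continuous_gradient hφ
  have hc := hφ.continuous
  have m1 := fun n => memLp_restrict_of_continuous (hψ n).1.continuous hU 2
  have m2 := fun n => memLp_restrict_of_continuous (continuous_gradient (hψ n).1) hU 2
  have m3 : MemLp (fun x => ⟪gradient φ x, e⟫_ℝ) 2 (volume.restrict U) :=
    memLp_restrict_of_continuous (by fun_prop) hU 2
  have m4 : MemLp (fun x => φ x • e) 2 (volume.restrict U) :=
    memLp_restrict_of_continuous (by fun_prop) hU 2
  have s := (tendsto_integral_mul_of_eLpNorm m1 h1.memLp m3 t1).add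
    (tendsto_integral_inner_of_eLpNorm m2 h1.memLp_grad m4 t2)
  rw [integral_add (MemLp.integrable_mul_two h1.memLp m3)
    (MemLp.integrable_inner_two h1.memLp_grad m4)]
  refine tendsto_nhds_unique s (tendsto_const_nhds.congr fun n => ?_)
  have := (memH1_of_contDiff hU hφ).weak_grad_inner (hψ n) e
  simp only [inner_smul_right]
  have e1 : ∫ x in U, φ x * ⟪gradient (ψ n) x, e⟫_ℝ = - ∫ x in U, ψ n x * ⟪gradient φ x, e⟫_ℝ := this
  rw [e1]
  ring

theorem MemH10.integral_inner_eq_zero {U : Set (E d)} (hU : Bornology.IsBounded U) {z : Field d}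
    (hz : MemH10 U z) {p : E d → E d} (hp : MemLp p 2 (volume.restrict U))
    (h : HasWeakDiv U p 0) : ∫ x in U, ⟪p x, z.2 x⟫_ℝ = 0 := by
  obtain ⟨h1, ψ, hψ, t1, t2⟩ := hz
  have m2 := fun n => memLp_restrict_of_continuous (continuous_gradient (hψ n).1) hU 2
  have s := tendsto_integral_inner_of_eLpNorm m2 h1.memLp_grad hp t2
  have e : ∀ n, ∫ x in U, ⟪gradient (ψ n) x, p x⟫_ℝ = 0 := fun n => by
    have := h _ (hψ n)
    simp only [real_inner_comm (p _)] at this ⊢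
    rw [this]
    simp
  simp only [e] at s
  have := tendsto_nhds_unique s tendsto_const_nhds
  simp only [real_inner_comm (z.2 _)]
  rw [this]

theorem HasWeakDiv.congr {U : Set (E d)} {p q : E d → E d} {f : E d → ℝ}
    (h : HasWeakDiv U p f) (hpq : p =ᵐ[volume.restrict U] q) : HasWeakDiv U q f := by
  intro φ hφ
  rw [← h φ hφ]
  refine integral_congr_ae ?_
  filter_upwards [hpq] with x hx
  rw [hx]

/-- A constant also has itself as trace; uniqueness compares the two on a facet, which has positive
measure. -/
theorem IsSimplex.eq_zero_of_isTrace_const (hd : 0 < d) {K : Finset (E d)} (hK : IsSimplex K)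
    {c : ℝ} (h : IsTrace K ((fun _ => c, fun _ => 0) : Field d) 0) : c = 0 := by
  have h1 := hK.isTrace_of_contDiff hd (contDiff_const (c := c))
  have e : gradient (fun _ : E d => c) = fun _ => 0 := by
    ext1 x; simp [gradient]
  rw [e] at h1
  have h2 := h.ae_eq hd hK (memH1_const (isBounded_openHull K) c) h1
  have hKn : K.Nonempty := by
    rw [← Finset.card_pos, hK.card]; omega
  obtain ⟨p, hp⟩ := hKn
  have h3 := ae_mono (hK.restrict_facet_le hp) h2
  have hne : NeBot (ae ((surf d).restrict (hull (K.erase p)))) := by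
    rw [ae_neBot, Ne, Measure.restrict_eq_zero]
    exact (hK.surf_facet_pos hd hp).ne'
  obtain ⟨x, hx⟩ := Filter.Eventually.exists h3
  exact hx.symm

namespace Mesh

variable {T : Mesh d}

/-- Elementwise integration by parts has no boundary terms, so functions that vanish on every
element boundary glue without jumps. -/
theorem memH1_Ω_of_memH10 {z : Field d} (hz : ∀ K ∈ T.elements, MemH10 (openHull K) z) :
    MemH1 T.Ω z := by
  have m1 : MemLp z.1 2 (volume.restrict T.Ω) := memLp_Ω fun K hK => (hz K hK).1.memLp
  have m2 : MemLp z.2 2 (volume.restrict T.Ω) := memLp_Ω fun K hK => (hz K hK).1.memLp_grad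
  refine MemH1.of_inner m1 m2 fun φ hφ e => ?_
  have q1 : MemLp (fun x => ⟪gradient φ x, e⟫_ℝ) 2 (volume.restrict T.Ω) := by
    have := continuous_gradient hφ.1
    exact memLp_restrict_of_continuous (by fun_prop) isBounded_Ω 2
  have q2 : MemLp (fun x => φ x • e) 2 (volume.restrict T.Ω) := hφ.memLp_smul_const _ e
  have j1 := MemLp.integrable_mul_two m1 q1
  have j2 := MemLp.integrable_inner_two m2 q2
  have j := j1.add j2
  simp only [Pi.add_def] at j
  have h0 := integral_Ω j
  rw [Finset.sum_eq_zero fun K hK => by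
    rw [restrict_hull]; exact (hz K hK).integral_gradient (isBounded_openHull K) hφ.1 e,
    integral_add j1 j2] at h0
  simp only [inner_smul_right] at h0
  linarith

/-- Functions that behave like the piecewise affine Lagrange basis on the facets. -/
structure IsNodalBasis (T : Mesh d) (φs : E d → Field d) : Prop where
  memH1 : ∀ i ∈ T.nodes, MemH1 T.Ω (φs i)
  isTrace : ∀ K ∈ T.elements, ∀ i ∈ K, IsTrace K (φs i) (fun x => lam K i x)
  eq_zero : ∀ i ∈ T.nodes, ∀ K ∈ T.elements, i ∉ K →
    (φs i).1 =ᵐ[volume.restrict (openHull K)] 0 ∧ (φs i).2 =ᵐ[volume.restrict (openHull K)] 0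
  sum_eq : ∀ K ∈ T.elements, ∀ᵐ x ∂(volume.restrict (openHull K)),
    ∑ i ∈ K, (φs i).1 x = 1 ∧ ∑ i ∈ K, (φs i).2 x = 0

theorem sum_slope_lam {K : Finset (E d)} (hK : IsSimplex K) :
    ∑ i ∈ K, slope (lam K i) = 0 := by
  refine ext_inner_right ℝ fun e => ?_
  have h1 := hK.sum_lam 0
  have h2 := hK.sum_lam (0 + e)
  simp only [affine_apply_add _ 0 e, Finset.sum_add_distrib] at h2
  rw [sum_inner, inner_zero_left]
  linarith

theorem IsHatBasis.isNodalBasis (hd : 0 < d) {φ0 : E d → Field d} (h : T.IsHatBasis φ0) :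
    T.IsNodalBasis φ0 where
  memH1 i hi := h.memH1_Ω hi
  isTrace K hK i hi := h.isTrace_of_mem hd hi hK
  eq_zero i hi K hK hiK := by
    obtain ⟨a, -, h0, h1, h2⟩ := h.eq_affine hi hK
    rw [h0 hiK] at h1 h2
    have e : slope (0 : E d →ᵃ[ℝ] ℝ) = 0 := by
      refine ext_inner_right ℝ fun e => ?_
      rw [inner_slope]; simp
    rw [e] at h2
    exact ⟨h1, h2⟩
  sum_eq K hK := by
    have h1 : ∀ i ∈ K, ∀ᵐ x ∂(volume.restrict (openHull K)),
        (φ0 i).1 x = lam K i x ∧ (φ0 i).2 x = slope (lam K i) := fun i hi => by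
      obtain ⟨a, h0, -, h1, h2⟩ := h.eq_affine ⟨K, hK, hi⟩ hK
      rw [← h0 hi]
      filter_upwards [h1, h2] with x hx1 hx2 using ⟨hx1, hx2⟩
    filter_upwards [(Finset.eventually_all K).2 h1] with x hx
    rw [Finset.sum_congr rfl fun i hi => (hx i hi).1, Finset.sum_congr rfl fun i hi => (hx i hi).2]
    exact ⟨(T.isSimplex hK).sum_lam x, sum_slope_lam (T.isSimplex hK)⟩

end Mesh

namespace Problem

variable {P : Problem d}

/-- Testing with `w` itself shows that the energy is zero, so ellipticity makes `w` constant, and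
its zero trace makes the constant zero. -/
theorem eq_zero_of_memH10 (hd : 0 < d) {K : Finset (E d)} (hK : K ∈ P.mesh.elements) {w : Field d}
    (hw : MemH10 (openHull K) w) (h : HasWeakDiv (openHull K) (P.flux w) 0) :
    w.1 =ᵐ[volume.restrict (openHull K)] 0 ∧ w.2 =ᵐ[volume.restrict (openHull K)] 0 := by
  have hU := Mesh.openHull_subset_Ω hK
  have sK := P.mesh.isSimplex hK
  have h2 := P.gradient_ae_eq_zero hU hw.1.memLp_grad
    (hw.integral_inner_eq_zero (isBounded_openHull K) (P.memLp_flux hU hw.1.memLp_grad) h).le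
  obtain ⟨c, hc⟩ := hw.1.ae_eq_const (isOpen_openHull K) (convex_openHull K)
    (isBounded_openHull K) sK.nonempty_openHull h2
  have h3 : IsTrace K ((fun _ => c, fun _ => 0) : Field d) 0 := hw.isTrace_zero.congr hc h2
  rw [sK.eq_zero_of_isTrace_const hd h3] at hc
  exact ⟨hc, h2⟩

theorem flux_sum {ι : Type*} (s : Finset ι) (v : ι → Field d) :
    P.flux (∑ i ∈ s, v i) = ∑ i ∈ s, P.flux (v i) := by
  classical
  induction s using Finset.induction_on with
  | empty =>
    ext1 x
    exact act_zero _
  | insert i s hi ih => rw [Finset.sum_insert hi, Finset.sum_insert hi, flux_add, ih]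

theorem hasWeakDiv_flux_sum {U : Set (E d)} (hU : U ⊆ P.mesh.Ω) {ι : Type*} {s : Finset ι}
    {v : ι → Field d} (hv : ∀ i ∈ s, MemH1 U (v i))
    (h : ∀ i ∈ s, HasWeakDiv U (P.flux (v i)) 0) :
    HasWeakDiv U (P.flux (∑ i ∈ s, v i)) 0 := by
  intro φ hφ
  have m := hφ.memLp_gradient (p := 2) (volume.restrict U)
  have h1 : ∀ i ∈ s, ∫ x in U, ⟪P.flux (v i) x, gradient φ x⟫_ℝ = 0 := fun i hi => by
    simpa using h i hi φ hφ
  rw [flux_sum]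
  simp only [Finset.sum_apply, sum_inner, Pi.zero_apply, zero_mul, integral_zero, neg_zero]
  rw [integral_finsetSum _ fun i hi => MemLp.integrable_inner_two
    (P.memLp_flux hU (hv i hi).memLp_grad) m]
  exact Finset.sum_eq_zero h1

/-- Adding `H¹₀` bubbles changes neither global membership nor traces. Vanishing off the patch and
the partition of unity follow from local uniqueness: in each case the defect is `A`-harmonic in the
element and, by the corresponding property of hat functions, in `H¹₀`. -/
theorem IsMsFEMBasis.isNodalBasis (hd : 0 < d) {φ0 φ : E d → Field d} (h0 : P.mesh.IsHatBasis φ0)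
    (h : P.IsMsFEMBasis φ0 φ) : P.mesh.IsNodalBasis φ where
  memH1 i hi := by
    have h1 := Mesh.memH1_Ω_of_memH10 fun K hK => (h i hi K hK).2.2
    have := (h0.memH1_Ω hi).add h1
    rwa [add_sub_cancel] at this
  isTrace K hK i hi := by
    have hi' : i ∈ P.mesh.nodes := ⟨K, hK, hi⟩
    have h1 := (h i hi' K hK).2.2
    have := IsTrace.add (h0.memH1_openHull hi' hK) h1.1 (h0.isTrace_of_mem hd hi hK)
      h1.isTrace_zero
    simpa using this
  eq_zero i hi K hK hiK := by
    obtain ⟨h1, h2, h3⟩ := h i hi K hK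
    obtain ⟨e1, e2⟩ := (h0.isNodalBasis hd).eq_zero i hi K hK hiK
    refine eq_zero_of_memH10 hd hK (h3.congr ?_ ?_) h2
    · filter_upwards [e1] with x hx
      simp [hx]
    · filter_upwards [e2] with x hx
      simp [hx]
  sum_eq K hK := by
    have hn : ∀ i ∈ K, i ∈ P.mesh.nodes := fun i hi => ⟨K, hK, hi⟩
    have hs := (h0.isNodalBasis hd).sum_eq K hK
    have h1 := MemH10.sum fun i hi => (h i (hn i hi) K hK).2.2
    set w : Field d := ∑ i ∈ K, φ i - ((fun _ => 1, fun _ => 0) : Field d) with hw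
    have h2 : MemH10 (openHull K) w := by
      refine h1.congr ?_ ?_
      · filter_upwards [hs] with x hx
        simp [hw, Prod.fst_sum, Finset.sum_sub_distrib, hx.1]
      · filter_upwards [hs] with x hx
        simp [hw, Prod.snd_sum, Finset.sum_sub_distrib, hx.2]
    have h3 : HasWeakDiv (openHull K) (P.flux w) 0 := by
      refine (hasWeakDiv_flux_sum (Mesh.openHull_subset_Ω hK) (fun i hi => (h i (hn i hi) K hK).1)
        fun i hi => (h i (hn i hi) K hK).2.1).congr (ae_of_all _ fun x => ?_)
      simp [flux, hw]
    obtain ⟨e1, e2⟩ := eq_zero_of_memH10 hd hK h2 h3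
    filter_upwards [e1, e2] with x hx1 hx2
    simp only [hw, Prod.fst_sub, Prod.snd_sub, Prod.fst_sum, Prod.snd_sum, Pi.sub_apply,
      Finset.sum_apply, Pi.zero_apply, sub_zero] at hx1 hx2
    exact ⟨sub_eq_zero.1 hx1, hx2⟩

end Problem

end

section

/-! ### Linear systems and least squares -/

/-- A vector outside the range of a finite-dimensional linear map is separated from it by a
functional that kills the range. The coordinates of that functional are a multiplier violating the
hypothesis. -/
theorem exists_solution_of_dual {κ Φ : Type*} (t : Finset κ) (s : Finset Φ) (B : κ → Φ → ℝ)
    (R : κ → ℝ) (h : ∀ l : κ → ℝ, (∀ F ∈ s, ∑ K ∈ t, l K * B K F = 0) → ∑ K ∈ t, l K * R K = 0) :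
    ∃ b : Φ → ℝ, ∀ K ∈ t, ∑ F ∈ s, B K F * b F = R K := by
  classical
  let L : (Φ → ℝ) →ₗ[ℝ] (t → ℝ) :=
    { toFun := fun b K => ∑ F ∈ s, B K F * b F
      map_add' := fun b b' => by
        ext K; simp [mul_add, Finset.sum_add_distrib]
      map_smul' := fun c b => by
        ext K
        simp only [Pi.smul_apply, smul_eq_mul, Finset.mul_sum, RingHom.id_apply]
        exact Finset.sum_congr rfl fun F _ => by ring }
  by_cases hR : (fun K : t => R K) ∈ LinearMap.range L
  · obtain ⟨b, hb⟩ := hR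
    exact ⟨b, fun K hK => congrFun hb ⟨K, hK⟩⟩
  · exfalso
    obtain ⟨f, hf, hker⟩ := Submodule.exists_le_ker_of_notMem hR
    have hfx : ∀ x : t → ℝ, f x = ∑ K : t, f (Pi.single K 1) * x K := by
      intro x
      conv_lhs => rw [pi_eq_sum_univ' x, map_sum]
      refine Finset.sum_congr rfl fun K _ => ?_
      rw [map_smul, smul_eq_mul, mul_comm]
    set l : κ → ℝ := fun K => if hK : K ∈ t then f (Pi.single ⟨K, hK⟩ 1) else 0 with hl
    have hsum : ∀ y : κ → ℝ, ∑ K ∈ t, l K * y K = f fun K : t => y K := by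
      intro y
      rw [hfx, ← Finset.sum_coe_sort t]
      exact Finset.sum_congr rfl fun K _ => by simp [hl]
    refine hf ?_
    rw [← hsum]
    refine h l fun F hF => ?_
    rw [hsum]
    have h1 : L (Pi.single F 1) = fun K : t => B K F := by
      ext K
      simp only [L, LinearMap.coe_mk, AddHom.coe_mk, Pi.single_apply]
      simp [hF]
    rw [← h1]
    exact hker ⟨_, rfl⟩

/-- In the variables `(b - m) / w` the cost is the squared Euclidean norm and the constraints define
a closed convex set; its point of least norm is the minimizer. -/
theorem exists_least_squares {κ Φ : Type*} (t : Finset κ) (s : Finset Φ) (B : κ → Φ → ℝ)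
    (R : κ → ℝ) (w m : Φ → ℝ) (hw : ∀ F ∈ s, 0 < w F)
    (h : ∃ b : Φ → ℝ, ∀ K ∈ t, ∑ F ∈ s, B K F * b F = R K) :
    ∃ b : Φ → ℝ, (∀ K ∈ t, ∑ F ∈ s, B K F * b F = R K) ∧
      ∀ b' : Φ → ℝ, (∀ K ∈ t, ∑ F ∈ s, B K F * b' F = R K) →
        ∑ F ∈ s, (b F - m F) ^ 2 / w F ^ 2 ≤ ∑ F ∈ s, (b' F - m F) ^ 2 / w F ^ 2 := by
  classical
  obtain ⟨b0, hb0⟩ := h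
  set Y : Set (EuclideanSpace ℝ s) :=
    {y | ∀ K ∈ t, ∑ F : s, B K F * (m F + w F * y F) = R K} with hY
  have hYmem : ∀ b : Φ → ℝ, (∀ K ∈ t, ∑ F ∈ s, B K F * b F = R K) →
      (WithLp.toLp 2 fun F : s => (b F - m F) / w F) ∈ Y := by
    intro b hb K hK
    rw [← hb K hK, ← Finset.sum_coe_sort s]
    refine Finset.sum_congr rfl fun F _ => ?_
    have := (hw F F.2).ne'
    simp only
    field_simp
    ring
  have hYc : IsClosed Y := by
    have : Y = ⋂ K ∈ t, {y | ∑ F : s, B K F * (m F + w F * y F) = R K} := by ext; simp [hY]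
    rw [this]
    exact isClosed_biInter fun K _ => isClosed_eq (by fun_prop) continuous_const
  have hYconv : Convex ℝ Y := by
    intro y hy z hz a b _ _ hab K hK
    have e : ∀ F : s, B K F * (m F + w F * (a • y + b • z) F) =
        a * (B K F * (m F + w F * y F)) + b * (B K F * (m F + w F * z F)) := by
      intro F
      simp only [PiLp.add_apply, PiLp.smul_apply, smul_eq_mul]
      linear_combination -(B K F * m F) * hab
    simp only [e, Finset.sum_add_distrib, ← Finset.mul_sum, hy K hK, hz K hK]
    rw [← add_mul, hab, one_mul]
  obtain ⟨y, hy, hmin⟩ := exists_norm_eq_iInf_of_complete_convex ⟨_, hYmem b0 hb0⟩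
    hYc.isComplete hYconv 0
  have hmin' : ∀ z ∈ Y, ‖y‖ ≤ ‖z‖ := by
    intro z hz
    have h1 : ⨅ w : Y, ‖(0 : EuclideanSpace ℝ s) - w‖ ≤ ‖(0 : EuclideanSpace ℝ s) - z‖ :=
      ciInf_le ⟨0, by rintro _ ⟨w, rfl⟩; exact norm_nonneg _⟩ (⟨z, hz⟩ : Y)
    rw [← hmin] at h1
    simpa using h1
  set b : Φ → ℝ := fun F => if hF : F ∈ s then m F + w F * y ⟨F, hF⟩ else 0 with hb
  have hbF : ∀ F : s, b F = m F + w F * y F := fun F => by simp [hb]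
  have hcost : ∀ b' : Φ → ℝ, ‖(WithLp.toLp 2 fun F : s => (b' F - m F) / w F)‖ ^ 2 =
      ∑ F ∈ s, (b' F - m F) ^ 2 / w F ^ 2 := by
    intro b'
    rw [EuclideanSpace.norm_sq_eq, ← Finset.sum_coe_sort s]
    refine Finset.sum_congr rfl fun F _ => ?_
    rw [Real.norm_eq_abs, sq_abs, div_pow]
  refine ⟨b, fun K hK => ?_, fun b' hb' => ?_⟩
  · rw [← hy K hK, ← Finset.sum_coe_sort s]
    exact Finset.sum_congr rfl fun F _ => by rw [hbF]
  · rw [← hcost, ← hcost]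
    have e : (WithLp.toLp 2 fun F : s => (b F - m F) / w F) = y := by
      ext F
      have := (hw F F.2).ne'
      simp only [hbF]
      field_simp
      ring
    rw [e]
    exact pow_le_pow_left₀ (norm_nonneg _) (hmin' _ (hYmem b' hb')) 2

/-- The midpoint of two minimizers is admissible, and by the parallelogram identity it is strictly
cheaper unless they agree on `s`. -/
theorem eq_of_least_squares {κ Φ : Type*} (t : Finset κ) (s : Finset Φ) (B : κ → Φ → ℝ)
    (R : κ → ℝ) (w m : Φ → ℝ) (hw : ∀ F ∈ s, 0 < w F) {b b' : Φ → ℝ}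
    (hb : ∀ K ∈ t, ∑ F ∈ s, B K F * b F = R K) (hb' : ∀ K ∈ t, ∑ F ∈ s, B K F * b' F = R K)
    (hmin : ∀ c : Φ → ℝ, (∀ K ∈ t, ∑ F ∈ s, B K F * c F = R K) →
        ∑ F ∈ s, (b F - m F) ^ 2 / w F ^ 2 ≤ ∑ F ∈ s, (c F - m F) ^ 2 / w F ^ 2)
    (hmin' : ∀ c : Φ → ℝ, (∀ K ∈ t, ∑ F ∈ s, B K F * c F = R K) →
        ∑ F ∈ s, (b' F - m F) ^ 2 / w F ^ 2 ≤ ∑ F ∈ s, (c F - m F) ^ 2 / w F ^ 2) :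
    ∀ F ∈ s, b F = b' F := by
  have hc : ∀ K ∈ t, ∑ F ∈ s, B K F * ((b F + b' F) / 2) = R K := by
    intro K hK
    have e : ∀ F, B K F * ((b F + b' F) / 2) = (B K F * b F + B K F * b' F) / 2 := fun F => by ring
    simp only [e]
    rw [← Finset.sum_div, Finset.sum_add_distrib, hb K hK, hb' K hK]
    ring
  have h1 := hmin _ hc
  have h2 := hmin' _ hc
  have h3 : ∑ F ∈ s, ((b F + b' F) / 2 - m F) ^ 2 / w F ^ 2 =
      (∑ F ∈ s, (b F - m F) ^ 2 / w F ^ 2 + ∑ F ∈ s, (b' F - m F) ^ 2 / w F ^ 2) / 2 -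
        (∑ F ∈ s, (b F - b' F) ^ 2 / w F ^ 2) / 4 := by
    rw [← Finset.sum_add_distrib, Finset.sum_div, Finset.sum_div, ← Finset.sum_sub_distrib]
    exact Finset.sum_congr rfl fun F _ => by ring
  have h4 : ∑ F ∈ s, (b F - b' F) ^ 2 / w F ^ 2 ≤ 0 := by linarith
  intro F hF
  have h5 : (b F - b' F) ^ 2 / w F ^ 2 ≤ 0 :=
    (Finset.single_le_sum (f := fun F => (b F - b' F) ^ 2 / w F ^ 2)
      (fun G _ => by positivity) hF).trans h4
  have h6 : 0 < w F ^ 2 := pow_pos (hw F hF) 2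
  have h7 : (b F - b' F) ^ 2 ≤ 0 := by
    by_contra! h
    have := div_pos h h6
    linarith
  have h8 : b F - b' F = 0 := by nlinarith [sq_nonneg (b F - b' F)]
  linarith

/-! ### Traces on the facets of a mesh -/

namespace Mesh

variable {T : Mesh d} {F : Finset (E d)} {v w : Field d}

theorem facetTrace_add (hd : 0 < d) (hF : F ∈ T.facets) (hv : MemH1 T.Ω v) (hw : MemH1 T.Ω w) :
    T.facetTrace F (v + w) =ᵐ[(surf d).restrict (hull F)]
      fun x => T.facetTrace F v x + T.facetTrace F w x := by
  obtain ⟨K, hK, hFK⟩ := exists_element_of_facet hF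
  have hc := ((mem_facets T).1 hF).2
  have sK := T.isSimplex hK
  obtain ⟨p, hp, hFp⟩ := exists_eq_erase hc hK hFK
  have hvK := memH1_openHull hv hK
  have hwK := memH1_openHull hw hK
  have h := IsTrace.ae_eq_facet hd sK (hvK.add hwK) (IsTrace.add hvK hwK
    (sK.isTrace_trace hd hvK) (sK.isTrace_trace hd hwK)) hp
  rw [← hFp] at h
  filter_upwards [h, facetTrace_eq_trace hd hK hc hFK (hv.add hw),
    facetTrace_eq_trace hd hK hc hFK hv, facetTrace_eq_trace hd hK hc hFK hw] with x h1 h2 h3 h4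
  rw [h2, h1, h3, h4]

theorem facetTrace_smul (hd : 0 < d) (hF : F ∈ T.facets) (hv : MemH1 T.Ω v) (c : ℝ) :
    T.facetTrace F (c • v) =ᵐ[(surf d).restrict (hull F)] fun x => c * T.facetTrace F v x := by
  obtain ⟨K, hK, hFK⟩ := exists_element_of_facet hF
  have hc := ((mem_facets T).1 hF).2
  have sK := T.isSimplex hK
  obtain ⟨p, hp, hFp⟩ := exists_eq_erase hc hK hFK
  have hvK := memH1_openHull hv hK
  have h := IsTrace.ae_eq_facet hd sK (hvK.smul c) ((sK.isTrace_trace hd hvK).const_smul c) hp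
  rw [← hFp] at h
  filter_upwards [h, facetTrace_eq_trace hd hK hc hFK (hv.smul c),
    facetTrace_eq_trace hd hK hc hFK hv] with x h1 h2 h3
  rw [h2, h1, h3]

theorem memLp_facetTrace (hd : 0 < d) (hF : F ∈ T.facets) (hv : MemH1 T.Ω v) :
    MemLp (T.facetTrace F v) 2 ((surf d).restrict (hull F)) := by
  obtain ⟨K, hK, hFK⟩ := exists_element_of_facet hF
  have hc := ((mem_facets T).1 hF).2
  obtain ⟨p, hp, hFp⟩ := exists_eq_erase hc hK hFK
  refine (memLp_congr_ae (facetTrace_eq_trace hd hK hc hFK hv)).2 ?_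
  rw [hFp]
  exact (T.isSimplex hK).memLp_trace_facet hd (memH1_openHull hv hK) hp

namespace IsNodalBasis

variable {φs : E d → Field d} (h : T.IsNodalBasis φs) {K : Finset (E d)} {i : E d}
include h

theorem trace_of_mem (hd : 0 < d) (hK : K ∈ T.elements) (hF : F.card = d) (hFK : F ⊆ K)
    (hi : i ∈ F) : trace K (φs i) =ᵐ[(surf d).restrict (hull F)] fun x => lam K i x := by
  obtain ⟨p, hp, rfl⟩ := exists_eq_erase hF hK hFK
  exact IsTrace.ae_eq_facet hd (T.isSimplex hK)
    (memH1_openHull (h.memH1 i ⟨K, hK, hFK hi⟩) hK) (h.isTrace K hK i (hFK hi)) hp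

theorem trace_of_notMem (hd : 0 < d) (hK : K ∈ T.elements) (hF : F.card = d) (hFK : F ⊆ K)
    (hin : i ∈ T.nodes) (hi : i ∉ F) : trace K (φs i) =ᵐ[(surf d).restrict (hull F)] 0 := by
  obtain ⟨p, hp, rfl⟩ := exists_eq_erase hF hK hFK
  have sK := T.isSimplex hK
  have hH := memH1_openHull (h.memH1 i hin) hK
  by_cases hiK : i ∈ K
  · have e : i = p := by
      by_contra hne
      exact hi (Finset.mem_erase.2 ⟨hne, hiK⟩)
    subst e
    refine (IsTrace.ae_eq_facet hd sK hH (h.isTrace K hK i hiK) hp).trans ?_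
    filter_upwards [ae_restrict_mem (measurableSet_hull _)] with x hx
    exact ((sK.mem_facet hp).1 hx).2
  · obtain ⟨h1, h2⟩ := h.eq_zero i hin K hK hiK
    have h0 : IsTrace K (0 : Field d) 0 := (memH10_zero (openHull K)).isTrace_zero
    exact IsTrace.ae_eq_facet hd sK hH (h0.congr h1.symm h2.symm) hp

theorem facetTrace_of_mem (hd : 0 < d) (hK : K ∈ T.elements) (hF : F.card = d) (hFK : F ⊆ K)
    (hi : i ∈ F) : T.facetTrace F (φs i) =ᵐ[(surf d).restrict (hull F)] fun x => lam K i x :=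
  (facetTrace_eq_trace hd hK hF hFK (h.memH1 i ⟨K, hK, hFK hi⟩)).trans
    (h.trace_of_mem hd hK hF hFK hi)

theorem facetTrace_of_notMem (hd : 0 < d) (hF : F ∈ T.facets) (hin : i ∈ T.nodes) (hi : i ∉ F) :
    T.facetTrace F (φs i) =ᵐ[(surf d).restrict (hull F)] 0 := by
  obtain ⟨K, hK, hFK⟩ := exists_element_of_facet hF
  have hc := ((mem_facets T).1 hF).2
  exact (facetTrace_eq_trace hd hK hc hFK (h.memH1 i hin)).trans
    (h.trace_of_notMem hd hK hc hFK hin hi)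

end IsNodalBasis

end Mesh

namespace Problem

variable (P : Problem d)

theorem mem_facets_of_mem_D {F : Finset (E d)} (hF : F ∈ P.D) : F ∈ P.mesh.facets :=
  Finset.filter_subset _ _ (P.D_subset hF)

/-- The space `V` as a subspace. -/
def VSpace (hd : 0 < d) : Submodule ℝ (Field d) where
  carrier := P.V
  zero_mem' := by
    refine ⟨(H1 _).zero_mem, fun F hF => ?_⟩
    have h := Mesh.facetTrace_smul hd (P.mem_facets_of_mem_D hF) (H1 P.mesh.Ω).zero_mem 0
    rw [smul_zero] at h
    filter_upwards [h] with x hx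
    simpa using hx
  add_mem' := by
    rintro v w ⟨hv, hv'⟩ ⟨hw, hw'⟩
    refine ⟨hv.add hw, fun F hF => ?_⟩
    filter_upwards [Mesh.facetTrace_add hd (P.mem_facets_of_mem_D hF) hv hw, hv' F hF,
      hw' F hF] with x h1 h2 h3
    rw [h1, h2, h3]
    simp
  smul_mem' := by
    rintro c v ⟨hv, hv'⟩
    refine ⟨hv.smul c, fun F hF => ?_⟩
    filter_upwards [Mesh.facetTrace_smul hd (P.mem_facets_of_mem_D hF) hv c, hv' F hF]
      with x h1 h2
    rw [h1, h2]
    simp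

theorem mem_V_of_isNodalBasis (hd : 0 < d) {φs : E d → Field d} (h : P.mesh.IsNodalBasis φs)
    {i : E d} (hi : i ∈ P.freeNodes) : φs i ∈ P.V :=
  ⟨h.memH1 i hi.1, fun F hF =>
    h.facetTrace_of_notMem hd (P.mem_facets_of_mem_D hF) hi.1 (hi.2 F hF)⟩

theorem space_le_VSpace (hd : 0 < d) {φs : E d → Field d} (h : P.mesh.IsNodalBasis φs) :
    P.space φs ≤ P.VSpace hd := by
  refine Submodule.span_le.2 ?_
  rintro _ ⟨i, hi, rfl⟩
  exact P.mem_V_of_isNodalBasis hd h hi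

end Problem

end

section

/-! ### Orientations and the patch systems -/

namespace Mesh

variable {T : Mesh d} {rk : Finset (E d) → ℕ} {F K L : Finset (E d)}

theorem boundaryFacets_subset : T.boundaryFacets ⊆ T.facets := Finset.filter_subset _ _

theorem eq_of_boundary (hF : F ∈ T.boundaryFacets) (hK : K ∈ T.elements) (hL : L ∈ T.elements)
    (hFK : F ⊆ K) (hFL : F ⊆ L) : K = L := by
  classical
  have h := (Finset.mem_filter.1 hF).2
  obtain ⟨M, hM⟩ := Finset.card_eq_one.1 h
  have h1 : K ∈ ({M} : Finset _) := hM ▸ Finset.mem_filter.2 ⟨hK, hFK⟩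
  have h2 : L ∈ ({M} : Finset _) := hM ▸ Finset.mem_filter.2 ⟨hL, hFL⟩
  rw [Finset.mem_singleton.1 h1, Finset.mem_singleton.1 h2]

theorem orient_boundary (hF : F ∈ T.boundaryFacets) (hK : K ∈ T.elements) (hFK : F ⊆ K) :
    T.orient rk K F = 1 := by
  rw [orient, if_neg]
  rintro ⟨L, hL, hFL, hlt⟩
  rw [eq_of_boundary hF hK hL hFK hFL] at hlt
  exact lt_irrefl _ hlt

theorem orient_ne_zero : T.orient rk K F ≠ 0 := by
  rw [orient]
  split_ifs <;> norm_num

/-- A facet belongs to at most two elements and ranks are distinct, so exactly one of the two sees a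
larger neighbour. -/
theorem orient_add (hd : 0 < d) (hrk : Set.InjOn rk (T.elements : Set (Finset (E d))))
    (hF : F.card = d) (hK : K ∈ T.elements) (hL : L ∈ T.elements) (hFK : F ⊆ K) (hFL : F ⊆ L)
    (hKL : K ≠ L) : T.orient rk K F + T.orient rk L F = 0 := by
  wlog hlt : rk K < rk L generalizing K L
  · rw [add_comm]
    exact this hL hK hFL hFK hKL.symm
      (lt_of_le_of_ne (not_lt.1 hlt) fun e => hKL (hrk hK hL e.symm))
  rw [orient, if_pos ⟨L, hL, hFL, hlt⟩, orient, if_neg]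
  · norm_num
  rintro ⟨M, hM, hFM, h⟩
  rcases eq_or_eq_of_facet_subset hd hF hK hL hM hFK hFL hFM hKL with rfl | rfl
  · exact lt_asymm h hlt
  · exact lt_irrefl _ h

theorem facet_cases (hF : F ∈ T.facets) : F ∈ T.boundaryFacets ∨
    ∃ K ∈ T.elements, ∃ L ∈ T.elements, K ≠ L ∧ F ⊆ K ∧ F ⊆ L := by
  classical
  by_cases h : F ∈ T.boundaryFacets
  · exact Or.inl h
  right
  obtain ⟨K, hK, hFK⟩ := exists_element_of_facet hF
  by_contra! hne
  refine h (Finset.mem_filter.2 ⟨hF, Finset.card_eq_one.2 ⟨K, ?_⟩⟩)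
  ext L
  simp only [Finset.mem_filter, Finset.mem_singleton]
  constructor
  · rintro ⟨hL, hFL⟩
    by_contra hLK
    exact hne K hK L hL (Ne.symm hLK) hFK hFL
  · rintro rfl
    exact ⟨hK, hFK⟩

theorem mem_facets_of_subset (hd : 0 < d) (hK : K ∈ T.elements) (hF : F.card = d) (hFK : F ⊆ K) :
    F ∈ T.facets := by
  obtain ⟨p, hp, rfl⟩ := exists_eq_erase hF hK hFK
  exact facet_mem hd hK hp

open Classical in
theorem sum_interior {a : Finset (E d) → ℝ} (hd : 0 < d) (hF : F.card = d)
    (hK : K ∈ T.elements) (hL : L ∈ T.elements) (hFK : F ⊆ K) (hFL : F ⊆ L) (hKL : K ≠ L) :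
    ∑ M ∈ T.elements.filter (fun M => F ⊆ M), a M = a K + a L := by
  rw [← Finset.sum_pair hKL]
  refine Finset.sum_congr ?_ fun _ _ => rfl
  ext M
  simp only [Finset.mem_filter, Finset.mem_insert, Finset.mem_singleton]
  constructor
  · rintro ⟨hM, hFM⟩
    exact eq_or_eq_of_facet_subset hd hF hK hL hM hFK hFL hFM hKL
  · rintro (rfl | rfl)
    exacts [⟨hK, hFK⟩, ⟨hL, hFL⟩]

open Classical in
theorem sum_boundary {a : Finset (E d) → ℝ} (hF : F ∈ T.boundaryFacets)
    (hK : K ∈ T.elements) (hFK : F ⊆ K) :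
    ∑ M ∈ T.elements.filter (fun M => F ⊆ M), a M = a K := by
  rw [← Finset.sum_singleton a K]
  refine Finset.sum_congr ?_ fun _ _ => rfl
  ext M
  simp only [Finset.mem_filter, Finset.mem_singleton]
  constructor
  · rintro ⟨hM, hFM⟩
    exact eq_of_boundary hF hM hK hFM hFK
  · rintro rfl
    exact ⟨hK, hFK⟩

open Classical in
theorem powersetCard_eq (hd : 0 < d) (hK : K ∈ T.elements) :
    K.powersetCard d = T.facets.filter (fun F => F ⊆ K) := by
  ext F
  rw [Finset.mem_powersetCard, Finset.mem_filter]
  exact ⟨fun h => ⟨mem_facets_of_subset hd hK h.2 h.1, h.1⟩,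
    fun h => ⟨h.2, ((mem_facets T).1 h.1).2⟩⟩

end Mesh

namespace Problem

variable {P : Problem d} {rk : Finset (E d) → ℕ} {φs : E d → Field d} {uH : Field d}
  {i : E d} {b : Finset (E d) → ℝ}

theorem mem_neumannFacets {F : Finset (E d)} :
    F ∈ P.neumannFacets ↔ F ∈ P.mesh.boundaryFacets ∧ F ∉ P.D := by
  classical
  simp [neumannFacets]

theorem memLp_g {F : Finset (E d)} (hF : F ∈ P.neumannFacets) :
    MemLp P.g 2 ((surf d).restrict (hull F)) :=
  P.g_memLp F (mem_neumannFacets.1 hF).1 (mem_neumannFacets.1 hF).2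

variable (P rk) in
open Classical in
/-- The incidence matrix of elements and facets. -/
def incidence (K F : Finset (E d)) : ℝ := if F ⊆ K then P.mesh.orient rk K F else 0

variable (P) in
open Classical in
/-- The facets of the patch of a node on which the tractions are unknown. -/
def patchFacets (i : E d) : Finset (Finset (E d)) :=
  P.mesh.facets.filter (fun F => i ∈ F ∧ F ∉ P.neumannFacets)

variable (P) in
open Classical in
/-- The elements of the patch of a node. -/
def patch (i : E d) : Finset (Finset (E d)) := P.mesh.elements.filter (fun K => i ∈ K)

variable (P rk φs uH i) in
open Classical in
/-- The right hand side of the patch system, once the Neumann facets are eliminated. -/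
def patchRhs (K : Finset (E d)) : ℝ := P.nodalResidual φs uH K i -
  ∑ F ∈ P.neumannFacets.filter (fun F => i ∈ F), P.incidence rk K F * P.projection φs P.g i F

/-- On Neumann facets the values are prescribed. Moving them to the right-hand side leaves the
unknowns on exactly the facets that enter the cost, in the form required by the abstract least
squares lemmas. -/
theorem patchSystem_iff (hd : 0 < d) : P.PatchSystem rk φs uH i b ↔
    (∀ K ∈ P.patch i, ∑ F ∈ P.patchFacets i, P.incidence rk K F * b F =
      P.patchRhs rk φs uH i K) ∧
    ∀ F ∈ P.neumannFacets, i ∈ F → b F = P.projection φs P.g i F := by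
  classical
  rw [PatchSystem]
  refine and_congr_left fun hN => ?_
  have key : ∀ K ∈ P.mesh.elements,
      ∑ F ∈ (K.powersetCard d).filter (fun F => i ∈ F), P.mesh.orient rk K F * b F =
        ∑ F ∈ P.patchFacets i, P.incidence rk K F * b F +
        ∑ F ∈ P.neumannFacets.filter (fun F => i ∈ F),
          P.incidence rk K F * P.projection φs P.g i F := by
    intro K hK
    have h1 : ∑ F ∈ P.neumannFacets.filter (fun F => i ∈ F),
          P.incidence rk K F * P.projection φs P.g i F =
        ∑ F ∈ P.neumannFacets.filter (fun F => i ∈ F), P.incidence rk K F * b F :=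
      Finset.sum_congr rfl fun F hF => by
        rw [hN F (Finset.mem_filter.1 hF).1 (Finset.mem_filter.1 hF).2]
    rw [h1, ← Finset.sum_union]
    · rw [Mesh.powersetCard_eq hd hK]
      have h2 : P.patchFacets i ∪ P.neumannFacets.filter (fun F => i ∈ F) =
          P.mesh.facets.filter (fun F => i ∈ F) := by
        ext F
        simp only [patchFacets, Finset.mem_union, Finset.mem_filter]
        constructor
        · rintro (h | h)
          · exact ⟨h.1, h.2.1⟩
          · exact ⟨Mesh.boundaryFacets_subset (mem_neumannFacets.1 h.1).1, h.2⟩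
        · rintro ⟨h, h'⟩
          by_cases hF : F ∈ P.neumannFacets
          · exact Or.inr ⟨hF, h'⟩
          · exact Or.inl ⟨h, h', hF⟩
      rw [h2, Finset.filter_filter]
      simp only [incidence, ite_mul, zero_mul]
      rw [Finset.sum_ite, Finset.sum_const_zero, add_zero, Finset.filter_filter]
      refine Finset.sum_congr ?_ fun _ _ => rfl
      ext F
      simp only [Finset.mem_filter]
      tauto
    · refine Finset.disjoint_left.2 fun F h h' => ?_
      exact (Finset.mem_filter.1 h).2.2 (Finset.mem_filter.1 h').1
  simp only [patch, Finset.mem_filter, patchRhs, and_imp]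
  refine forall_congr' fun K => forall_congr' fun hK => forall_congr' fun _ => ?_
  rw [key K hK, eq_sub_iff_add_eq]

theorem nodalResidual_eq (huH : P.mesh.MemBrokenH1 uH) {v : Field d} (hv : MemH1 P.mesh.Ω v)
    {K : Finset (E d)} (hK : K ∈ P.mesh.elements) :
    ∫ x in hull K, (⟪P.flux uH x, v.2 x⟫_ℝ - P.f x * v.1 x) =
      P.bilinOn (hull K) uH v - ∫ x in hull K, P.f x * v.1 x := by
  have h := Mesh.memH1_openHull hv hK
  rw [bilinOn, restrict_hull, ← integral_sub]
  · exact MemLp.integrable_inner_two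
      (P.memLp_flux (Mesh.openHull_subset_Ω hK) (huH K hK).memLp_grad) h.memLp_grad
  · exact MemLp.integrable_mul_two (Mesh.memLp_openHull P.f_memLp hK) h.memLp

theorem sum_nodalResidual (huH : P.mesh.MemBrokenH1 uH) {v : Field d} (hv : MemH1 P.mesh.Ω v) :
    ∑ K ∈ P.mesh.elements, ∫ x in hull K, (⟪P.flux uH x, v.2 x⟫_ℝ - P.f x * v.1 x) =
      P.brokenBilin uH v - ∫ x in P.mesh.Ω, P.f x * v.1 x := by
  rw [Mesh.integral_Ω (MemLp.integrable_mul_two P.f_memLp hv.memLp), brokenBilin,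
    ← Finset.sum_sub_distrib]
  exact Finset.sum_congr rfl fun K hK => nodalResidual_eq huH hv hK

/-- The residuals outside the patch vanish, so their sum is `B_H(u_H, φ_i) - ∫ f φ_i`, which the
discrete equation identifies with the Neumann work. The subtracted terms amount to the same work,
since a boundary facet has one element and orientation `+1`. -/
theorem sum_patchRhs (hd : 0 < d) (h : P.mesh.IsNodalBasis φs) (huH : P.mesh.MemBrokenH1 uH)
    (hi : i ∈ P.freeNodes) (hdisc : P.brokenBilin uH (φs i) = P.load (φs i)) :
    ∑ K ∈ P.patch i, P.patchRhs rk φs uH i K = 0 := by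
  classical
  have hv := h.memH1 i hi.1
  have h1 : ∑ K ∈ P.patch i, P.nodalResidual φs uH K i = P.neumannWork (φs i) := by
    have h2 := sum_nodalResidual huH hv
    rw [hdisc, load, add_sub_cancel_left] at h2
    rw [← h2, patch]
    refine Finset.sum_subset (Finset.filter_subset _ _) fun K hK hKi => ?_
    have hiK : i ∉ K := fun h' => hKi (Finset.mem_filter.2 ⟨hK, h'⟩)
    obtain ⟨e1, e2⟩ := h.eq_zero i hi.1 K hK hiK
    rw [nodalResidual, restrict_hull, integral_congr_ae (g := fun _ => (0 : ℝ)), integral_zero]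
    filter_upwards [e1, e2] with x hx1 hx2
    simp [hx1, hx2]
  have h2 : P.neumannWork (φs i) =
      ∑ F ∈ P.neumannFacets.filter (fun F => i ∈ F), P.projection φs P.g i F := by
    rw [neumannWork]
    refine (Finset.sum_subset (Finset.filter_subset _ _) fun F hF hFi => ?_).symm
    have hiF : i ∉ F := fun h' => hFi (Finset.mem_filter.2 ⟨hF, h'⟩)
    have e := h.facetTrace_of_notMem hd
      (Mesh.boundaryFacets_subset (mem_neumannFacets.1 hF).1) hi.1 hiF
    rw [integral_congr_ae (g := fun _ => (0 : ℝ)), integral_zero]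
    filter_upwards [e] with x hx
    simp [hx]
  simp only [patchRhs]
  rw [Finset.sum_sub_distrib, h1, h2, Finset.sum_comm, sub_eq_zero]
  refine Finset.sum_congr rfl fun F hF => ?_
  rw [← Finset.sum_mul]
  obtain ⟨hFN, hiF⟩ := Finset.mem_filter.1 hF
  have hFb := (mem_neumannFacets.1 hFN).1
  obtain ⟨K, hK, hFK⟩ := Mesh.exists_element_of_facet (Mesh.boundaryFacets_subset hFb)
  have h3 : ∑ L ∈ P.patch i, P.incidence rk L F = 1 := by
    rw [← Mesh.orient_boundary (rk := rk) hFb hK hFK,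
      ← Mesh.sum_boundary (a := fun K => P.mesh.orient rk K F) hFb hK hFK]
    simp only [incidence, patch]
    rw [Finset.sum_ite, Finset.sum_const_zero, add_zero, Finset.filter_filter]
    refine Finset.sum_congr ?_ fun _ _ => rfl
    ext L
    simp only [Finset.mem_filter]
    exact ⟨fun h => ⟨h.1, h.2.2⟩, fun h => ⟨h.1, h.2 hiF, h.2⟩⟩
  rw [h3, one_mul]

/-- This is the Fredholm condition of the patch system. The equations of interior facets force the
multiplier `l` to be constant on the connected patch; then either the right-hand sides sum to zero,
or a Dirichlet facet, whose column has a single nonzero entry, forces the constant to vanish. -/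
theorem patch_compatible (hd : 0 < d)
    (hrk : Set.InjOn rk (P.mesh.elements : Set (Finset (E d)))) (h : P.mesh.IsNodalBasis φs)
    (huH : P.mesh.MemBrokenH1 uH) (hi : i ∈ P.mesh.nodes)
    (hdisc : i ∈ P.freeNodes → P.brokenBilin uH (φs i) = P.load (φs i))
    (l : Finset (E d) → ℝ)
    (hl : ∀ F ∈ P.patchFacets i, ∑ K ∈ P.patch i, l K * P.incidence rk K F = 0) :
    ∑ K ∈ P.patch i, l K * P.patchRhs rk φs uH i K = 0 := by
  classical
  have hsum : ∀ F, i ∈ F → ∑ K ∈ P.patch i, l K * P.incidence rk K F =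
      ∑ K ∈ P.mesh.elements.filter (fun K => F ⊆ K), l K * P.mesh.orient rk K F := by
    intro F hiF
    simp only [incidence, patch, mul_ite, mul_zero]
    rw [Finset.sum_ite, Finset.sum_const_zero, add_zero, Finset.filter_filter]
    refine Finset.sum_congr ?_ fun _ _ => rfl
    ext L
    simp only [Finset.mem_filter]
    exact ⟨fun h => ⟨h.1, h.2.2⟩, fun h => ⟨h.1, h.2 hiF, h.2⟩⟩
  have hstep : ∀ K ∈ P.mesh.elements, ∀ L ∈ P.mesh.elements, ∀ F : Finset (E d), F.card = d →
      i ∈ F → F ⊆ K → F ⊆ L → l K = l L := by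
    intro K hK L hL F hF hiF hFK hFL
    by_cases hKL : K = L
    · rw [hKL]
    have hFf := Mesh.mem_facets_of_subset hd hK hF hFK
    have hFN : F ∉ P.neumannFacets := fun h =>
      hKL (Mesh.eq_of_boundary (mem_neumannFacets.1 h).1 hK hL hFK hFL)
    have h1 := hl F (Finset.mem_filter.2 ⟨hFf, hiF, hFN⟩)
    rw [hsum F hiF, Mesh.sum_interior hd hF hK hL hFK hFL hKL] at h1
    have h2 := Mesh.orient_add hd hrk hF hK hL hFK hFL hKL
    have h3 : P.mesh.orient rk K F * (l K - l L) = 0 := by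
      linear_combination h1 - l L * h2
    exact sub_eq_zero.1 ((mul_eq_zero.1 h3).resolve_left Mesh.orient_ne_zero)
  have hconst : ∀ K ∈ P.patch i, ∀ L ∈ P.patch i, l K = l L := by
    intro K hK L hL
    obtain ⟨hK, hiK⟩ := Finset.mem_filter.1 hK
    obtain ⟨hL, hiL⟩ := Finset.mem_filter.1 hL
    obtain ⟨hK1, hK2⟩ := (Mesh.mem_elements P.mesh).1 hK
    obtain ⟨hL1, hL2⟩ := (Mesh.mem_elements P.mesh).1 hL
    have hch := P.mesh.patch_connected i K hK1 L hL1 hK2 hL2 hiK hiL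
    clear hL hiL hL1 hL2
    induction hch with
    | refl => rfl
    | tail _ hst ih =>
      obtain ⟨m1, m2, c1, c2, F, hF, hiF, hF1, hF2⟩ := hst
      rw [ih (Finset.mem_filter.2 ⟨(Mesh.mem_elements P.mesh).2 ⟨m1, c1⟩, hF1 hiF⟩)]
      exact hstep _ ((Mesh.mem_elements P.mesh).2 ⟨m1, c1⟩) _
        ((Mesh.mem_elements P.mesh).2 ⟨m2, c2⟩) F hF hiF hF1 hF2
  obtain ⟨K0, hK0, hiK0⟩ := hi
  have hK0p : K0 ∈ P.patch i := Finset.mem_filter.2 ⟨hK0, hiK0⟩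
  rw [Finset.sum_congr rfl fun K hK => by rw [hconst K hK K0 hK0p], ← Finset.mul_sum]
  by_cases hfree : i ∈ P.freeNodes
  · rw [sum_patchRhs hd h huH hfree (hdisc hfree), mul_zero]
  · have : ∃ F ∈ P.D, i ∈ F := by
      by_contra! hne
      exact hfree ⟨⟨K0, hK0, hiK0⟩, hne⟩
    obtain ⟨F, hFD, hiF⟩ := this
    have hFb := P.D_subset hFD
    obtain ⟨K, hK, hFK⟩ := Mesh.exists_element_of_facet (Mesh.boundaryFacets_subset hFb)
    have h1 := hl F (Finset.mem_filter.2 ⟨Mesh.boundaryFacets_subset hFb, hiF,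
      fun h => (mem_neumannFacets.1 h).2 hFD⟩)
    rw [hsum F hiF, Mesh.sum_boundary hFb hK hFK] at h1
    have h2 := (mul_eq_zero.1 h1).resolve_right Mesh.orient_ne_zero
    rw [hconst K0 hK0p K (Finset.mem_filter.2 ⟨hK, hFK hiF⟩), h2, zero_mul]

theorem exists_patch_minimizer (hd : 0 < d)
    (hrk : Set.InjOn rk (P.mesh.elements : Set (Finset (E d)))) (h : P.mesh.IsNodalBasis φs)
    (huH : P.mesh.MemBrokenH1 uH) (hi : i ∈ P.mesh.nodes)
    (hdisc : i ∈ P.freeNodes → P.brokenBilin uH (φs i) = P.load (φs i)) (m : E d → ℝ) :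
    ∃ b, P.PatchSystem rk φs uH i b ∧
      ∀ b', P.PatchSystem rk φs uH i b' → P.patchCost φs m i b ≤ P.patchCost φs m i b' := by
  classical
  have hw : ∀ F ∈ P.patchFacets i, 0 < (surf d).real (hull F) := by
    intro F hF
    have hFf := (Finset.mem_filter.1 hF).1
    obtain ⟨K, hK, hFK⟩ := Mesh.exists_element_of_facet hFf
    obtain ⟨p, hp, rfl⟩ := Mesh.exists_eq_erase ((Mesh.mem_facets _).1 hFf).2 hK hFK
    exact (P.mesh.isSimplex hK).real_surf_facet_pos hd hp
  obtain ⟨b, hb, hmin⟩ := exists_least_squares (P.patch i) (P.patchFacets i) (P.incidence rk)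
    (P.patchRhs rk φs uH i) (fun F => (surf d).real (hull F)) (P.projection φs m i) hw
    (exists_solution_of_dual _ _ _ _ (patch_compatible hd hrk h huH hi hdisc))
  -- A solution of the reduced system is completed by the prescribed Neumann values; the cost does
  -- not see them.
  set c : Finset (E d) → ℝ := fun F => if F ∈ P.neumannFacets then P.projection φs P.g i F else b F
    with hc
  have hcb : ∀ F ∈ P.patchFacets i, c F = b F := fun F hF => by
    rw [hc]
    exact if_neg (Finset.mem_filter.1 hF).2.2
  refine ⟨c, (patchSystem_iff hd).2 ⟨fun K hK => ?_, fun F hF _ => ?_⟩, fun b' hb' => ?_⟩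
  · rw [← hb K hK]
    exact Finset.sum_congr rfl fun F hF => by rw [hcb F hF]
  · rw [hc]
    exact if_pos hF
  · refine le_trans (le_of_eq ?_) (hmin b' ((patchSystem_iff hd).1 hb').1)
    exact Finset.sum_congr rfl fun F hF => by rw [hcb F hF]

theorem patch_minimizer_unique (hd : 0 < d) (m : E d → ℝ) {b' : Finset (E d) → ℝ}
    (hb : P.PatchSystem rk φs uH i b) (hb' : P.PatchSystem rk φs uH i b')
    (hmin : ∀ c, P.PatchSystem rk φs uH i c → P.patchCost φs m i b ≤ P.patchCost φs m i c)
    (hmin' : ∀ c, P.PatchSystem rk φs uH i c → P.patchCost φs m i b' ≤ P.patchCost φs m i c)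
    {F : Finset (E d)} (hF : F ∈ P.mesh.facets) (hFN : F ∉ P.neumannFacets) (hiF : i ∈ F) :
    b F = b' F := by
  classical
  have hw : ∀ F ∈ P.patchFacets i, 0 < (surf d).real (hull F) := by
    intro F hF
    have hFf := (Finset.mem_filter.1 hF).1
    obtain ⟨K, hK, hFK⟩ := Mesh.exists_element_of_facet hFf
    obtain ⟨p, hp, rfl⟩ := Mesh.exists_eq_erase ((Mesh.mem_facets _).1 hFf).2 hK hFK
    exact (P.mesh.isSimplex hK).real_surf_facet_pos hd hp
  -- Minimality is given among solutions of the full system, whereas the uniqueness lemma compares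
  -- solutions of the reduced one. Every competitor is therefore completed on the Neumann facets at
  -- equal cost.
  have hext : ∀ c₀ : Finset (E d) → ℝ, (∀ K ∈ P.patch i, ∑ F ∈ P.patchFacets i,
      P.incidence rk K F * c₀ F = P.patchRhs rk φs uH i K) → ∃ c, P.PatchSystem rk φs uH i c ∧
      P.patchCost φs m i c = P.patchCost φs m i c₀ := by
    intro c₀ hc₀
    set c : Finset (E d) → ℝ := fun F =>
      if F ∈ P.neumannFacets then P.projection φs P.g i F else c₀ F with hc
    have hcb : ∀ F ∈ P.patchFacets i, c F = c₀ F := fun F hF => by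
      rw [hc]
      exact if_neg (Finset.mem_filter.1 hF).2.2
    refine ⟨c, (patchSystem_iff hd).2 ⟨fun K hK => ?_, fun F hF _ => ?_⟩, ?_⟩
    · rw [← hc₀ K hK]
      exact Finset.sum_congr rfl fun F hF => by rw [hcb F hF]
    · rw [hc]
      exact if_pos hF
    · exact Finset.sum_congr rfl fun F hF => by rw [hcb F hF]
  refine eq_of_least_squares (P.patch i) (P.patchFacets i) (P.incidence rk)
    (P.patchRhs rk φs uH i) (fun F => (surf d).real (hull F)) (P.projection φs m i) hw
    ((patchSystem_iff hd).1 hb).1 ((patchSystem_iff hd).1 hb').1 (fun c₀ hc₀ => ?_)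
    (fun c₀ hc₀ => ?_) F (Finset.mem_filter.2 ⟨hF, hiF, hFN⟩)
  · obtain ⟨c, h1, h2⟩ := hext c₀ hc₀
    exact (hmin c h1).trans_eq h2
  · obtain ⟨c, h1, h2⟩ := hext c₀ hc₀
    exact (hmin' c h1).trans_eq h2

end Problem

end

section

/-! ### The construction of the tractions -/

namespace Mesh

variable {T : Mesh d} {φs : E d → Field d} {F : Finset (E d)}

theorem isFiniteMeasure_restrict_facet (hd : 0 < d) (hF : F ∈ T.facets) :
    IsFiniteMeasure ((surf d).restrict (hull F)) := by
  obtain ⟨K, hK, hFK⟩ := exists_element_of_facet hF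
  obtain ⟨p, hp, rfl⟩ := exists_eq_erase ((mem_facets _).1 hF).2 hK hFK
  exact (T.isSimplex hK).isFiniteMeasure_facet hd hp

theorem node_of_mem_facet (hF : F ∈ T.facets) {i : E d} (hi : i ∈ F) : i ∈ T.nodes := by
  obtain ⟨K, hK, hFK⟩ := exists_element_of_facet hF
  exact ⟨K, hK, hFK hi⟩

/-- Distinct facets meet in the hull of fewer than `d` vertices, a null set, so functions chosen
facet by facet define a single one up to null sets. -/
theorem exists_glue {X : Type*} (G : Finset (E d) → E d → X) [Inhabited X] :
    ∃ g : E d → X, ∀ F ∈ T.facets, g =ᵐ[(surf d).restrict (hull F)] G F := by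
  classical
  refine ⟨fun x => if h : ∃ F ∈ T.facets, x ∈ hull F then G h.choose x else default,
    fun F hF => ?_⟩
  have hnull : surf d (⋃ F' ∈ T.facets.erase F, hull F ∩ hull F') = 0 := by
    refine (measure_biUnion_null_iff (T.facets.erase F).countable_toSet).2 fun F' hF' => ?_
    obtain ⟨hne, hF'⟩ := Finset.mem_erase.1 hF'
    obtain ⟨h1, h2⟩ := (mem_facets T).1 hF
    obtain ⟨h1', h2'⟩ := (mem_facets T).1 hF'
    rw [T.hull_inter h1 h1']
    refine surf_hull_eq_zero ?_
    refine (Finset.card_lt_card ?_).trans_eq h2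
    refine (Finset.ssubset_iff_subset_ne.2 ⟨Finset.inter_subset_left, ?_⟩)
    intro e
    have h3 : F ⊆ F' := Finset.inter_eq_left.1 e
    exact hne (Finset.eq_of_subset_of_card_le h3 (by rw [h2, h2'])).symm
  rw [Filter.EventuallyEq, ae_restrict_iff' (measurableSet_hull F)]
  filter_upwards [measure_eq_zero_iff_ae_notMem.1 hnull] with x hx hxF
  have h : ∃ F ∈ T.facets, x ∈ hull F := ⟨F, hF, hxF⟩
  rw [dif_pos h]
  have e : h.choose = F := by
    by_contra hne
    exact hx (Set.mem_biUnion (Finset.mem_coe.2 (Finset.mem_erase.2 ⟨hne, h.choose_spec.1⟩))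
      ⟨hxF, h.choose_spec.2⟩)
  rw [e]

namespace IsNodalBasis

variable (h : T.IsNodalBasis φs)
include h

theorem memLp_facetTrace (hd : 0 < d) (hF : F ∈ T.facets) {i : E d} (hi : i ∈ F) :
    MemLp (T.facetTrace F (φs i)) 2 ((surf d).restrict (hull F)) :=
  Mesh.memLp_facetTrace hd hF (h.memH1 i (node_of_mem_facet hF hi))

theorem memLp_facet_sum (hd : 0 < d) (hF : F ∈ T.facets) (a : E d → ℝ) :
    MemLp (fun x => ∑ j ∈ F, a j * T.facetTrace F (φs j) x) 2 ((surf d).restrict (hull F)) :=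
  memLp_finsetSum F fun j hj => (h.memLp_facetTrace hd hF hj).const_mul (a j)

theorem integral_facet_sum (hd : 0 < d) (hF : F ∈ T.facets) (a : E d → ℝ) {i : E d} (hi : i ∈ F) :
    ∫ x in hull F, (∑ j ∈ F, a j * T.facetTrace F (φs j) x) * T.facetTrace F (φs i) x ∂(surf d) =
      ∑ j ∈ F, a j * ∫ x in hull F,
        T.facetTrace F (φs j) x * T.facetTrace F (φs i) x ∂(surf d) := by
  simp only [Finset.sum_mul, mul_assoc]
  rw [integral_finsetSum]
  · simp only [integral_const_mul]
  · intro j hj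
    exact (MemLp.integrable_mul_two (h.memLp_facetTrace hd hF hj)
      (h.memLp_facetTrace hd hF hi)).const_mul (a j)

/-- Injectivity of the facet mass matrix: a combination orthogonal to every trace is orthogonal to
itself, hence zero almost everywhere. It is affine on the facet, so its vertex values, the
coefficients, vanish. -/
theorem coeff_eq_zero (hd : 0 < d) (hF : F ∈ T.facets) {a : E d → ℝ}
    (ha : ∀ i ∈ F, ∫ x in hull F, (∑ j ∈ F, a j * T.facetTrace F (φs j) x) *
      T.facetTrace F (φs i) x ∂(surf d) = 0) : ∀ i ∈ F, a i = 0 := by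
  classical
  obtain ⟨K, hK, hFK⟩ := exists_element_of_facet hF
  have hc := ((mem_facets T).1 hF).2
  have sK := T.isSimplex hK
  obtain ⟨p, hp, hFp⟩ := exists_eq_erase hc hK hFK
  set S : E d → ℝ := fun x => ∑ j ∈ F, a j * T.facetTrace F (φs j) x with hS
  have mS : MemLp S 2 ((surf d).restrict (hull F)) := h.memLp_facet_sum hd hF a
  have h0 : ∫ x in hull F, S x ^ 2 ∂(surf d) = 0 := by
    have e : ∀ x, S x ^ 2 = ∑ i ∈ F, a i * (S x * T.facetTrace F (φs i) x) := by
      intro x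
      rw [sq]
      conv_lhs => rw [hS, Finset.mul_sum]
      exact Finset.sum_congr rfl fun i _ => by ring
    simp only [e]
    rw [integral_finsetSum _ fun i hi => (MemLp.integrable_mul_two mS
      (h.memLp_facetTrace hd hF hi)).const_mul (a i)]
    refine Finset.sum_eq_zero fun i hi => ?_
    rw [integral_const_mul, ha i hi, mul_zero]
  rw [integral_eq_zero_iff_of_nonneg (fun x => sq_nonneg _) mS.integrable_sq] at h0
  set A : E d →ᵃ[ℝ] ℝ := ∑ j ∈ F, a j • lam K j with hA
  have hAx : ∀ x, A x = ∑ j ∈ F, a j * lam K j x := by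
    intro x
    rw [hA]
    have : ∀ s : Finset (E d), (∑ j ∈ s, a j • lam K j) x = ∑ j ∈ s, a j * lam K j x := by
      intro s
      induction s using Finset.induction_on with
      | empty => simp
      | insert j s hj ih => rw [Finset.sum_insert hj, Finset.sum_insert hj, ← ih]; simp
    exact this F
  have hAe : ∀ᵐ x ∂((surf d).restrict (hull F)), A x = 0 := by
    have hl := (Finset.eventually_all F).2 fun j hj => h.facetTrace_of_mem hd hK hc hFK hj
    filter_upwards [h0, hl] with x hx hx2
    have h3 : S x ^ 2 = 0 := hx
    have h4 : S x = A x := by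
      rw [hAx]
      exact Finset.sum_congr rfl fun j hj => by rw [hx2 j hj]
    rw [← h4]
    simpa using h3
  intro i hi
  rw [hFp] at hAe
  have h2 := sK.eq_zero_of_ae_facet hd hp A hAe (hFp ▸ hi)
  rw [hAx, Finset.sum_eq_single i] at h2
  · rwa [sK.lam_self (hFK hi), mul_one] at h2
  · intro j hj hji
    rw [sK.lam_ne (hFK hj) (hFK hi) (Ne.symm hji), mul_zero]
  · exact fun h => absurd hi h

/-- The mass matrix is symmetric, so its injectivity is precisely the dual solvability condition. -/
theorem exists_coeff (hd : 0 < d) (hF : F ∈ T.facets) {m : E d → ℝ}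
    (hm : MemLp m 2 ((surf d).restrict (hull F))) (b : E d → ℝ) : ∃ a : E d → ℝ, ∀ i ∈ F,
      ∫ x in hull F, (m x + ∑ j ∈ F, a j * T.facetTrace F (φs j) x) *
        T.facetTrace F (φs i) x ∂(surf d) = b i := by
  obtain ⟨a, ha⟩ := exists_solution_of_dual F F (fun i j => ∫ x in hull F,
      T.facetTrace F (φs j) x * T.facetTrace F (φs i) x ∂(surf d))
    (fun i => b i - ∫ x in hull F, m x * T.facetTrace F (φs i) x ∂(surf d)) (by
      intro l hl
      have := h.coeff_eq_zero hd hF (a := l) (fun j hj => by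
        rw [h.integral_facet_sum hd hF l hj, ← hl j hj]
        refine Finset.sum_congr rfl fun i _ => ?_
        simp only [mul_comm])
      exact Finset.sum_eq_zero fun i hi => by rw [this i hi, zero_mul])
  refine ⟨a, fun i hi => ?_⟩
  have h1 := ha i hi
  simp only [add_mul]
  rw [integral_add (MemLp.integrable_mul_two hm (h.memLp_facetTrace hd hF hi))
    (MemLp.integrable_mul_two (h.memLp_facet_sum hd hF a) (h.memLp_facetTrace hd hF hi)),
    h.integral_facet_sum hd hF a hi]
  rw [Finset.sum_congr rfl fun j _ => mul_comm (a j) _, h1]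
  ring

end IsNodalBasis

end Mesh

namespace Problem

variable {P : Problem d} {rk : Finset (E d) → ℕ} {φs : E d → Field d} {uH : Field d}
  {m : E d → ℝ}

theorem projection_congr {g g' : E d → ℝ} {F : Finset (E d)}
    (h : g =ᵐ[(surf d).restrict (hull F)] g') (i : E d) :
    P.projection φs g i F = P.projection φs g' i F := by
  refine integral_congr_ae ?_
  filter_upwards [h] with x hx
  rw [hx]

theorem exists_isBuiltTraction (hd : 0 < d)
    (hrk : Set.InjOn rk (P.mesh.elements : Set (Finset (E d)))) (h : P.mesh.IsNodalBasis φs)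
    (huH : P.mesh.MemBrokenH1 uH)
    (hdisc : ∀ i ∈ P.freeNodes, P.brokenBilin uH (φs i) = P.load (φs i))
    (hm : ∀ F ∈ P.mesh.facets, MemLp m 2 ((surf d).restrict (hull F))) :
    ∃ ghat, P.IsBuiltTraction rk φs uH m ghat := by
  classical
  choose! b hb using fun i (hi : i ∈ P.mesh.nodes) =>
    exists_patch_minimizer hd hrk h huH hi (hdisc i) m
  choose! a ha using fun F (hF : F ∈ P.mesh.facets) =>
    h.exists_coeff hd hF (hm F hF) (fun i => b i F)
  obtain ⟨ghat, hg⟩ := P.mesh.exists_glue fun F x => if F ∈ P.neumannFacets then P.g x else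
    m x + ∑ j ∈ F, a F j * P.mesh.facetTrace F (φs j) x
  refine ⟨ghat, b, fun i F => a F i, hb, fun F hF => ?_, fun F hF hFN => ?_⟩
  · have := hg F (Mesh.boundaryFacets_subset (mem_neumannFacets.1 hF).1)
    simpa only [if_pos hF] using this
  · have h1 := hg F hF
    simp only [if_neg hFN] at h1
    refine ⟨h1, fun i hi => ?_⟩
    rw [projection_congr h1]
    exact ha F hF i hi

/-- Strict convexity fixes the projections `b`. The difference of two coefficient vectors is then in
the kernel of the mass matrix of the facet. -/
theorem isBuiltTraction_unique (hd : 0 < d) (h : P.mesh.IsNodalBasis φs)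
    (hm : ∀ F ∈ P.mesh.facets, MemLp m 2 ((surf d).restrict (hull F))) {ghat ghat' : E d → ℝ}
    (hg : P.IsBuiltTraction rk φs uH m ghat) (hg' : P.IsBuiltTraction rk φs uH m ghat')
    {F : Finset (E d)} (hF : F ∈ P.mesh.facets) :
    ghat =ᵐ[(surf d).restrict (hull F)] ghat' := by
  obtain ⟨b, a, h1, h2, h3⟩ := hg
  obtain ⟨b', a', h1', h2', h3'⟩ := hg'
  by_cases hFN : F ∈ P.neumannFacets
  · exact (h2 F hFN).trans (h2' F hFN).symm
  obtain ⟨e1, e2⟩ := h3 F hF hFN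
  obtain ⟨e1', e2'⟩ := h3' F hF hFN
  have hz : ∀ i ∈ F, (a i F - a' i F) = 0 := by
    refine h.coeff_eq_zero hd hF (a := fun i => a i F - a' i F) fun i hi => ?_
    have hin := Mesh.node_of_mem_facet hF hi
    have hbb : b i F = b' i F := patch_minimizer_unique hd m (h1 i hin).1 (h1' i hin).1
      (h1 i hin).2 (h1' i hin).2 hF hFN hi
    have k := e2 i hi
    have k' := e2' i hi
    rw [projection_congr e1] at k
    rw [projection_congr e1', ← hbb, ← k] at k'
    simp only [projection] at k'
    have mi := h.memLp_facetTrace hd hF hi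
    have j1 := MemLp.integrable_mul_two
      ((hm F hF).add (h.memLp_facet_sum hd hF fun i => a i F)) mi
    have j2 := MemLp.integrable_mul_two
      ((hm F hF).add (h.memLp_facet_sum hd hF fun i => a' i F)) mi
    simp only [Pi.add_apply] at j1 j2
    rw [← sub_eq_zero.2 k'.symm, ← integral_sub j1 j2]
    refine integral_congr_ae (ae_of_all _ fun x => ?_)
    simp only [sub_mul, Finset.sum_sub_distrib]
    ring
  filter_upwards [e1, e1'] with x hx hx'
  rw [hx, hx']
  congr 1
  exact Finset.sum_congr rfl fun i hi => by rw [sub_eq_zero.1 (hz i hi)]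

/-- The test function of a node has zero trace on the facets without that node, so the work over the
element boundary is the left-hand side of the patch system of that node. -/
theorem IsBuiltTraction.isProlongation (hd : 0 < d) (h : P.mesh.IsNodalBasis φs)
    (hm : ∀ F ∈ P.mesh.facets, MemLp m 2 ((surf d).restrict (hull F))) {ghat : E d → ℝ}
    (hg : P.IsBuiltTraction rk φs uH m ghat) : P.IsProlongation rk φs uH ghat := by
  classical
  obtain ⟨b, a, h1, h2, h3⟩ := hg
  refine ⟨fun F hF => ?_, h2, fun K hK i hi => ?_⟩
  · by_cases hFN : F ∈ P.neumannFacets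
    · exact (memLp_congr_ae (h2 F hFN)).2 (memLp_g hFN)
    · exact (memLp_congr_ae (h3 F hF hFN).1).2
        ((hm F hF).add (h.memLp_facet_sum hd hF fun i => a i F))
  · have hin : i ∈ P.mesh.nodes := ⟨K, hK, hi⟩
    have hS := (h1 i hin).1
    rw [← hS.1 K hK hi, Mesh.tractionWork, Finset.sum_filter]
    refine Finset.sum_congr rfl fun F hF => ?_
    obtain ⟨hFK, hc⟩ := Finset.mem_powersetCard.1 hF
    have hFf := Mesh.mem_facets_of_subset hd hK hc hFK
    split_ifs with hiF
    · congr 1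
      have e := Mesh.facetTrace_eq_trace hd hK hc hFK (h.memH1 i hin)
      have e1 : ∫ x in hull F, ghat x * trace K (φs i) x ∂(surf d) =
          P.projection φs ghat i F := by
        refine integral_congr_ae ?_
        filter_upwards [e] with x hx
        rw [hx]
      rw [e1]
      by_cases hFN : F ∈ P.neumannFacets
      · rw [projection_congr (h2 F hFN), hS.2 F hFN hiF]
      · exact (h3 F hFf hFN).2 i hiF
    · have e := h.trace_of_notMem hd hK hc hFK hin hiF
      rw [integral_congr_ae (g := fun _ => (0 : ℝ)), integral_zero, mul_zero]
      filter_upwards [e] with x hx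
      simp [hx]

end Problem

end

section

/-! ### The work of tractions on an element -/

theorem abs_integral_mul_le {X : Type*} [MeasurableSpace X] {μ : Measure X} {f g : X → ℝ}
    (hf : MemLp f 2 μ) (hg : MemLp g 2 μ) :
    |∫ x, f x * g x ∂μ| ≤ (eLpNorm f 2 μ).toReal * (eLpNorm g 2 μ).toReal := by
  have h := norm_inner_le_norm (𝕜 := ℝ) hg.toLp hf.toLp
  rw [inner_toLp_eq_integral, Lp.norm_toLp, Lp.norm_toLp, mul_comm] at h
  exact h

namespace Mesh

variable {T : Mesh d} {rk : Finset (E d) → ℕ} {ghat : E d → ℝ} {K : Finset (E d)} {v w : Field d}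

theorem tractionWork_eq (hd : 0 < d) (hK : K ∈ T.elements) (hv : MemH1 (openHull K) v)
    {τ : E d → ℝ} (hτ : IsTrace K v τ) : T.tractionWork rk ghat K v =
      ∑ F ∈ K.powersetCard d, T.orient rk K F * ∫ x in hull F, ghat x * τ x ∂(surf d) := by
  refine Finset.sum_congr rfl fun F hF => ?_
  obtain ⟨hFK, hc⟩ := Finset.mem_powersetCard.1 hF
  obtain ⟨p, hp, rfl⟩ := exists_eq_erase hc hK hFK
  congr 1
  refine integral_congr_ae ?_
  filter_upwards [IsTrace.ae_eq_facet hd (T.isSimplex hK) hv hτ hp] with x hx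
  rw [hx]

theorem tractionWork_const (hd : 0 < d) (hK : K ∈ T.elements) (c : ℝ) :
    T.tractionWork rk ghat K ((fun _ => c, fun _ => 0) : Field d) =
      T.tractionResultant rk ghat K * c := by
  have h1 := (T.isSimplex hK).isTrace_of_contDiff hd (contDiff_const (c := c))
  have e : gradient (fun _ : E d => c) = fun _ => 0 := by
    ext1 x; simp [gradient]
  rw [e] at h1
  rw [tractionWork_eq hd hK (memH1_const (isBounded_openHull K) c) h1, tractionResultant,
    Finset.sum_mul]
  exact Finset.sum_congr rfl fun F _ => by rw [integral_mul_const, mul_assoc]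

theorem tractionWork_of_memH10 (hd : 0 < d) (hK : K ∈ T.elements) (hv : MemH10 (openHull K) v) :
    T.tractionWork rk ghat K v = 0 := by
  rw [tractionWork_eq hd hK hv.1 hv.isTrace_zero]
  simp

theorem tractionWork_smul (hd : 0 < d) (hK : K ∈ T.elements) (hv : MemH1 (openHull K) v) (c : ℝ) :
    T.tractionWork rk ghat K (c • v) = c * T.tractionWork rk ghat K v := by
  have hτ := (T.isSimplex hK).isTrace_trace hd hv
  rw [tractionWork_eq hd hK (hv.smul c) (hτ.const_smul c), tractionWork_eq hd hK hv hτ,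
    Finset.mul_sum]
  refine Finset.sum_congr rfl fun F _ => ?_
  rw [mul_left_comm, ← integral_const_mul c]
  simp only [mul_left_comm c]

variable (hg : ∀ F ∈ T.facets, MemLp ghat 2 ((surf d).restrict (hull F)))
include hg

theorem tractionWork_add (hd : 0 < d) (hK : K ∈ T.elements) (hv : MemH1 (openHull K) v)
    (hw : MemH1 (openHull K) w) : T.tractionWork rk ghat K (v + w) =
      T.tractionWork rk ghat K v + T.tractionWork rk ghat K w := by
  have sK := T.isSimplex hK
  have hτ := sK.isTrace_trace hd hv
  have hσ := sK.isTrace_trace hd hw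
  rw [tractionWork_eq hd hK (hv.add hw) (IsTrace.add hv hw hτ hσ), tractionWork, tractionWork,
    ← Finset.sum_add_distrib]
  refine Finset.sum_congr rfl fun F hF => ?_
  obtain ⟨hFK, hc⟩ := Finset.mem_powersetCard.1 hF
  have mg := hg F (mem_facets_of_subset hd hK hc hFK)
  obtain ⟨p, hp, rfl⟩ := exists_eq_erase hc hK hFK
  rw [← mul_add, ← integral_add (MemLp.integrable_mul_two mg (sK.memLp_trace_facet hd hv hp))
    (MemLp.integrable_mul_two mg (sK.memLp_trace_facet hd hw hp))]
  simp only [mul_add]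

theorem exists_tractionWork_le (hd : 0 < d) (hK : K ∈ T.elements) :
    ∃ C : ℝ, 0 ≤ C ∧ ∀ v : Field d, MemH1 (openHull K) v → |T.tractionWork rk ghat K v| ≤
      C * ((eLpNorm v.1 2 (volume.restrict (openHull K))).toReal +
        (eLpNorm v.2 2 (volume.restrict (openHull K))).toReal) := by
  have sK := T.isSimplex hK
  obtain ⟨C, hC, h⟩ := sK.eLpNorm_trace_le hd
  refine ⟨∑ F ∈ K.powersetCard d, (eLpNorm ghat 2 ((surf d).restrict (hull F))).toReal * C.toReal,
    by positivity, fun v hv => ?_⟩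
  rw [Finset.sum_mul]
  refine (Finset.abs_sum_le_sum_abs _ _).trans (Finset.sum_le_sum fun F hF => ?_)
  obtain ⟨hFK, hc⟩ := Finset.mem_powersetCard.1 hF
  have mg := hg F (mem_facets_of_subset hd hK hc hFK)
  obtain ⟨p, hp, rfl⟩ := exists_eq_erase hc hK hFK
  have hor : |T.orient rk K (K.erase p)| = 1 := by
    rw [orient]
    split_ifs <;> norm_num
  rw [abs_mul, hor, one_mul]
  refine (abs_integral_mul_le mg (sK.memLp_trace_facet hd hv hp)).trans ?_
  rw [mul_assoc]
  refine mul_le_mul_of_nonneg_left ?_ ENNReal.toReal_nonneg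
  have h1 := (eLpNorm_mono_measure (p := 2) (trace K v) (sK.restrict_facet_le hp)).trans
    (h v _ hv (sK.isTrace_trace hd hv))
  have hfin : eLpNorm v.1 2 (volume.restrict (openHull K)) +
      eLpNorm v.2 2 (volume.restrict (openHull K)) ≠ ⊤ :=
    ENNReal.add_ne_top.2 ⟨hv.memLp.2.ne, hv.memLp_grad.2.ne⟩
  have h2 := ENNReal.toReal_mono (ENNReal.mul_ne_top hC hfin) h1
  rwa [ENNReal.toReal_mul, ENNReal.toReal_add hv.memLp.2.ne hv.memLp_grad.2.ne] at h2

end Mesh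

namespace Problem

variable {P : Problem d} {rk : Finset (E d) → ℕ} {φs : E d → Field d} {uH : Field d}
  {ghat : E d → ℝ} {K : Finset (E d)}

/-- Sum the prolongation conditions over the vertices. The traces add up to one, giving the
resultant; inside the element the values add up to one and the gradients to zero, so only `-∫ f`
remains. -/
theorem IsProlongation.equilibrium (hd : 0 < d) (h : P.mesh.IsNodalBasis φs)
    (huH : P.mesh.MemBrokenH1 uH) (hg : P.IsProlongation rk φs uH ghat)
    (hK : K ∈ P.mesh.elements) :
    (∫ x in hull K, P.f x) + P.mesh.tractionResultant rk ghat K = 0 := by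
  have sK := P.mesh.isSimplex hK
  have hn : ∀ i ∈ K, i ∈ P.mesh.nodes := fun i hi => ⟨K, hK, hi⟩
  have hH : ∀ i ∈ K, MemH1 (openHull K) (φs i) := fun i hi =>
    Mesh.memH1_openHull (h.memH1 i (hn i hi)) hK
  have h1 : ∑ i ∈ K, P.mesh.tractionWork rk ghat K (φs i) =
      P.mesh.tractionResultant rk ghat K := by
    rw [Finset.sum_congr rfl fun i hi => Mesh.tractionWork_eq (rk := rk) (ghat := ghat) hd hK
      (hH i hi) (h.isTrace K hK i hi), Finset.sum_comm, Mesh.tractionResultant]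
    refine Finset.sum_congr rfl fun F hF => ?_
    obtain ⟨hFK, hc⟩ := Finset.mem_powersetCard.1 hF
    have hFf := Mesh.mem_facets_of_subset hd hK hc hFK
    have mg := hg.memLp F hFf
    have fin := Mesh.isFiniteMeasure_restrict_facet hd hFf
    rw [← Finset.mul_sum, ← integral_finsetSum]
    · congr 2
      ext x
      rw [← Finset.mul_sum, sK.sum_lam, mul_one]
    · intro i hi
      obtain ⟨p, hp, rfl⟩ := Mesh.exists_eq_erase hc hK hFK
      exact MemLp.integrable_mul_two mg
        ((h.isTrace K hK i hi).1.mono_measure (sK.restrict_facet_le hp))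
  have h2 : ∑ i ∈ K, P.mesh.tractionWork rk ghat K (φs i) =
      ∑ i ∈ K, ∫ x in hull K, (⟪P.flux uH x, (φs i).2 x⟫_ℝ - P.f x * (φs i).1 x) :=
    Finset.sum_congr rfl fun i hi => hg.prolongation K hK i hi
  rw [← h1, h2]
  have mf := Mesh.memLp_openHull P.f_memLp hK
  have mq := P.memLp_flux (Mesh.openHull_subset_Ω hK) (huH K hK).memLp_grad
  rw [restrict_hull, ← integral_finsetSum]
  · rw [← integral_add]
    · rw [integral_congr_ae (g := fun _ => (0 : ℝ)), integral_zero]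
      filter_upwards [h.sum_eq K hK] with x hx
      rw [Finset.sum_sub_distrib, ← inner_sum, ← Finset.mul_sum, hx.1, hx.2]
      simp
    · exact mf.integrable (by norm_num)
    · exact integrable_finsetSum _ fun i hi => (MemLp.integrable_inner_two mq
        (hH i hi).memLp_grad).sub (MemLp.integrable_mul_two mf (hH i hi).memLp)
  · exact fun i hi => (MemLp.integrable_inner_two mq
        (hH i hi).memLp_grad).sub (MemLp.integrable_mul_two mf (hH i hi).memLp)

end Problem

/-! ### Gradient fields -/

theorem eLpNorm_two_sq_eq_ofReal {X F : Type*} [MeasurableSpace X] {μ : Measure X}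
    [NormedAddCommGroup F] [InnerProductSpace ℝ F] {f : X → F} (hf : MemLp f 2 μ) :
    eLpNorm f 2 μ ^ 2 = ENNReal.ofReal (∫ x, ‖f x‖ ^ 2 ∂μ) := by
  rw [eLpNorm_two_sq, ofReal_integral_eq_lintegral_ofReal (hf.integrable_norm_pow two_ne_zero)
    (ae_of_all _ fun x => by positivity)]
  simp only [ENNReal.ofReal_pow (norm_nonneg _), ofReal_norm]

section GradientFields

variable {U : Set (E d)} (hU : IsOpen U) (hUc : Convex ℝ U) (hUb : Bornology.IsBounded U)
  (hUn : U.Nonempty)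
include hU hUc hUb hUn

theorem exists_eLpNorm_le_gradient : ∃ C : ℝ≥0∞, C ≠ ⊤ ∧ ∀ v : Field d, MemH1 U v →
    ∫ x in U, v.1 x = 0 →
      eLpNorm v.1 2 (volume.restrict U) ≤ C * eLpNorm v.2 2 (volume.restrict U) := by
  obtain ⟨C, hC, h⟩ := exists_poincare hU hUc hUb hUn
  have hpos : 0 < volume.real U :=
    ENNReal.toReal_pos (hU.measure_pos _ hUn).ne' hUb.measure_lt_top.ne
  set D := ENNReal.ofReal (C / volume.real U)
  refine ⟨D + 1, by simp [D], fun v hv h0 => ?_⟩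
  refine (ENNReal.pow_le_pow_left_iff two_ne_zero).1 ?_
  have h1 := h v hv
  rw [h0, zero_pow two_ne_zero, zero_add] at h1
  calc eLpNorm v.1 2 (volume.restrict U) ^ 2
      ≤ D * eLpNorm v.2 2 (volume.restrict U) ^ 2 := by
        rw [eLpNorm_two_sq_eq_ofReal hv.memLp, eLpNorm_two_sq_eq_ofReal hv.memLp_grad,
          ← ENNReal.ofReal_mul (by positivity)]
        refine ENNReal.ofReal_le_ofReal ?_
        rw [div_mul_eq_mul_div, le_div_iff₀ hpos]
        linarith
    _ ≤ ((D + 1) * eLpNorm v.2 2 (volume.restrict U)) ^ 2 := by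
        rw [mul_pow]
        gcongr
        calc D ≤ D + 1 := le_self_add
          _ ≤ (D + 1) ^ 2 := le_self_pow₀ (by simp) (by norm_num)

omit hUc in
theorem MemH1.exists_mean_zero {v : Field d} (hv : MemH1 U v) :
    ∃ c : ℝ, MemH1 U ((fun x => v.1 x - c, v.2) : Field d) ∧ ∫ x in U, (v.1 x - c) = 0 := by
  have hfin : volume U < ⊤ := hUb.measure_lt_top
  have hpos : 0 < volume.real U := ENNReal.toReal_pos (hU.measure_pos _ hUn).ne' hfin.ne
  have : IsFiniteMeasure (volume.restrict U) := ⟨by simpa using hfin⟩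
  refine ⟨(volume.real U)⁻¹ * ∫ x in U, v.1 x, ?_, ?_⟩
  · have := hv.sub (memH1_const hUb ((volume.real U)⁻¹ * ∫ x in U, v.1 x))
    refine this.congr (ae_of_all _ fun x => rfl) (ae_of_all _ fun x => ?_)
    simp
  · rw [integral_sub (hv.memLp.integrable (by norm_num)) (integrable_const _)]
    simp only [integral_const, smul_eq_mul, Measure.real, Measure.restrict_apply_univ]
    change _ - volume.real U * _ = 0
    rw [← Measure.real, mul_inv_cancel_left₀ hpos.ne', sub_self]

theorem exists_memH1_of_tendsto_gradient {v : ℕ → E d → ℝ} {p : ℕ → E d → E d} {q : E d → E d}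
    (hv : ∀ n, MemH1 U ((v n, p n) : Field d)) (hv0 : ∀ n, ∫ x in U, v n x = 0)
    (hq : MemLp q 2 (volume.restrict U))
    (t2 : Tendsto (fun n => eLpNorm (fun x => p n x - q x) 2 (volume.restrict U)) atTop (𝓝 0)) :
    ∃ z : E d → ℝ, MemH1 U ((z, q) : Field d) := by
  obtain ⟨C, hC, hP⟩ := exists_eLpNorm_le_gradient hU hUc hUb hUn
  have c2 := tendsto_eLpNorm_sub_sub (fun n => (hv n).memLp_grad.1) hq.1 t2
  have hle : ∀ i j, eLpNorm (fun x => v i x - v j x) 2 (volume.restrict U) ≤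
      C * eLpNorm (fun x => p i x - p j x) 2 (volume.restrict U) := by
    intro i j
    refine hP (fun x => v i x - v j x, fun x => p i x - p j x) ((hv i).sub (hv j)) ?_
    have : IsFiniteMeasure (volume.restrict U) := ⟨by simpa using hUb.measure_lt_top⟩
    have := integral_sub ((hv i).memLp.integrable (by norm_num))
      ((hv j).memLp.integrable (by norm_num))
    simp only [hv0, sub_zero] at this
    exact this
  have c1 : Tendsto (fun k : ℕ × ℕ => eLpNorm (fun x => v k.1 x - v k.2 x) 2
      (volume.restrict U)) atTop (𝓝 0) := by
    have h1 := ENNReal.Tendsto.const_mul (a := C) c2 (Or.inr hC)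
    rw [mul_zero] at h1
    exact tendsto_of_tendsto_of_tendsto_of_le_of_le tendsto_const_nhds h1 (fun _ => zero_le)
      fun k => hle k.1 k.2
  obtain ⟨z, hz, t1⟩ := exists_limit_of_eLpNorm_cauchy (fun n => (hv n).memLp) c1
  exact ⟨z, MemH1.of_tendsto hv hz hq t1 t2⟩

/-- The Poincaré–Wirtinger inequality makes mean-zero potentials of a convergent sequence of
gradients Cauchy, and weak gradients pass to limits. Closedness makes the space complete, as
Lax–Milgram requires. -/
theorem isClosed_gradients :
    IsClosed {p : Lp (E d) 2 (volume.restrict U) | ∃ v : E d → ℝ, MemH1 U ((v, p) : Field d)} := by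
  refine IsSeqClosed.isClosed ?_
  intro p q hp hpq
  have hp' : ∀ n, ∃ v : E d → ℝ, MemH1 U ((v, p n) : Field d) ∧ ∫ x in U, v x = 0 := by
    intro n
    obtain ⟨v, hv⟩ := hp n
    obtain ⟨c, h1, h2⟩ := hv.exists_mean_zero hU hUb hUn
    exact ⟨_, h1, h2⟩
  choose v hv hv0 using hp'
  have t2 := (Lp.tendsto_Lp_iff_tendsto_eLpNorm' p q).1 hpq
  exact exists_memH1_of_tendsto_gradient hU hUc hUb hUn hv hv0 (Lp.memLp q) t2

end GradientFields

end

section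

/-! ### The local Neumann problems -/

namespace Problem

variable {P : Problem d} {U : Set (E d)}

/-- The operator `p ↦ A p` on `L²(U)`. -/
def actLp (P : Problem d) (hU : U ⊆ P.mesh.Ω) :
    Lp (E d) 2 (volume.restrict U) →L[ℝ] Lp (E d) 2 (volume.restrict U) :=
  LinearMap.mkContinuous
    { toFun := fun p => (P.memLp_act hU (Lp.memLp p)).toLp
      map_add' := fun p q => by
        rw [← MemLp.toLp_add]
        refine MemLp.toLp_congr _ _ ?_
        filter_upwards [Lp.coeFn_add p q] with x hx
        rw [hx]
        exact act_add _ _ _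
      map_smul' := fun c p => by
        rw [RingHom.id_apply, ← MemLp.toLp_const_smul]
        refine MemLp.toLp_congr _ _ ?_
        filter_upwards [Lp.coeFn_smul c p] with x hx
        rw [hx]
        exact act_smul _ _ _ } |P.β| fun p => by
    refine Lp.norm_le_mul_norm_of_ae_le_mul ?_
    filter_upwards [(P.memLp_act hU (Lp.memLp p)).coeFn_toLp,
      P.ae_isCoefficient_of_subset hU] with x h1 h2
    change ‖((P.memLp_act hU (Lp.memLp p)).toLp : E d → E d) x‖ ≤ _
    rw [h1]
    exact h2.norm_act_le P.α_pos _

theorem inner_actLp (hU : U ⊆ P.mesh.Ω) (p q : Lp (E d) 2 (volume.restrict U)) :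
    ⟪P.actLp hU p, q⟫_ℝ = ∫ x in U, ⟪act (P.A x) (p x), q x⟫_ℝ := by
  rw [L2.inner_def]
  refine integral_congr_ae ?_
  filter_upwards [(P.memLp_act hU (Lp.memLp p)).coeFn_toLp] with x h1
  change ⟪((P.memLp_act hU (Lp.memLp p)).toLp : E d → E d) x, _⟫_ℝ = _
  rw [h1]

theorem le_inner_actLp (hU : U ⊆ P.mesh.Ω) (p : Lp (E d) 2 (volume.restrict U)) :
    P.α * ‖p‖ * ‖p‖ ≤ ⟪P.actLp hU p, p⟫_ℝ := by
  have h1 := real_inner_self_eq_norm_mul_norm p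
  rw [L2.inner_def] at h1
  rw [inner_actLp, mul_assoc, ← h1, ← integral_const_mul]
  refine integral_mono_ae ((MemLp.integrable_inner_two (Lp.memLp p) (Lp.memLp p)).const_mul _)
    (MemLp.integrable_inner_two (P.memLp_act hU (Lp.memLp p)) (Lp.memLp p)) ?_
  filter_upwards [P.ae_isCoefficient_of_subset hU] with x hx
  rw [real_inner_self_eq_norm_sq]
  exact hx.lower _

/-- The space of the gradients of `H¹(U)`. -/
def gradients (U : Set (E d)) : Submodule ℝ (Lp (E d) 2 (volume.restrict U)) where
  carrier := {p | ∃ v : E d → ℝ, MemH1 U ((v, p) : Field d)}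
  add_mem' := by
    rintro p q ⟨v, hv⟩ ⟨w, hw⟩
    exact ⟨v + w, (hv.add hw).congr EventuallyEq.rfl (Lp.coeFn_add p q).symm⟩
  zero_mem' := by
    exact ⟨0, (memH10_zero U).1.congr (w := (0, _)) EventuallyEq.rfl (Lp.coeFn_zero _ _ _).symm⟩
  smul_mem' := by
    rintro c p ⟨v, hv⟩
    exact ⟨c • v, (hv.smul c).congr EventuallyEq.rfl (Lp.coeFn_smul c p).symm⟩

/-- The Lax-Milgram lemma for functionals that are bounded by the `L²`-norm of the gradient. -/
theorem exists_weak_solution (hU : U ⊆ P.mesh.Ω) (hUo : IsOpen U) (hUc : Convex ℝ U)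
    (hUb : Bornology.IsBounded U) (hUn : U.Nonempty) {ℓ : Field d → ℝ} {C : ℝ}
    (hadd : ∀ v w, MemH1 U v → MemH1 U w → ℓ (v + w) = ℓ v + ℓ w)
    (hsmul : ∀ (c : ℝ) v, MemH1 U v → ℓ (c • v) = c * ℓ v)
    (hle : ∀ v, MemH1 U v → |ℓ v| ≤ C * (eLpNorm v.2 2 (volume.restrict U)).toReal) :
    ∃ w, MemH1 U w ∧ ∀ v, MemH1 U v → ∫ x in U, ⟪P.flux w x, v.2 x⟫_ℝ = ℓ v := by
  have hcl : IsClosed (gradients U : Set (Lp (E d) 2 (volume.restrict U))) :=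
    isClosed_gradients hUo hUc hUb hUn
  have : CompleteSpace (gradients U) := hcl.completeSpace_coe
  have hzero : ∀ v, MemH1 U v → v.2 =ᵐ[volume.restrict U] 0 → ℓ v = 0 := by
    intro v hv h0
    have := hle v hv
    rw [eLpNorm_congr_ae h0, eLpNorm_zero, ENNReal.toReal_zero, mul_zero] at this
    exact abs_eq_zero.1 (le_antisymm this (abs_nonneg _))
  -- The functional depends on the gradient alone, so it descends to the space of gradients, on
  -- which the bilinear form is coercive.
  have hcongr : ∀ v w, MemH1 U v → MemH1 U w → v.2 =ᵐ[volume.restrict U] w.2 → ℓ v = ℓ w := by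
    intro v w hv hw h
    have h1 := hadd _ _ (hw.smul (-1)) hv
    rw [hsmul _ _ hw, hzero _ ((hw.smul (-1)).add hv)] at h1
    · linarith
    · filter_upwards [h] with x hx
      change (-1 : ℝ) • w.2 x + v.2 x = 0
      rw [hx]; simp
  -- The choice of potentials is not linear, but two potentials of one gradient have the same value
  -- under `ℓ`, so the induced functional is linear.
  choose pot hpot using fun p : gradients U => p.2
  let G : gradients U → Field d := fun p => (pot p, (p : Lp (E d) 2 (volume.restrict U)))
  have hG : ∀ p, MemH1 U (G p) := hpot
  have hG_add : ∀ p q, ℓ (G (p + q)) = ℓ (G p) + ℓ (G q) := by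
    intro p q
    rw [← hadd _ _ (hG p) (hG q)]
    exact hcongr _ _ (hG _) ((hG p).add (hG q)) (Lp.coeFn_add p.1 q.1)
  have hG_smul : ∀ (c : ℝ) p, ℓ (G (c • p)) = c * ℓ (G p) := by
    intro c p
    rw [← hsmul _ _ (hG p)]
    exact hcongr _ _ (hG _) ((hG p).smul c) (Lp.coeFn_smul c p.1)
  have hG_le : ∀ p : gradients U, ‖ℓ (G p)‖ ≤ C * ‖p‖ := by
    intro p
    rw [Submodule.coe_norm, Lp.norm_def]
    exact hle _ (hG p)
  let φ : gradients U →L[ℝ] ℝ := LinearMap.mkContinuous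
    { toFun := fun p => ℓ (G p), map_add' := hG_add, map_smul' := hG_smul } C hG_le
  let B : gradients U →L[ℝ] gradients U →L[ℝ] ℝ :=
    ((innerSL ℝ).comp (P.actLp hU)).bilinearComp (gradients U).subtypeL (gradients U).subtypeL
  have hB : IsCoercive B := ⟨P.α, P.α_pos, fun p => P.le_inner_actLp hU p⟩
  let p := hB.continuousLinearEquivOfBilin.symm ((InnerProductSpace.toDual ℝ _).symm φ)
  refine ⟨G p, hG p, fun v hv => ?_⟩
  let q : gradients U := ⟨hv.memLp_grad.toLp, v.1,
    hv.congr EventuallyEq.rfl hv.memLp_grad.coeFn_toLp.symm⟩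
  have h1 : B p q = φ q := by
    rw [← hB.continuousLinearEquivOfBilin_apply, ContinuousLinearEquiv.apply_symm_apply,
      InnerProductSpace.toDual_symm_apply]
  have h2 : φ q = ℓ v := hcongr _ _ (hG q) hv hv.memLp_grad.coeFn_toLp
  have h3 : B p q = ∫ x in U, ⟪act (P.A x) ((p : Lp (E d) 2 (volume.restrict U)) x),
      (q : Lp (E d) 2 (volume.restrict U)) x⟫_ℝ := P.inner_actLp hU _ _
  rw [← h2, ← h1, h3]
  refine integral_congr_ae ?_
  filter_upwards [hv.memLp_grad.coeFn_toLp] with x hx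
  change _ = ⟪_, (hv.memLp_grad.toLp : E d → E d) x⟫_ℝ
  rw [hx]
  rfl

end Problem

end

/-! ### Solvability and uniqueness of the local Neumann problems, and their fluxes -/

section

theorem IsTestFunction.memH10 {U : Set (E d)} (hU : Bornology.IsBounded U) {φ : E d → ℝ}
    (hφ : IsTestFunction U φ) : MemH10 U ((φ, gradient φ) : Field d) :=
  ⟨memH1_of_contDiff hU hφ.1, fun _ => φ, fun _ => hφ, by simp [TendstoH1]⟩

namespace Problem

variable {P : Problem d} {rk : Finset (E d) → ℕ} {ghat : E d → ℝ} {K : Finset (E d)}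

/-- Equilibrium is the statement that the load annihilates constants. Subtracting the mean of the
test function therefore costs nothing, and the trace and Poincaré–Wirtinger inequalities bound the
load by the gradient. -/
theorem exists_isNeumannSolution (hd : 0 < d)
    (hg : ∀ F ∈ P.mesh.facets, MemLp ghat 2 ((surf d).restrict (hull F)))
    (hK : K ∈ P.mesh.elements)
    (heq : (∫ x in hull K, P.f x) + P.mesh.tractionResultant rk ghat K = 0) :
    ∃ w, P.IsNeumannSolution rk ghat K w := by
  have hb := isBounded_openHull K
  have hn := (P.mesh.isSimplex hK).nonempty_openHull
  have ho := isOpen_openHull K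
  have hc := convex_openHull K
  have mf := Mesh.memLp_openHull P.f_memLp hK
  obtain ⟨D, hD, hP⟩ := exists_eLpNorm_le_gradient ho hc hb hn
  obtain ⟨C, hC, hT⟩ := Mesh.exists_tractionWork_le (rk := rk) hg hd hK
  let ℓ : Field d → ℝ := fun v =>
    (∫ x in openHull K, P.f x * v.1 x) + P.mesh.tractionWork rk ghat K v
  have hadd : ∀ v w, MemH1 (openHull K) v → MemH1 (openHull K) w → ℓ (v + w) = ℓ v + ℓ w := by
    intro v w hv hw
    have h1 := integral_add (MemLp.integrable_mul_two mf hv.memLp)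
      (MemLp.integrable_mul_two mf hw.memLp)
    simp only [ℓ, Mesh.tractionWork_add hg hd hK hv hw, Prod.fst_add, Pi.add_apply, mul_add]
    rw [h1]
    ring
  have hsmul : ∀ (c : ℝ) v, MemH1 (openHull K) v → ℓ (c • v) = c * ℓ v := by
    intro c v hv
    simp only [ℓ, Mesh.tractionWork_smul hd hK hv, Prod.smul_fst, Pi.smul_apply, smul_eq_mul,
      mul_left_comm _ c, integral_const_mul]
    ring
  have hconst : ∀ c : ℝ, ℓ (fun _ => c, fun _ => 0) = 0 := by
    intro c
    simp only [ℓ, Mesh.tractionWork_const hd hK, integral_mul_const]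
    rw [← add_mul, ← restrict_hull, heq, zero_mul]
  have hle : ∀ v, MemH1 (openHull K) v → |ℓ v| ≤ (((eLpNorm P.f 2
      (volume.restrict (openHull K))).toReal + C) * D.toReal + C) *
        (eLpNorm v.2 2 (volume.restrict (openHull K))).toReal := by
    intro v hv
    obtain ⟨c, h1, h2⟩ := hv.exists_mean_zero ho hb hn
    have e : v = ((fun x => v.1 x - c, v.2) : Field d) + ((fun _ => c, fun _ => 0) : Field d) := by
      refine Prod.ext ?_ ?_ <;> ext1 x <;> simp
    have e2 : ℓ v = ℓ (fun x => v.1 x - c, v.2) := by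
      conv_lhs => rw [e]
      rw [hadd _ _ h1 (memH1_const hb c), hconst, add_zero]
    rw [e2]
    have h3 := ENNReal.toReal_mono (ENNReal.mul_ne_top hD hv.memLp_grad.2.ne) (hP (fun x => v.1 x - c, v.2) h1 h2)
    rw [ENNReal.toReal_mul] at h3
    have h4 := hT _ h1
    have h5 := abs_integral_mul_le mf h1.memLp
    refine (abs_add_le _ _).trans ((add_le_add h5 h4).trans ?_)
    simp only at h3 ⊢
    have h6 : 0 ≤ (eLpNorm P.f 2 (volume.restrict (openHull K))).toReal := ENNReal.toReal_nonneg
    nlinarith [mul_le_mul_of_nonneg_left h3 (add_nonneg h6 hC)]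
  obtain ⟨w, hw, h⟩ := exists_weak_solution (P := P) (Mesh.openHull_subset_Ω hK) ho hc hb hn
    hadd hsmul hle
  refine ⟨w, hw, fun v hv => ?_⟩
  rw [bilinOn, restrict_hull]
  exact h v hv

theorem IsNeumannSolution.unique {w w' : Field d} (hK : K ∈ P.mesh.elements)
    (hw : P.IsNeumannSolution rk ghat K w) (hw' : P.IsNeumannSolution rk ghat K w') :
    (∃ c : ℝ, ∀ᵐ x ∂(volume.restrict (hull K)), w.1 x = w'.1 x + c) ∧
      w.2 =ᵐ[volume.restrict (hull K)] w'.2 := by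
  rw [restrict_hull]
  have hU := Mesh.openHull_subset_Ω hK
  have hz := hw.1.sub hw'.1
  have i1 := MemLp.integrable_inner_two (P.memLp_flux hU hw.1.memLp_grad) hz.memLp_grad
  have i2 := MemLp.integrable_inner_two (P.memLp_flux hU hw'.1.memLp_grad) hz.memLp_grad
  have h0 : ∫ x in openHull K, ⟪P.flux (w - w') x, (w - w').2 x⟫_ℝ = 0 := by
    have h1 := hw.2 _ hz
    have h2 := hw'.2 _ hz
    rw [bilinOn, restrict_hull] at h1 h2
    simp only [flux_sub, Pi.sub_apply, inner_sub_left]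
    rw [integral_sub i1 i2]
    linarith
  have hg := P.gradient_ae_eq_zero hU hz.memLp_grad h0.le
  obtain ⟨c, hc⟩ := hz.ae_eq_const (isOpen_openHull K) (convex_openHull K) (isBounded_openHull K)
    (P.mesh.isSimplex hK).nonempty_openHull hg
  refine ⟨⟨c, ?_⟩, ?_⟩
  · filter_upwards [hc] with x hx
    rw [← hx]
    simp
  · filter_upwards [hg] with x hx
    exact sub_eq_zero.1 hx

/-- Test functions of the open element have zero trace, so the traction drops out and leaves the
divergence equation; general `v` give the normal trace. -/
theorem IsNeumannSolution.isElementFlux {w : Field d} (hd : 0 < d) (hK : K ∈ P.mesh.elements)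
    (hw : P.IsNeumannSolution rk ghat K w) : P.IsElementFlux rk ghat K (P.flux w) := by
  refine ⟨P.memLp_flux (Mesh.openHull_subset_Ω hK) hw.1.memLp_grad, fun φ hφ => ?_, fun v hv => ?_⟩
  · have h := IsTestFunction.memH10 (isBounded_openHull K) hφ
    have h1 := hw.2 _ h.1
    rw [bilinOn, Mesh.tractionWork_of_memH10 hd hK h, add_zero, restrict_hull] at h1
    simp only [neg_mul, integral_neg, neg_neg]
    exact h1
  · have h1 := hw.2 v hv
    rw [bilinOn] at h1
    simp only [neg_mul, integral_neg]
    rw [h1]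
    ring

theorem exists_assembled_flux {q : Finset (E d) → E d → E d} :
    ∃ qhat : E d → E d, ∀ K ∈ P.mesh.elements, qhat =ᵐ[volume.restrict (hull K)] q K := by
  classical
  refine ⟨fun x => if h : ∃ K ∈ P.mesh.elements, x ∈ openHull K then q h.choose x else 0,
    fun K hK => ?_⟩
  rw [restrict_hull]
  filter_upwards [ae_restrict_mem (isOpen_openHull K).measurableSet] with x hx
  have h : ∃ K ∈ P.mesh.elements, x ∈ openHull K := ⟨K, hK, hx⟩
  rw [dif_pos h]
  have : h.choose = K := by
    by_contra hne
    exact Set.disjoint_left.1 (P.mesh.pairwise_disjoint_openHull h.choose_spec.1 hK hne)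
      h.choose_spec.2 hx
  rw [this]

end Problem

end

section

/-! ### Static admissibility -/

namespace Mesh

variable {T : Mesh d} {rk : Finset (E d) → ℕ} {F K : Finset (E d)}

/-- Since `Ω` is the interior of the union of closed simplices, one must exclude that a boundary
facet is covered from its far side. Were `x` interior, the points just across `F` would belong to
other elements; by closedness one of these contains `x`, hence by conformity all of `F`. -/
theorem notMem_Ω_of_boundary (hd : 0 < d) (hF : F ∈ T.boundaryFacets) (hK : K ∈ T.elements)
    (hFK : F ⊆ K) {x : E d} (hx : x ∈ hull F) (hpos : ∀ q ∈ F, lam K q x ≠ 0) : x ∉ T.Ω := by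
  classical
  intro hxΩ
  have sK := T.isSimplex hK
  obtain ⟨p, hp, rfl⟩ := exists_eq_erase ((mem_facets T).1 (boundaryFacets_subset hF)).2 hK hFK
  have ha := sK.slope_lam_ne_zero hd hp
  have hxp := (sK.mem_facet hp).1 hx
  have hcl : IsClosed (⋃ L ∈ T.elements.erase K, hull L) :=
    isClosed_biUnion_finset fun L _ => isClosed_hull L
  -- These points approach `x` from the side where `lam K p` is negative, outside `K`.
  let y : ℕ → E d := fun n => x + (-(1 / ((n : ℝ) + 1))) • unitStep (lam K p)
  have ht : Tendsto y atTop (𝓝 x) := by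
    have h1 : Tendsto (fun n : ℕ => -(1 / ((n : ℝ) + 1))) atTop (𝓝 (-0)) :=
      tendsto_one_div_add_atTop_nhds_zero_nat.neg
    have h2 := (h1.smul_const (unitStep (lam K p))).const_add x
    simpa [y] using h2
  have hmem : ∀ᶠ n in atTop, y n ∈ ⋃ L ∈ T.elements.erase K, hull L := by
    filter_upwards [ht.eventually (T.isOpen_Ω.mem_nhds hxΩ)] with n hn
    obtain ⟨L, hL, hyL⟩ := Set.mem_iUnion₂.1 (Ω_subset hn)
    refine Set.mem_iUnion₂.2 ⟨L, Finset.mem_erase.2 ⟨?_, hL⟩, hyL⟩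
    rintro rfl
    have h3 := sK.mem_hull.1 hyL p hp
    rw [apply_add_smul_unitStep ha, hxp.2, zero_add] at h3
    have : (0 : ℝ) < 1 / ((n : ℝ) + 1) := by positivity
    linarith
  obtain ⟨L, hL, hxL⟩ := Set.mem_iUnion₂.1 (hcl.mem_of_tendsto ht hmem)
  obtain ⟨hLK, hL⟩ := Finset.mem_erase.1 hL
  have hxKL : x ∈ hull (K ∩ L) := by
    rw [← hull_inter ((mem_elements T).1 hK).1 ((mem_elements T).1 hL).1]
    exact ⟨hxp.1, hxL⟩
  refine hLK (eq_of_boundary hF hL hK (fun q hq => ?_) hFK)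
  by_contra hqL
  refine hpos q hq ((sK.mem_facet (hFK hq)).1 (hull_mono (fun r hr => ?_) hxKL)).2
  obtain ⟨h1, h2⟩ := Finset.mem_inter.1 hr
  exact Finset.mem_erase.2 ⟨fun e => hqL (e ▸ h2), h1⟩

theorem ae_notMem_Ω_of_boundary (hd : 0 < d) (hF : F ∈ T.boundaryFacets) :
    ∀ᵐ x ∂((surf d).restrict (hull F)), x ∉ T.Ω := by
  obtain ⟨K, hK, hFK⟩ := exists_element_of_facet (boundaryFacets_subset hF)
  have sK := T.isSimplex hK
  have h : ∀ᵐ x ∂((surf d).restrict (hull F)), ∀ q ∈ F, lam K q x ≠ 0 := by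
    refine (ae_ball_iff F.countable_toSet).2 fun q hq => ?_
    obtain ⟨p, hp, rfl⟩ := exists_eq_erase ((mem_facets T).1 (boundaryFacets_subset hF)).2 hK hFK
    rw [ae_restrict_iff' (measurableSet_hull _), ae_iff]
    refine measure_mono_null (fun y hy => ?_) (sK.surf_relative_boundary hp hq)
    simp only [Classical.not_imp, not_not, Set.mem_ofPred_eq] at hy
    exact hy
  filter_upwards [h, ae_restrict_mem (measurableSet_hull F)] with x hx hxF
  exact notMem_Ω_of_boundary hd hF hK hFK hxF hx

theorem facetTrace_of_isTestFunction (hd : 0 < d) (hF : F ∈ T.boundaryFacets) {φ : E d → ℝ}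
    (hφ : IsTestFunction T.Ω φ) :
    T.facetTrace F (φ, gradient φ) =ᵐ[(surf d).restrict (hull F)] 0 := by
  obtain ⟨K, hK, hFK⟩ := exists_element_of_facet (boundaryFacets_subset hF)
  have sK := T.isSimplex hK
  have hv : MemH1 T.Ω ((φ, gradient φ) : Field d) := memH1_of_contDiff isBounded_Ω hφ.1
  have hc := ((mem_facets T).1 (boundaryFacets_subset hF)).2
  refine (facetTrace_eq_trace hd hK hc hFK hv).trans ?_
  have h := T.ae_notMem_Ω_of_boundary hd hF
  obtain ⟨p, hp, rfl⟩ := exists_eq_erase hc hK hFK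
  filter_upwards [h, IsTrace.ae_eq_facet hd sK (memH1_openHull hv hK)
    (sK.isTrace_of_contDiff hd hφ.1) hp] with x h1 h2
  rw [h2]
  exact hφ.eq_zero h1

/-- After exchanging the sums, an interior facet contributes twice with the same trace and opposite
orientations, hence cancels; a boundary facet contributes once, with sign `+1`. No integrability of
`ghat` is needed, because a common integral is factored out. -/
theorem sum_tractionWork (hd : 0 < d) (hrk : Set.InjOn rk (T.elements : Set (Finset (E d))))
    {v : Field d} (hv : MemH1 T.Ω v) (ghat : E d → ℝ) :
    ∑ K ∈ T.elements, T.tractionWork rk ghat K v =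
      ∑ F ∈ T.boundaryFacets, ∫ x in hull F, ghat x * T.facetTrace F v x ∂(surf d) := by
  classical
  have h1 : ∀ K ∈ T.elements, T.tractionWork rk ghat K v =
      ∑ F ∈ T.facets.filter (fun F => F ⊆ K),
        T.orient rk K F * ∫ x in hull F, ghat x * T.facetTrace F v x ∂(surf d) := by
    intro K hK
    rw [tractionWork, ← powersetCard_eq hd hK]
    refine Finset.sum_congr rfl fun F hF => ?_
    obtain ⟨hFK, hc⟩ := Finset.mem_powersetCard.1 hF
    congr 1
    refine integral_congr_ae ?_
    filter_upwards [facetTrace_eq_trace hd hK hc hFK hv] with x hx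
    rw [hx]
  rw [Finset.sum_congr rfl h1]
  simp only [Finset.sum_filter]
  rw [Finset.sum_comm]
  simp only [← Finset.sum_filter]
  rw [← Finset.sum_subset boundaryFacets_subset]
  · refine Finset.sum_congr rfl fun F hF => ?_
    obtain ⟨K, hK, hFK⟩ := exists_element_of_facet (boundaryFacets_subset hF)
    rw [sum_boundary hF hK hFK, orient_boundary hF hK hFK, one_mul]
  · intro F hF hFb
    rcases facet_cases hF with h | ⟨K, hK, L, hL, hKL, hFK, hFL⟩
    · exact absurd h hFb
    · have hc := ((mem_facets T).1 hF).2
      rw [sum_interior hd hc hK hL hFK hFL hKL, ← add_mul,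
        orient_add hd hrk hc hK hL hFK hFL hKL, zero_mul]

end Mesh

namespace Problem

variable {P : Problem d} {rk : Finset (E d) → ℕ} {φs : E d → Field d} {uH : Field d}
  {ghat : E d → ℝ}

theorem sum_tractionWork_eq_neumannWork (hd : 0 < d)
    (hrk : Set.InjOn rk (P.mesh.elements : Set (Finset (E d))))
    (hN : ∀ F ∈ P.neumannFacets, ghat =ᵐ[(surf d).restrict (hull F)] P.g)
    {v : Field d} (hv : v ∈ P.V) :
    ∑ K ∈ P.mesh.elements, P.mesh.tractionWork rk ghat K v = P.neumannWork v := by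
  classical
  rw [Mesh.sum_tractionWork hd hrk hv.1, ← Finset.sum_sdiff P.D_subset, neumannWork,
    Finset.sum_eq_zero (s := P.D), add_zero]
  · refine Finset.sum_congr (by unfold neumannFacets; congr) fun F hF => integral_congr_ae ?_
    have hF' : F ∈ P.neumannFacets := mem_neumannFacets.2 (Finset.mem_sdiff.1 hF)
    filter_upwards [hN F hF'] with x hx
    rw [hx]
  · intro F hF
    refine integral_eq_zero_of_ae ?_
    filter_upwards [hv.2 F hF] with x hx
    rw [hx]
    simp

/-- The normal-trace identity is the sum of the elementwise ones. Test functions of `Ω` belong to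
`V` and have zero trace on all boundary facets, so the divergence equation is a special case of the
same identity. -/
theorem isStaticallyAdmissible (hd : 0 < d)
    (hrk : Set.InjOn rk (P.mesh.elements : Set (Finset (E d))))
    (hN : ∀ F ∈ P.neumannFacets, ghat =ᵐ[(surf d).restrict (hull F)] P.g)
    {q : E d → E d} (hq : ∀ K ∈ P.mesh.elements, P.IsElementFlux rk ghat K q) :
    P.IsStaticallyAdmissible q := by
  have mq : MemLp q 2 (volume.restrict P.mesh.Ω) := Mesh.memLp_Ω fun K hK => (hq K hK).memLp
  have ht : ∀ v ∈ P.V, (∫ x in P.mesh.Ω, ⟪q x, v.2 x⟫_ℝ) +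
      (∫ x in P.mesh.Ω, (- P.f x) * v.1 x) = P.neumannWork v := by
    intro v hv
    rw [Mesh.integral_Ω (MemLp.integrable_inner_two mq hv.1.memLp_grad),
      Mesh.integral_Ω (f := fun x => -P.f x * v.1 x)
        (MemLp.integrable_mul_two P.f_memLp.neg hv.1.memLp), ← Finset.sum_add_distrib,
      ← sum_tractionWork_eq_neumannWork hd hrk hN hv]
    exact Finset.sum_congr rfl fun K hK =>
      (hq K hK).normal_trace v (Mesh.memH1_openHull hv.1 hK)
  refine ⟨mq, fun φ hφ => ?_, ht⟩
  have hv : ((φ, gradient φ) : Field d) ∈ P.V :=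
    ⟨memH1_of_contDiff Mesh.isBounded_Ω hφ.1, fun F hF =>
      Mesh.facetTrace_of_isTestFunction hd (P.D_subset hF) hφ⟩
  have h := ht _ hv
  rw [neumannWork, Finset.sum_eq_zero] at h
  · exact eq_neg_of_add_eq_zero_left h
  · intro F hF
    refine integral_eq_zero_of_ae ?_
    filter_upwards [Mesh.facetTrace_of_isTestFunction hd (mem_neumannFacets.1 hF).1 hφ] with x hx
    rw [hx]
    simp

end Problem

end

section

/-! ### Error bounds by the constitutive relation error -/

/-- Minkowski's inequality for a nonnegative quadratic form: nonpositivity of the discriminant is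
Cauchy–Schwarz. -/
theorem sqrt_add_two_mul_add_le {a b c : ℝ} (hc : 0 ≤ c)
    (h : ∀ t : ℝ, 0 ≤ a + 2 * t * b + t ^ 2 * c) :
    √(a + 2 * b + c) ≤ √a + √c := by
  have ha : 0 ≤ a := by simpa using h 0
  have h1 := discrim_le_zero (a := c) (b := 2 * b) (c := a) fun t => by linarith [h t]
  rw [discrim] at h1
  have h2 : b ≤ √a * √c := by
    rw [← Real.sqrt_mul ha]
    exact Real.le_sqrt_of_sq_le (by linarith)
  refine Real.sqrt_le_iff.2 ⟨by positivity, ?_⟩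
  rw [add_sq, Real.sq_sqrt ha, Real.sq_sqrt hc]
  linarith

namespace Problem

variable {P : Problem d} {u v w : Field d} {p q : E d → E d}

theorem brokenBilin_eq_bilin (hv : MemLp v.2 2 (volume.restrict P.mesh.Ω))
    (hw : MemLp w.2 2 (volume.restrict P.mesh.Ω)) : P.brokenBilin v w = P.bilin v w :=
  (Mesh.integral_Ω (MemLp.integrable_inner_two (P.memLp_flux subset_rfl hv) hw)).symm

theorem brokenEnergyNorm_eq_energyNorm (hv : MemLp v.2 2 (volume.restrict P.mesh.Ω)) :
    P.brokenEnergyNorm v = P.energyNorm v := by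
  rw [brokenEnergyNorm, energyNorm, brokenBilin_eq_bilin hv hv]

theorem bilin_self_nonneg : 0 ≤ P.bilin v v := by
  refine integral_nonneg_of_ae ?_
  filter_upwards [P.ae_isCoefficient] with x hx
  exact (mul_nonneg P.α_pos.le (sq_nonneg _)).trans (hx.lower _)

theorem bilin_add_smul_self (hv : MemLp v.2 2 (volume.restrict P.mesh.Ω))
    (hw : MemLp w.2 2 (volume.restrict P.mesh.Ω)) (t : ℝ) : P.bilin (v + t • w) (v + t • w) =
      P.bilin v v + 2 * t * P.bilin v w + t ^ 2 * P.bilin w w := by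
  have fv := P.memLp_flux subset_rfl hv
  have fw := P.memLp_flux subset_rfl hw
  have i1 := MemLp.integrable_inner_two fv hv
  have i2 := (MemLp.integrable_inner_two fv hw).const_mul (2 * t)
  have i3 := (MemLp.integrable_inner_two fw hw).const_mul (t ^ 2)
  have i12 := i1.add i2
  simp only [Pi.add_def] at i12
  simp only [bilin, bilinOn]
  rw [← integral_const_mul, ← integral_const_mul, ← integral_add i1 i2, ← integral_add i12 i3]
  refine integral_congr_ae ?_
  filter_upwards [P.ae_isCoefficient] with x hx
  have h : ⟪act (P.A x) (w.2 x), v.2 x⟫_ℝ = ⟪act (P.A x) (v.2 x), w.2 x⟫_ℝ :=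
    (hx.inner_act_comm _ _).trans (real_inner_comm _ _)
  simp only [act_add, act_smul, Pi.add_apply, Pi.smul_apply, Prod.snd_add, Prod.smul_snd,
    inner_add_left, inner_add_right, inner_smul_left, inner_smul_right, flux, conj_trivial]
  rw [h]
  ring

theorem energyNorm_add_le (hv : MemLp v.2 2 (volume.restrict P.mesh.Ω))
    (hw : MemLp w.2 2 (volume.restrict P.mesh.Ω)) :
    P.energyNorm (v + w) ≤ P.energyNorm v + P.energyNorm w := by
  have h := bilin_add_smul_self hv hw 1
  rw [one_smul, mul_one, one_pow, one_mul] at h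
  rw [energyNorm, h]
  refine sqrt_add_two_mul_add_le bilin_self_nonneg fun t => ?_
  rw [← bilin_add_smul_self hv hw t]
  exact bilin_self_nonneg

theorem fluxNorm_sq (p : E d → E d) :
    P.fluxNorm p ^ 2 = ∫ x in P.mesh.Ω, ⟪act ((P.A x)⁻¹) (p x), p x⟫_ℝ := by
  refine Real.sq_sqrt (integral_nonneg_of_ae ?_)
  filter_upwards [P.ae_isCoefficient] with x hx
  exact hx.inner_act_inv_nonneg P.α_pos _

theorem fluxNorm_sub_comm (p q : E d → E d) : P.fluxNorm (p - q) = P.fluxNorm (q - p) := by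
  rw [fluxNorm, fluxNorm]
  congr 2
  ext1 x
  rw [← neg_sub q p, Pi.neg_apply, ← zero_sub, act_sub, act_zero, zero_sub, zero_sub, inner_neg_neg]

theorem fluxNorm_flux (v : Field d) : P.fluxNorm (P.flux v) = P.energyNorm v := by
  rw [fluxNorm, energyNorm, bilin, bilinOn]
  congr 1
  refine integral_congr_ae ?_
  filter_upwards [P.ae_isCoefficient] with x hx
  rw [flux, hx.act_inv_act P.α_pos, real_inner_comm]

theorem cre_flux (u v : Field d) : P.cre v (P.flux u) = P.energyNorm (u - v) := by
  rw [cre, ← flux_sub, fluxNorm_flux]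

/-- In the cross term `A⁻¹` cancels the `A` of the flux, leaving the plain `L²` product of `p` with
the gradient, which weak formulations can evaluate. -/
theorem fluxNorm_add_flux_sq (hp : MemLp p 2 (volume.restrict P.mesh.Ω))
    (hv : MemLp v.2 2 (volume.restrict P.mesh.Ω)) : P.fluxNorm (p + P.flux v) ^ 2 =
      P.fluxNorm p ^ 2 + 2 * (∫ x in P.mesh.Ω, ⟪p x, v.2 x⟫_ℝ) + P.energyNorm v ^ 2 := by
  have ip := MemLp.integrable_inner_two (P.memLp_act_inv subset_rfl hp) hp
  have ipv := (MemLp.integrable_inner_two hp hv).const_mul 2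
  have iv := MemLp.integrable_inner_two (P.memLp_flux subset_rfl hv) hv
  have i12 := ip.add ipv
  simp only [Pi.add_def] at i12
  rw [fluxNorm_sq, fluxNorm_sq, energyNorm, Real.sq_sqrt bilin_self_nonneg, bilin, bilinOn,
    ← integral_const_mul, ← integral_add ip ipv, ← integral_add i12 iv]
  refine integral_congr_ae ?_
  filter_upwards [P.ae_isCoefficient] with x hx
  have h1 := hx.inner_act_inv_comm P.α_pos (p x) (P.flux v x)
  have h2 : act (P.A x)⁻¹ (P.flux v x) = v.2 x := hx.act_inv_act P.α_pos _
  rw [h2] at h1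
  rw [Pi.add_apply, act_add, h2, inner_add_left, inner_add_right, inner_add_right, h1,
    real_inner_comm (p x) (v.2 x), real_inner_comm (P.flux v x) (v.2 x)]
  ring

/-- Both fluxes satisfy the same weak identity on `V`: one by admissibility, the other by the
equation for `u`. -/
theorem IsStaticallyAdmissible.integral_sub_flux (hq : P.IsStaticallyAdmissible q)
    (hu : P.IsWeakSolution u) (hv : v ∈ P.V) :
    ∫ x in P.mesh.Ω, ⟪(q - P.flux u) x, v.2 x⟫_ℝ = 0 := by
  have h1 := hq.normal_trace v hv
  have h2 := hu.2 v hv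
  rw [bilin, bilinOn, load] at h2
  simp only [neg_mul, integral_neg] at h1
  simp only [Pi.sub_apply, inner_sub_left]
  rw [integral_sub (MemLp.integrable_inner_two hq.memLp hv.1.memLp_grad)
    (MemLp.integrable_inner_two (P.memLp_flux subset_rfl hu.1.1.memLp_grad) hv.1.memLp_grad), h2]
  linarith

/-- The Prager-Synge identity. -/
theorem IsStaticallyAdmissible.prager_synge (hd : 0 < d) (hq : P.IsStaticallyAdmissible q)
    (hu : P.IsWeakSolution u) (hv : v ∈ P.V) :
    P.energyNorm (u - v) ^ 2 + P.fluxNorm (P.flux u - q) ^ 2 = P.cre v q ^ 2 := by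
  have hw : u - v ∈ P.V := (P.VSpace hd).sub_mem hu.1 hv
  -- The two summands are orthogonal because `u - v` lies in `V`.
  have e : q - P.flux v = (q - P.flux u) + P.flux (u - v) := by
    rw [flux_sub]
    abel
  rw [cre, e, fluxNorm_add_flux_sq (hq.memLp.sub (P.memLp_flux subset_rfl hu.1.1.memLp_grad))
    hw.1.memLp_grad, hq.integral_sub_flux hu hw, fluxNorm_sub_comm]
  ring

theorem IsStaticallyAdmissible.energyNorm_le_cre (hd : 0 < d) (hq : P.IsStaticallyAdmissible q)
    (hu : P.IsWeakSolution u) (hv : v ∈ P.V) : P.energyNorm (u - v) ≤ P.cre v q := by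
  have h1 : 0 ≤ P.energyNorm (u - v) := Real.sqrt_nonneg _
  have h2 : 0 ≤ P.cre v q := Real.sqrt_nonneg _
  rw [← sq_le_sq₀ h1 h2, ← hq.prager_synge hd hu hv]
  exact le_add_of_nonneg_right (sq_nonneg _)

/-- Both energies integrate the given gradient field over the domain and facets are null, so the
broken norm coincides with the other even for discontinuous functions. The triangle inequality
through `v` then suffices. -/
theorem IsStaticallyAdmissible.brokenEnergyNorm_le (hd : 0 < d) (hq : P.IsStaticallyAdmissible q)
    (hu : P.IsWeakSolution u) (hv : v ∈ P.V) (hw : P.mesh.MemBrokenH1 w) :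
    P.brokenEnergyNorm (u - w) ≤ P.cre v q + P.brokenEnergyNorm (v - w) := by
  have mw : MemLp w.2 2 (volume.restrict P.mesh.Ω) :=
    Mesh.memLp_Ω fun K hK => (hw K hK).memLp_grad
  have mu := hu.1.1.memLp_grad
  have mv := hv.1.memLp_grad
  rw [brokenEnergyNorm_eq_energyNorm (mu.sub mw), brokenEnergyNorm_eq_energyNorm (mv.sub mw)]
  have h := energyNorm_add_le (P := P) (v := u - v) (w := v - w) (mu.sub mv) (mv.sub mw)
  rw [sub_add_sub_cancel] at h
  exact h.trans (add_le_add_left (hq.energyNorm_le_cre hd hu hv) _)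

end Problem

end

end MsFEM

end

/-! ### The a posteriori error theorem -/

theorem mainTheorem1 {d : ℕ} (hd : 0 < d) (P : MsFEM.Problem d)
    (u : MsFEM.Field d) (hu : P.IsWeakSolution u)
    (rk : Finset (MsFEM.E d) → ℕ) (hrk : Set.InjOn rk (P.mesh.elements : Set (Finset (MsFEM.E d))))
    (φ0 φ φs : MsFEM.E d → MsFEM.Field d) (hφ0 : P.mesh.IsHatBasis φ0)
    (hφ : P.IsConforming φ0 φ φs ∨ P.IsPetrovGalerkin φ0 φ φs)
    (uH : MsFEM.Field d) (huH : P.IsDiscreteSolution φ φs uH) :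
    -- the test functions are a partition of unity
    (∀ K ∈ P.mesh.elements,
      ∀ᵐ x ∂(volume.restrict (MsFEM.hull K)), ∑ i ∈ K, (φs i).1 x = 1) ∧
    -- the construction of the tractions succeeds, has one result, which has the prolongation property
    (∀ m : MsFEM.E d → ℝ,
      (∀ F ∈ P.mesh.facets, MemLp m 2 ((MsFEM.surf d).restrict (MsFEM.hull F))) →
      (∃ ghat, P.IsBuiltTraction rk φs uH m ghat) ∧
      (∀ ghat ghat', P.IsBuiltTraction rk φs uH m ghat → P.IsBuiltTraction rk φs uH m ghat' →
        ∀ F ∈ P.mesh.facets, ghat =ᵐ[(MsFEM.surf d).restrict (MsFEM.hull F)] ghat') ∧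
      (∀ ghat, P.IsBuiltTraction rk φs uH m ghat → P.IsProlongation rk φs uH ghat)) ∧
    -- in the conforming case the discrete solution is kinematically admissible
    (P.IsConforming φ0 φ φs → uH ∈ P.V) ∧
    -- for all tractions with the prolongation property:
    (∀ ghat, P.IsProlongation rk φs uH ghat →
      -- element equilibrium
      (∀ K ∈ P.mesh.elements,
        (∫ x in MsFEM.hull K, P.f x) + P.mesh.tractionResultant rk ghat K = 0) ∧
      -- the local Neumann problems are well posed up to constants and yield element fluxes
      (∀ K ∈ P.mesh.elements,
        (∃ w, P.IsNeumannSolution rk ghat K w) ∧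
        (∀ w w', P.IsNeumannSolution rk ghat K w → P.IsNeumannSolution rk ghat K w' →
          (∃ c : ℝ, ∀ᵐ x ∂(volume.restrict (MsFEM.hull K)), w.1 x = w'.1 x + c) ∧
          w.2 =ᵐ[volume.restrict (MsFEM.hull K)] w'.2) ∧
        (∀ w, P.IsNeumannSolution rk ghat K w → P.IsElementFlux rk ghat K (P.flux w))) ∧
      (∃ qhat, ∀ K ∈ P.mesh.elements, ∃ w, P.IsNeumannSolution rk ghat K w ∧
        qhat =ᵐ[volume.restrict (MsFEM.hull K)] P.flux w) ∧
      -- every flux assembled from element fluxes is statically admissible, and gives the bounds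
      (∀ qhat, (∀ K ∈ P.mesh.elements, P.IsElementFlux rk ghat K qhat) →
        P.IsStaticallyAdmissible qhat ∧
        (uH ∈ P.V →
          P.energyNorm (u - uH) ≤ P.cre uH qhat ∧
          P.energyNorm (u - uH) ^ 2 + P.fluxNorm (P.flux u - qhat) ^ 2 = P.cre uH qhat ^ 2) ∧
        (∀ uhat ∈ P.V,
          P.energyNorm (u - uhat) = P.cre uhat (P.flux u) ∧
          P.energyNorm (u - uhat) ≤ P.cre uhat qhat ∧
          P.energyNorm (u - uhat) ^ 2 + P.fluxNorm (P.flux u - qhat) ^ 2 = P.cre uhat qhat ^ 2 ∧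
          P.brokenEnergyNorm (u - uH) ≤ P.cre uhat qhat + P.brokenEnergyNorm (uhat - uH)))) := by
  -- From here on the two methods are treated alike: only these properties of the test functions,
  -- elementwise regularity of `uH` and the nodal equations are used, except for conforming
  -- admissibility.
  have hs : P.mesh.IsNodalBasis φs := by
    rcases hφ with ⟨h, rfl⟩ | ⟨-, rfl⟩
    · exact h.isNodalBasis hd hφ0
    · exact hφ0.isNodalBasis hd
  have hH : P.mesh.MemBrokenH1 uH := by
    intro K hK
    have hle : P.space φ ≤ MsFEM.H1 (MsFEM.openHull K) := by
      refine Submodule.span_le.2 ?_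
      rintro _ ⟨i, hi, rfl⟩
      rcases hφ with ⟨h, -⟩ | ⟨h, -⟩
      · exact (h i hi.1 K hK).1
      · exact h i hi K hK
    exact hle huH.1
  have hdisc : ∀ i ∈ P.freeNodes, P.brokenBilin uH (φs i) = P.load (φs i) := fun i hi =>
    huH.2 _ (Submodule.subset_span ⟨i, hi, rfl⟩)
  refine ⟨fun K hK => ?_, fun m hm => ⟨P.exists_isBuiltTraction hd hrk hs hH hdisc hm,
    fun ghat ghat' hg hg' F hF => P.isBuiltTraction_unique hd hs hm hg hg' hF,
    fun ghat hg => hg.isProlongation hd hs hm⟩, ?_, fun ghat hg => ?_⟩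
  · rw [MsFEM.restrict_hull]
    filter_upwards [hs.sum_eq K hK] with x hx
    exact hx.1
  · rintro ⟨-, rfl⟩
    exact P.space_le_VSpace hd hs huH.1
  have heq : ∀ K ∈ P.mesh.elements,
      (∫ x in MsFEM.hull K, P.f x) + P.mesh.tractionResultant rk ghat K = 0 := fun K hK =>
    hg.equilibrium hd hs hH hK
  have hex : ∀ K ∈ P.mesh.elements, ∃ w, P.IsNeumannSolution rk ghat K w := fun K hK =>
    MsFEM.Problem.exists_isNeumannSolution hd hg.memLp hK (heq K hK)
  refine ⟨heq, fun K hK => ⟨hex K hK, fun w w' hw hw' => hw.unique hK hw',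
    fun w hw => hw.isElementFlux hd hK⟩, ?_, fun qhat hq => ?_⟩
  · choose! w hw using hex
    obtain ⟨qhat, h⟩ := MsFEM.Problem.exists_assembled_flux (P := P) (q := fun K => P.flux (w K))
    exact ⟨qhat, fun K hK => ⟨w K, hw K hK, h K hK⟩⟩
  · have hadm := MsFEM.Problem.isStaticallyAdmissible hd hrk hg.neumann hq
    exact ⟨hadm, fun hV => ⟨hadm.energyNorm_le_cre hd hu hV, hadm.prager_synge hd hu hV⟩,
      fun uhat hV => ⟨(P.cre_flux u uhat).symm, hadm.energyNorm_le_cre hd hu hV,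
        hadm.prager_synge hd hu hV, hadm.brokenEnergyNorm_le hd hu hV hH⟩⟩
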